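/- Let $M$ be a smooth (finite-dimensional, paracompact Hausdorff) manifold, let $\tau\colon A\to M$ be a smooth affine bundle of finite rank modelled on a vector bundle $V(A)\to M$, and let $A$ carry a Lie affgebroid structure, i.e. a bi-affine map $[\cdot,\cdot]\colon \mathrm{Sec}(A)\times\mathrm{Sec}(A)\to\mathrm{Sec}(V(A))$ that is skew-symmetric and satisfies the Jacobi identity $[\alpha_1,[\alpha_2,\alpha_3]]+[\alpha_2,[\alpha_3,\alpha_1]]+[\alpha_3,[\alpha_1,\alpha_2]]=0$, together with a morphism of affine bundles $\gamma\colon A\to TM$ such that $[\alpha,fX]=f[\alpha,X]+\gamma(\alpha)(f)X$ for $\alpha\in\mathrm{Sec}(A)$, $X\in\mathrm{Sec}(V(A))$, $f\in C^\infty(M)$. Here $[\alpha,X]$ and $[X,Y]$, for $\alpha\in\mathrm{Sec}(A)$ and $X,Y\in\mathrm{Sec}(V(A))$, denote the affine-linear part $[\alpha,\beta+X]-[\alpha,\beta]$ and the bilinear part $[\alpha+X,Y]-[\alpha,Y]$ of the bracket. Let $\widehat A=(A^\dagger)^*$ be the vector hull of $A$, the dual of the vector bundle $A^\dagger$ of affine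 functions on the fibres of $A$; by evaluation, $A$ is an affine subbundle and $V(A)$ a vector subbundle of $\widehat A$. There is exactly one Lie algebroid structure on $\widehat A$ (bracket and anchor $\rho$) whose bracket and anchor restrict on $A$ to those of the Lie affgebroid. Each section $X$ of $\widehat A$ has exactly one complete lift, a smooth vector field $X^c$ on the manifold $\widehat A$ such that $X^c(f\circ\pi)=(\rho(X)f)\circ\pi$ for $f\in C^\infty(M)$, with $\pi\colon\widehat A\to M$ the projection, and $X^c(\iota_\mu)=\iota_{\mathcal L_X\mu}$ for every section $\mu$ of $A^\dagger$, where $\iota_\mu$ is the fibrewise linear function given by $\mu$ and $\langle\mathcal L_X\mu,Z\rangle=\rho(X)\langle\mu,Z\rangle-\langle\mu,[X,Z]\rangle$. For every section $X$ of $A$ or of $V(A)$, $X^c$ is tangent to the submanifold $A\subset\widehat A$, and so is the vertical lift of every section $Y$ of $V(A)$, the vector field on $\widehat A$ whose value at $p$ is the velocity at $t=0$ of $t\mapsto p+tY(\pi(p))$. Let $X^A$ and $\mathsf V^A(Y)$, the Lie affgebroid complete and vertical lifts, be their (smooth) restrictions to $A$. Then, for all $X,X_1,X_2\in\mathrm{Sec}(A)$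 and $Y,Y_1,Y_2\in\mathrm{Sec}(V(A))$, (a) $[X_1^A,X_2^A]=([X_1,X_2])^A$, (b) $[Y_1^A,Y_2^A]=([Y_1,Y_2])^A$, (c) $[X^A,\mathsf V^A(Y)]=\mathsf V^A([X,Y])$, (d) $[\mathsf V^A(Y_1),\mathsf V^A(Y_2)]=0$, where the brackets on the left-hand sides are the brackets of vector fields on the manifold $A$. -/

import Mathlib

open Bundle Set Module
open scoped Manifold ContDiff Bundle Topology

noncomputable section

/-! ### The vector hull of an affine space -/

section AffineSpace

variable {V A : Type*} [AddCommGroup V] [Module ℝ V] [AddTorsor V A]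

/-- The embedding of an affine space `A` into its vector hull, the dual of the space of affine
functions on `A`: a point `a` goes to the evaluation `f ↦ f a`. -/
def hullPoint : A →ᵃ[ℝ] Dual ℝ (A →ᵃ[ℝ] ℝ) where
  toFun a :=
    { toFun := fun f => f a
      map_add' := fun _ _ => rfl
      map_smul' := fun _ _ => rfl }
  linear :=
    { toFun := fun v =>
        { toFun := fun f => f.linear v
          map_add' := fun _ _ => rfl
          map_smul' := fun _ _ => rfl }
      map_add' := fun v w => by ext f; simp
      map_smul' := fun c v => by ext f; simp }
  map_vadd' a v := by ext f; simp

/-- The linear part of `hullPoint`: a vector `v` goes to the functional `f ↦ f.linear v`. -/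
def hullVector : V →ₗ[ℝ] Dual ℝ (A →ᵃ[ℝ] ℝ) := (hullPoint (V := V) (A := A)).linear

@[simp] theorem hullPoint_apply (a : A) (f : A →ᵃ[ℝ] ℝ) : hullPoint (V := V) a f = f a := rfl

@[simp] theorem hullVector_apply (v : V) (f : A →ᵃ[ℝ] ℝ) :
    hullVector (V := V) (A := A) v f = f.linear v := rfl

theorem hullPoint_vadd (v : V) (a : A) :
    hullPoint (V := V) (v +ᵥ a) = hullVector v + hullPoint a := by
  ext f
  exact f.map_vadd a v

/-- The affine function `a ↦ μ (a - a₀) + c`. -/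
def affFun (a₀ : A) (μ : Dual ℝ V) (c : ℝ) : A →ᵃ[ℝ] ℝ where
  toFun a := μ (a -ᵥ a₀) + c
  linear := μ
  map_vadd' a v := by simp [vadd_vsub_assoc, add_assoc]

theorem affFun_eq (a₀ : A) (f : A →ᵃ[ℝ] ℝ) : affFun a₀ f.linear (f a₀) = f := by
  ext a
  have := f.map_vadd a₀ (a -ᵥ a₀)
  simp only [vsub_vadd, vadd_eq_add] at this
  rw [this]; rfl

/-- A point `a₀` splits the vector hull: every element is uniquely `v + s • a₀` with a vector `v`
and a real number `s`. -/
def hullEquiv [Module.Finite ℝ V] (a₀ : A) : Dual ℝ (A →ᵃ[ℝ] ℝ) ≃ₗ[ℝ] V × ℝ where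
  toFun α :=
    ((Module.evalEquiv ℝ V).symm
      { toFun := fun μ => α (affFun a₀ μ 0)
        map_add' := fun μ ν => by
          rw [← map_add]; congr 1; ext a; simp [affFun]
        map_smul' := fun c μ => by
          rw [RingHom.id_apply, ← map_smul]; congr 1; ext a; simp [affFun] },
      α (AffineMap.const ℝ A 1))
  map_add' α β := by
    ext
    · simp only [Prod.fst_add]
      rw [← map_add]
      rfl
    · rfl
  map_smul' c α := by
    ext
    · simp only [Prod.smul_fst, RingHom.id_apply]
      rw [← map_smul]
      rfl
    · rfl
  invFun p := hullVector p.1 + p.2 • hullPoint a₀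
  left_inv α := by
    ext f
    have h : ∀ (φ : Dual ℝ (Dual ℝ V)) (μ : Dual ℝ V), μ ((Module.evalEquiv ℝ V).symm φ) = φ μ :=
      fun φ μ => Module.apply_evalEquiv_symm_apply ℝ V μ φ
    simp only [LinearMap.add_apply, hullVector_apply, LinearMap.smul_apply, hullPoint_apply,
      smul_eq_mul]
    rw [h]
    change α (affFun a₀ f.linear 0) + α (AffineMap.const ℝ A 1) * f a₀ = α f
    rw [mul_comm, ← smul_eq_mul, ← map_smul, ← map_add]
    congr 1
    conv_rhs => rw [← affFun_eq a₀ f]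
    ext a
    simp [affFun]
  right_inv p := by
    ext
    · simp only
      rw [LinearEquiv.symm_apply_eq]
      ext μ
      simp [affFun]
    · simp

@[simp] theorem hullEquiv_symm_apply [Module.Finite ℝ V] (a₀ : A) (p : V × ℝ) :
    (hullEquiv a₀).symm p = hullVector p.1 + p.2 • hullPoint a₀ := rfl

theorem hullEquiv_hullPoint [Module.Finite ℝ V] (a₀ a : A) :
    hullEquiv a₀ (hullPoint (V := V) a) = (a -ᵥ a₀, 1) := by
  rw [← LinearEquiv.eq_symm_apply]
  ext f
  have := f.map_vadd a₀ (a -ᵥ a₀)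
  simp

theorem hullEquiv_hullVector [Module.Finite ℝ V] (a₀ : A) (v : V) :
    hullEquiv a₀ (hullVector v) = (v, 0) := by
  rw [← LinearEquiv.eq_symm_apply]
  simp

end AffineSpace

/-! ### Smooth affine bundles and their sections -/

/-- `A` is a smooth affine bundle over the smooth manifold `M`, modelled on the smooth vector
bundle `V`: the fibres `A x` are affine spaces over `V x`, the total space of `A` is a smooth
manifold (given with its atlas; that the atlas is smooth is a separate `IsManifold` instance), and
locally over `M` there are (local) sections `σ` of `A` such that the fibrewise
translations `v ↦ v + σ` and `a ↦ a - σ` are mutually inverse diffeomorphisms between the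
restrictions of `V` and `A`. -/
class SmoothAffineBundle (EM : Type*) [NormedAddCommGroup EM] [NormedSpace ℝ EM]
    {M : Type*} [TopologicalSpace M] [ChartedSpace EM M]
    (F : Type*) [NormedAddCommGroup F] [NormedSpace ℝ F]
    (V : M → Type*) [∀ x, AddCommGroup (V x)] [∀ x, Module ℝ (V x)]
    [∀ x, TopologicalSpace (V x)] [TopologicalSpace (TotalSpace F V)] [FiberBundle F V]
    [VectorBundle ℝ F V]
    (A : M → Type*) [∀ x, AddTorsor (V x) (A x)] [TopologicalSpace (TotalSpace F A)]
    [ChartedSpace (ModelProd EM F) (TotalSpace F A)] : Prop where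
  continuous_proj : Continuous (π F A)
  exists_local : ∀ x₀ : M, ∃ U : Set M, IsOpen U ∧ x₀ ∈ U ∧ ∃ σ : ∀ x, A x,
    ContMDiffOn (𝓘(ℝ, EM).prod 𝓘(ℝ, F)) (𝓘(ℝ, EM).prod 𝓘(ℝ, F)) ∞
      (fun p : TotalSpace F V => TotalSpace.mk' F p.1 (p.2 +ᵥ σ p.1 : A p.1)) (π F V ⁻¹' U) ∧
    ContMDiffOn (𝓘(ℝ, EM).prod 𝓘(ℝ, F)) (𝓘(ℝ, EM).prod 𝓘(ℝ, F)) ∞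
      (fun a : TotalSpace F A => TotalSpace.mk' F a.1 (a.2 -ᵥ σ a.1 : V a.1)) (π F A ⁻¹' U)

/-- Global smooth sections of an affine bundle `A` modelled on `V`. -/
@[ext] structure AffineSection (EM : Type*) [NormedAddCommGroup EM] [NormedSpace ℝ EM]
    {M : Type*} [TopologicalSpace M] [ChartedSpace EM M]
    (F : Type*) [NormedAddCommGroup F] [NormedSpace ℝ F]
    (V : M → Type*) [∀ x, AddCommGroup (V x)]
    (A : M → Type*) [∀ x, AddTorsor (V x) (A x)] [TopologicalSpace (TotalSpace F A)]
    [ChartedSpace (ModelProd EM F) (TotalSpace F A)] where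
  /-- the underlying function -/
  toFun : ∀ x, A x
  contMDiff_toFun : ContMDiff 𝓘(ℝ, EM) (𝓘(ℝ, EM).prod 𝓘(ℝ, F)) ∞
    (fun x => TotalSpace.mk' F x (toFun x))

theorem exists_localSection (EM : Type*) [NormedAddCommGroup EM] [NormedSpace ℝ EM]
    {M : Type*} [TopologicalSpace M] [ChartedSpace EM M]
    (F : Type*) [NormedAddCommGroup F] [NormedSpace ℝ F]
    (V : M → Type*) [∀ x, AddCommGroup (V x)] [∀ x, Module ℝ (V x)]
    [∀ x, TopologicalSpace (V x)] [TopologicalSpace (TotalSpace F V)] [FiberBundle F V]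
    [VectorBundle ℝ F V]
    (A : M → Type*) [∀ x, AddTorsor (V x) (A x)] [TopologicalSpace (TotalSpace F A)]
    [ChartedSpace (ModelProd EM F) (TotalSpace F A)] [SmoothAffineBundle EM F V A] (x₀ : M) : ∃ U : Set M, IsOpen U ∧ x₀ ∈ U ∧ ∃ σ : ∀ x, A x,
    ContMDiffOn 𝓘(ℝ, EM) (𝓘(ℝ, EM).prod 𝓘(ℝ, F)) ∞ (fun x => TotalSpace.mk' F x (σ x)) U := by
  obtain ⟨U, hU, hx, σ, h, -⟩ := SmoothAffineBundle.exists_local (EM := EM) (F := F) (V := V)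
    (A := A) x₀
  refine ⟨U, hU, hx, σ, ?_⟩
  have h0 := (Bundle.contMDiff_zeroSection ℝ V (IB := 𝓘(ℝ, EM)) (F := F) (n := ∞)).contMDiffOn
    (s := U)
  have := h.comp h0 (fun x hx => hx)
  refine this.congr fun x _ => ?_
  exact congrArg (TotalSpace.mk' F x) (zero_vadd (V x) (σ x)).symm

section AffineBundle

variable {EM : Type*} [NormedAddCommGroup EM] [NormedSpace ℝ EM]
  {M : Type*} [TopologicalSpace M] [ChartedSpace EM M]
  {F : Type*} [NormedAddCommGroup F] [NormedSpace ℝ F]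
  {V : M → Type*} [∀ x, AddCommGroup (V x)] [∀ x, Module ℝ (V x)]
  [∀ x, TopologicalSpace (V x)] [TopologicalSpace (TotalSpace F V)] [FiberBundle F V]
  [VectorBundle ℝ F V]
  {A : M → Type*} [∀ x, AddTorsor (V x) (A x)] [TopologicalSpace (TotalSpace F A)]
  [ChartedSpace (ModelProd EM F) (TotalSpace F A)] [SmoothAffineBundle EM F V A]

instance instCoeFunAffineSection : CoeFun (AffineSection EM F V A) (fun _ => ∀ x, A x) :=
  ⟨AffineSection.toFun⟩

theorem contMDiffAt_vsub {s t : ∀ x, A x} {x₀ : M}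
    (hs : ContMDiffAt 𝓘(ℝ, EM) (𝓘(ℝ, EM).prod 𝓘(ℝ, F)) ∞ (fun x => TotalSpace.mk' F x (s x)) x₀)
    (ht : ContMDiffAt 𝓘(ℝ, EM) (𝓘(ℝ, EM).prod 𝓘(ℝ, F)) ∞ (fun x => TotalSpace.mk' F x (t x)) x₀) :
    ContMDiffAt 𝓘(ℝ, EM) (𝓘(ℝ, EM).prod 𝓘(ℝ, F)) ∞
      (fun x => TotalSpace.mk' F x (s x -ᵥ t x : V x)) x₀ := by
  obtain ⟨U, hU, hx, σ, -, h⟩ := SmoothAffineBundle.exists_local (EM := EM) (F := F) (V := V)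
    (A := A) x₀
  have hop : IsOpen (π F A ⁻¹' U) :=
    hU.preimage (SmoothAffineBundle.continuous_proj EM (V := V))
  have key : ∀ r : ∀ x, A x, ContMDiffAt 𝓘(ℝ, EM) (𝓘(ℝ, EM).prod 𝓘(ℝ, F)) ∞
      (fun x => TotalSpace.mk' F x (r x)) x₀ → ContMDiffAt 𝓘(ℝ, EM) (𝓘(ℝ, EM).prod 𝓘(ℝ, F)) ∞
      (fun x => TotalSpace.mk' F x (r x -ᵥ σ x : V x)) x₀ := fun r hr =>
    (h.contMDiffAt (hop.mem_nhds (x := TotalSpace.mk' F x₀ (r x₀)) hx)).comp x₀ hr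
  have := (key s hs).sub_section (key t ht)
  refine this.congr_of_eventuallyEq (Filter.Eventually.of_forall fun x => ?_)
  simp

theorem contMDiffAt_vadd {v : ∀ x, V x} {s : ∀ x, A x} {x₀ : M}
    (hv : ContMDiffAt 𝓘(ℝ, EM) (𝓘(ℝ, EM).prod 𝓘(ℝ, F)) ∞ (fun x => TotalSpace.mk' F x (v x)) x₀)
    (hs : ContMDiffAt 𝓘(ℝ, EM) (𝓘(ℝ, EM).prod 𝓘(ℝ, F)) ∞ (fun x => TotalSpace.mk' F x (s x)) x₀) :
    ContMDiffAt 𝓘(ℝ, EM) (𝓘(ℝ, EM).prod 𝓘(ℝ, F)) ∞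
      (fun x => TotalSpace.mk' F x (v x +ᵥ s x : A x)) x₀ := by
  obtain ⟨U, hU, hx, σ, h', h⟩ := SmoothAffineBundle.exists_local (EM := EM) (F := F) (V := V)
    (A := A) x₀
  have hop : IsOpen (π F A ⁻¹' U) :=
    hU.preimage (SmoothAffineBundle.continuous_proj EM (V := V))
  have hop' : IsOpen (π F V ⁻¹' U) := hU.preimage (FiberBundle.continuous_proj F V)
  have h1 : ContMDiffAt 𝓘(ℝ, EM) (𝓘(ℝ, EM).prod 𝓘(ℝ, F)) ∞
      (fun x => TotalSpace.mk' F x (s x -ᵥ σ x : V x)) x₀ :=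
    (h.contMDiffAt (hop.mem_nhds (x := TotalSpace.mk' F x₀ (s x₀)) hx)).comp x₀ hs
  have h2 := hv.add_section h1
  have := (h'.contMDiffAt (hop'.mem_nhds (x := TotalSpace.mk' F x₀ (v x₀ + (s x₀ -ᵥ σ x₀)))
    hx)).comp x₀ h2
  refine this.congr_of_eventuallyEq (Filter.Eventually.of_forall fun x => ?_)
  simp [add_vadd]

end AffineBundle

/-! ### The vector hull of an affine bundle -/

/-- The vector hull of an affine bundle `A`: the vector bundle whose fibre at `x` is the dual of the
space of affine functions on `A x`. -/
def VectorHull (EM : Type*) [NormedAddCommGroup EM] [NormedSpace ℝ EM]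
    {M : Type*} [TopologicalSpace M] [ChartedSpace EM M]
    (F : Type*) [NormedAddCommGroup F] [NormedSpace ℝ F]
    (V : M → Type*) [∀ x, AddCommGroup (V x)] [∀ x, Module ℝ (V x)]
    (A : M → Type*) [∀ x, AddTorsor (V x) (A x)] (x : M) : Type _ :=
  Dual ℝ (A x →ᵃ[ℝ] ℝ)

theorem finite_fiber {M : Type*} [TopologicalSpace M]
    (F : Type*) [NormedAddCommGroup F] [NormedSpace ℝ F] [FiniteDimensional ℝ F]
    (V : M → Type*) [∀ x, AddCommGroup (V x)] [∀ x, Module ℝ (V x)]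
    [∀ x, TopologicalSpace (V x)] [TopologicalSpace (TotalSpace F V)] [FiberBundle F V]
    [VectorBundle ℝ F V] (x : M) : Module.Finite ℝ (V x) :=
  Module.Finite.equiv ((trivializationAt F V x).linearEquivAt ℝ x
    (FiberBundle.mem_baseSet_trivializationAt' x)).symm

/-- The linear map `(w, s) ↦ (L w + s • c, s)` as a function of `(L, c)`. -/
def hullCoordChange (F : Type*) [NormedAddCommGroup F] [NormedSpace ℝ F]
    (q : (F →L[ℝ] F) × F) : (F × ℝ) →L[ℝ] (F × ℝ) :=
  (ContinuousLinearMap.inl ℝ F ℝ).comp (q.1.comp (ContinuousLinearMap.fst ℝ F ℝ) +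
      (ContinuousLinearMap.snd ℝ F ℝ).smulRight q.2) +
    (ContinuousLinearMap.inr ℝ F ℝ).comp (ContinuousLinearMap.snd ℝ F ℝ)

theorem hullCoordChange_apply (F : Type*) [NormedAddCommGroup F] [NormedSpace ℝ F]
    (q : (F →L[ℝ] F) × F) (v : F × ℝ) :
    hullCoordChange F q v = (q.1 v.1 + v.2 • q.2, v.2) := by
  simp [hullCoordChange]

theorem hullCoordChange_contDiff (F : Type*) [NormedAddCommGroup F] [NormedSpace ℝ F] :
    ContDiff ℝ ∞ (hullCoordChange F) := by
  have a1 : ContDiff ℝ ∞ (fun q : (F →L[ℝ] F) × F =>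
      q.1.comp (ContinuousLinearMap.fst ℝ F ℝ)) :=
    contDiff_fst.clm_comp contDiff_const
  have a2 : ContDiff ℝ ∞ (fun q : (F →L[ℝ] F) × F =>
      (ContinuousLinearMap.snd ℝ F ℝ).smulRight q.2) :=
    contDiff_const.smulRight contDiff_snd
  exact (contDiff_const.clm_comp (a1.add a2)).add contDiff_const

section VectorHull

set_option linter.unusedSectionVars false
set_option linter.style.haveILetI false

variable (EM : Type*) [NormedAddCommGroup EM] [NormedSpace ℝ EM]
  {M : Type*} [TopologicalSpace M] [ChartedSpace EM M] [IsManifold 𝓘(ℝ, EM) ∞ M]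
  (F : Type*) [NormedAddCommGroup F] [NormedSpace ℝ F] [FiniteDimensional ℝ F]
  (V : M → Type*) [∀ x, AddCommGroup (V x)] [∀ x, Module ℝ (V x)]
  [∀ x, TopologicalSpace (V x)] [TopologicalSpace (TotalSpace F V)] [FiberBundle F V]
  [VectorBundle ℝ F V] [ContMDiffVectorBundle ∞ F V 𝓘(ℝ, EM)]
  (A : M → Type*) [∀ x, AddTorsor (V x) (A x)] [TopologicalSpace (TotalSpace F A)]
  [ChartedSpace (ModelProd EM F) (TotalSpace F A)] [SmoothAffineBundle EM F V A]

instance VectorHull.instAddCommGroup (x : M) : AddCommGroup (VectorHull EM F V A x) :=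
  inferInstanceAs (AddCommGroup (Dual ℝ (A x →ᵃ[ℝ] ℝ)))

instance VectorHull.instModule (x : M) : Module ℝ (VectorHull EM F V A x) :=
  inferInstanceAs (Module ℝ (Dual ℝ (A x →ᵃ[ℝ] ℝ)))

/-- The canonical linear topology of the (finite-dimensional) fibres of the vector hull. -/
instance VectorHull.instTopologicalSpace (x : M) : TopologicalSpace (VectorHull EM F V A x) :=
  moduleTopology ℝ (VectorHull EM F V A x)

instance VectorHull.instIsModuleTopology (x : M) : IsModuleTopology ℝ (VectorHull EM F V A x) :=
  ⟨rfl⟩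


variable {EM F V A}

/-- The splitting of the fibre of the vector hull given by a point of the fibre of `A`. -/
def VectorHull.split {x : M} (a : A x) : VectorHull EM F V A x ≃ₗ[ℝ] V x × ℝ :=
  haveI := finite_fiber F V x
  hullEquiv a

/-- The local trivialization of the vector hull given by a local section `σ` of `A` over the open
set `U` and a local trivialization `e` of `V`: in a fibre, `v + s • σ` goes to `(e v, s)`. -/
def VectorHull.pretriv {U : Set M} (hU : IsOpen U) (σ : ∀ x, A x)
    (e : Trivialization F (π F V)) [MemTrivializationAtlas e] :
    Pretrivialization (F × ℝ) (π (F × ℝ) (VectorHull EM F V A)) where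
  toFun p := (p.1, e.linearMapAt ℝ p.1 (VectorHull.split (σ p.1) p.2).1,
    (VectorHull.split (σ p.1) p.2).2)
  invFun q := ⟨q.1, (VectorHull.split (σ q.1)).symm (e.symmₗ ℝ q.1 q.2.1, q.2.2)⟩
  source := π (F × ℝ) (VectorHull EM F V A) ⁻¹' (U ∩ e.baseSet)
  target := (U ∩ e.baseSet) ×ˢ univ
  map_source' p hp := ⟨hp, mem_univ _⟩
  map_target' q hq := hq.1
  left_inv' p hp := by
    obtain ⟨x, α⟩ := p
    have hx : x ∈ e.baseSet := hp.2
    simp [hx]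
  right_inv' q hq := by
    obtain ⟨x, w, s⟩ := q
    have hx : x ∈ e.baseSet := hq.1.2
    simp [hx]
  open_target := (hU.inter e.open_baseSet).prod isOpen_univ
  baseSet := U ∩ e.baseSet
  open_baseSet := hU.inter e.open_baseSet
  source_eq := rfl
  target_eq := rfl
  proj_toFun _ _ := rfl

theorem VectorHull.pretriv_apply {U : Set M} (hU : IsOpen U) (σ : ∀ x, A x)
    (e : Trivialization F (π F V)) [MemTrivializationAtlas e]
    (p : TotalSpace (F × ℝ) (VectorHull EM F V A)) :
    VectorHull.pretriv hU σ e p = (p.1, e.linearMapAt ℝ p.1 (VectorHull.split (σ p.1) p.2).1,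
      (VectorHull.split (σ p.1) p.2).2) := rfl

theorem VectorHull.pretriv_symm {U : Set M} (hU : IsOpen U) (σ : ∀ x, A x)
    (e : Trivialization F (π F V)) [MemTrivializationAtlas e] {x : M} (hx : x ∈ U ∩ e.baseSet)
    (w : F × ℝ) :
    (VectorHull.pretriv (EM := EM) hU σ e).symm x w =
      (VectorHull.split (σ x)).symm (e.symmₗ ℝ x w.1, w.2) := by
  rw [Pretrivialization.symm_apply (b := x) _ hx]
  rfl

theorem VectorHull.split_split_symm {x : M} (a b : A x) (v : V x) (s : ℝ) :
    VectorHull.split (EM := EM) (F := F) b ((VectorHull.split a).symm (v, s)) =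
      (v + s • (a -ᵥ b), s) := by
  haveI := finite_fiber F V x
  have h : ((VectorHull.split (EM := EM) (F := F) a).symm (v, s)) =
      (hullVector v + s • hullPoint a : Dual ℝ (A x →ᵃ[ℝ] ℝ)) := rfl
  rw [h]
  change hullEquiv b (hullVector v + s • hullPoint a : Dual ℝ (A x →ᵃ[ℝ] ℝ)) = _
  rw [map_add, map_smul, hullEquiv_hullVector, hullEquiv_hullPoint]
  simp

theorem VectorHull.exists_coordChange {U U' : Set M} (hU : IsOpen U) (hU' : IsOpen U')
    {σ σ' : ∀ x, A x}
    (hσ : ContMDiffOn 𝓘(ℝ, EM) (𝓘(ℝ, EM).prod 𝓘(ℝ, F)) ∞ (fun x => TotalSpace.mk' F x (σ x)) U)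
    (hσ' : ContMDiffOn 𝓘(ℝ, EM) (𝓘(ℝ, EM).prod 𝓘(ℝ, F)) ∞ (fun x => TotalSpace.mk' F x (σ' x)) U')
    (e e' : Trivialization F (π F V)) [MemTrivializationAtlas e] [MemTrivializationAtlas e'] :
    ∃ f : M → (F × ℝ) →L[ℝ] (F × ℝ),
      ContMDiffOn 𝓘(ℝ, EM) 𝓘(ℝ, (F × ℝ) →L[ℝ] (F × ℝ)) ∞ f
        ((VectorHull.pretriv (EM := EM) hU σ e).baseSet ∩
          (VectorHull.pretriv (EM := EM) hU' σ' e').baseSet) ∧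
      ∀ b ∈ (VectorHull.pretriv (EM := EM) hU σ e).baseSet ∩
          (VectorHull.pretriv (EM := EM) hU' σ' e').baseSet, ∀ v : F × ℝ,
        f b v = (VectorHull.pretriv (EM := EM) hU' σ' e'
          ⟨b, (VectorHull.pretriv (EM := EM) hU σ e).symm b v⟩).2 := by
  refine ⟨fun x => hullCoordChange F
    ((e.coordChangeL ℝ e' x : F →L[ℝ] F), (e' ⟨x, σ x -ᵥ σ' x⟩).2), ?_, ?_⟩
  · rintro x ⟨⟨hxU, hxe⟩, ⟨hxU', hxe'⟩⟩
    apply ContMDiffAt.contMDiffWithinAt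
    have h1 : ContMDiffAt 𝓘(ℝ, EM) 𝓘(ℝ, F →L[ℝ] F) ∞
        (fun x => (e.coordChangeL ℝ e' x : F →L[ℝ] F)) x :=
      contMDiffAt_coordChangeL hxe hxe'
    have h2 : ContMDiffAt 𝓘(ℝ, EM) 𝓘(ℝ, F) ∞ (fun x => (e' ⟨x, σ x -ᵥ σ' x⟩).2) x :=
      (e'.contMDiffAt_section_iff hxe').1 (contMDiffAt_vsub
        (hσ.contMDiffAt (hU.mem_nhds hxU)) (hσ'.contMDiffAt (hU'.mem_nhds hxU')))
    exact (hullCoordChange_contDiff F).contMDiff.contMDiffAt.comp x (h1.prodMk_space h2)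
  · rintro x ⟨hx, hx'⟩ v
    have hxe : x ∈ e.baseSet := hx.2
    have hxe' : x ∈ e'.baseSet := hx'.2
    rw [VectorHull.pretriv_symm hU σ e hx, VectorHull.pretriv_apply]
    simp only [VectorHull.split_split_symm, hullCoordChange_apply]
    ext
    · simp [Trivialization.coordChangeL_apply, hxe, hxe', Trivialization.symmₗ_apply,
        Trivialization.linearMapAt_apply]
      have key := e'.linear ℝ hxe'
      rw [key.map_add, key.map_smul]
    · simp

variable (EM F V A) in
/-- The vector bundle structure of the vector hull, given by all the local trivializations coming
from smooth local sections of `A` and local trivializations of `V`. -/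
def VectorHull.prebundle : VectorPrebundle ℝ (F × ℝ) (VectorHull EM F V A) where
  pretrivializationAtlas :=
    {p | ∃ (U : Set M) (hU : IsOpen U) (σ : ∀ x, A x) (e : Trivialization F (π F V))
      (_ : MemTrivializationAtlas e),
      ContMDiffOn 𝓘(ℝ, EM) (𝓘(ℝ, EM).prod 𝓘(ℝ, F)) ∞ (fun x => TotalSpace.mk' F x (σ x)) U ∧
      p = VectorHull.pretriv hU σ e}
  pretrivialization_linear' := by
    rintro _ ⟨U, hU, σ, e, _, -, rfl⟩
    exact ⟨fun x _ => ⟨fun α β => by simp [VectorHull.pretriv_apply],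
      fun c α => by simp [VectorHull.pretriv_apply]⟩⟩
  pretrivializationAt x :=
    VectorHull.pretriv (exists_localSection EM F V A x).choose_spec.1
      (exists_localSection EM F V A x).choose_spec.2.2.choose (trivializationAt F V x)
  mem_base_pretrivializationAt x :=
    ⟨(exists_localSection EM F V A x).choose_spec.2.1,
      FiberBundle.mem_baseSet_trivializationAt' x⟩
  pretrivialization_mem_atlas x :=
    ⟨_, _, _, _, inferInstance, (exists_localSection EM F V A x).choose_spec.2.2.choose_spec, rfl⟩
  exists_coordChange := by
    rintro _ ⟨U, hU, σ, e, _, hσ, rfl⟩ _ ⟨U', hU', σ', e', _, hσ', rfl⟩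
    obtain ⟨f, hf, h⟩ := VectorHull.exists_coordChange hU hU' hσ hσ' e e'
    exact ⟨f, hf.continuousOn, h⟩
  totalSpaceMk_isInducing x := by
    set σ := (exists_localSection EM F V A x).choose_spec.2.2.choose
    set e := trivializationAt F V x
    have hx : x ∈ e.baseSet := FiberBundle.mem_baseSet_trivializationAt' x
    have h1 : IsModuleTopology ℝ (F × ℝ) := by
      haveI : IsModuleTopology ℝ F := isModuleTopologyOfFiniteDimensional
      infer_instance
    let E : VectorHull EM F V A x ≃ₗ[ℝ] F × ℝ :=
      (VectorHull.split (σ x)).trans ((e.linearEquivAt ℝ x hx).prodCongr (LinearEquiv.refl ℝ ℝ))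
    have hc : Continuous E := IsModuleTopology.continuous_of_linearMap E.toLinearMap
    haveI : ContinuousAdd (VectorHull EM F V A x) := IsModuleTopology.toContinuousAdd ℝ _
    have hc' : Continuous E.symm := IsModuleTopology.continuous_of_linearMap E.symm.toLinearMap
    let E' : VectorHull EM F V A x ≃ₜ F × ℝ := ⟨E.toEquiv, hc, hc'⟩
    have h2 : Topology.IsInducing (fun w : F × ℝ => (x, w)) := by
      exact Topology.isInducing_const_prod.2 Topology.IsInducing.id
    convert h2.comp E'.isInducing using 1
    ext α <;> simp [VectorHull.pretriv_apply, E', E, Trivialization.linearMapAt_apply, hx, e, σ]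

instance VectorHull.instTopologicalSpaceTotalSpace :
    TopologicalSpace (TotalSpace (F × ℝ) (VectorHull EM F V A)) :=
  (VectorHull.prebundle EM F V A).totalSpaceTopology

instance VectorHull.instFiberBundle : FiberBundle (F × ℝ) (VectorHull EM F V A) :=
  (VectorHull.prebundle EM F V A).toFiberBundle

instance VectorHull.instVectorBundle : VectorBundle ℝ (F × ℝ) (VectorHull EM F V A) :=
  (VectorHull.prebundle EM F V A).toVectorBundle

instance VectorHull.instPrebundleIsContMDiff :
    (VectorHull.prebundle EM F V A).IsContMDiff 𝓘(ℝ, EM) ∞ where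
  exists_contMDiffCoordChange := by
    rintro _ ⟨U, hU, σ, e, _, hσ, rfl⟩ _ ⟨U', hU', σ', e', _, hσ', rfl⟩
    exact VectorHull.exists_coordChange hU hU' hσ hσ' e e'

instance VectorHull.instContMDiffVectorBundle :
    ContMDiffVectorBundle ∞ (F × ℝ) (VectorHull EM F V A) 𝓘(ℝ, EM) :=
  (VectorHull.prebundle EM F V A).contMDiffVectorBundle 𝓘(ℝ, EM)

/-- The inclusion of the fibres of `A` as affine subspaces of the fibres of the vector hull. -/
def VectorHull.point (x : M) : A x →ᵃ[ℝ] VectorHull EM F V A x :=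
  (hullPoint : A x →ᵃ[ℝ] Dual ℝ (A x →ᵃ[ℝ] ℝ))

/-- The inclusion of the fibres of `V` as linear subspaces of the fibres of the vector hull. -/
def VectorHull.vector (x : M) : V x →ₗ[ℝ] VectorHull EM F V A x :=
  (hullVector : V x →ₗ[ℝ] Dual ℝ (A x →ᵃ[ℝ] ℝ))

variable (EM F V A) in
/-- The inclusion of the total space of `A` into the total space of its vector hull. -/
def VectorHull.embed (a : TotalSpace F A) : TotalSpace (F × ℝ) (VectorHull EM F V A) :=
  ⟨a.1, VectorHull.point a.1 a.2⟩

theorem VectorHull.split_point {x : M} (a b : A x) :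
    VectorHull.split a (VectorHull.point (EM := EM) (F := F) x b) = (b -ᵥ a, 1) :=
  haveI := finite_fiber F V x
  hullEquiv_hullPoint a b

theorem VectorHull.split_vector {x : M} (a : A x) (v : V x) :
    VectorHull.split a (VectorHull.vector (EM := EM) (F := F) x v) = (v, 0) :=
  haveI := finite_fiber F V x
  hullEquiv_hullVector a v

/-- The trivializations of the vector hull are indeed given by `VectorHull.pretriv`. -/
theorem VectorHull.exists_trivialization {U : Set M} (hU : IsOpen U) {σ : ∀ x, A x}
    (hσ : ContMDiffOn 𝓘(ℝ, EM) (𝓘(ℝ, EM).prod 𝓘(ℝ, F)) ∞ (fun x => TotalSpace.mk' F x (σ x)) U)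
    (e : Trivialization F (π F V)) [MemTrivializationAtlas e] :
    ∃ (t : Trivialization (F × ℝ) (π (F × ℝ) (VectorHull EM F V A))),
      MemTrivializationAtlas t ∧ t.baseSet = U ∩ e.baseSet ∧
      ∀ p, t p = VectorHull.pretriv hU σ e p := by
  have h : VectorHull.pretriv hU σ e ∈ (VectorHull.prebundle EM F V A).pretrivializationAtlas :=
    ⟨U, hU, σ, e, inferInstance, hσ, rfl⟩
  refine ⟨(VectorHull.prebundle EM F V A).trivializationOfMemPretrivializationAtlas h,
    ⟨?_⟩, rfl, fun p => rfl⟩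
  exact ⟨_, h, rfl⟩

theorem VectorHull.contMDiff_vector : ContMDiff (𝓘(ℝ, EM).prod 𝓘(ℝ, F))
    (𝓘(ℝ, EM).prod 𝓘(ℝ, F × ℝ)) ∞ (fun v : TotalSpace F V =>
      (⟨v.1, VectorHull.vector v.1 v.2⟩ : TotalSpace (F × ℝ) (VectorHull EM F V A))) := by
  rintro ⟨x, v⟩
  obtain ⟨U, hU, hx, σ, hσ⟩ := exists_localSection EM F V A x
  let e := trivializationAt F V x
  have hxe : x ∈ e.baseSet := FiberBundle.mem_baseSet_trivializationAt' x
  obtain ⟨t, _, hb, ht⟩ := VectorHull.exists_trivialization hU hσ e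
  rw [t.contMDiffAt_iff (by rw [t.mem_source, hb]; exact ⟨hx, hxe⟩)]
  refine ⟨Bundle.contMDiffAt_proj V, ?_⟩
  have h1 : ContMDiffAt (𝓘(ℝ, EM).prod 𝓘(ℝ, F)) 𝓘(ℝ, F) ∞ (fun p : TotalSpace F V => (e p).2)
      ⟨x, v⟩ := ((e.contMDiffAt_iff (by rw [e.mem_source]; exact hxe)).1 contMDiffAt_id).2
  have h2 := h1.prodMk_space (contMDiffAt_const (c := (0 : ℝ)))
  refine h2.congr_of_eventuallyEq ?_
  have : (π F V ⁻¹' e.baseSet) ∈ 𝓝 (⟨x, v⟩ : TotalSpace F V) :=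
    (e.open_baseSet.preimage (FiberBundle.continuous_proj F V)).mem_nhds hxe
  filter_upwards [this] with p hp
  have hp' : p.1 ∈ e.baseSet := hp
  rw [ht, VectorHull.pretriv_apply]
  simp only [VectorHull.split_vector]
  simp [Trivialization.linearMapAt_apply, hp']

theorem VectorHull.contMDiff_embed : ContMDiff (𝓘(ℝ, EM).prod 𝓘(ℝ, F))
    (𝓘(ℝ, EM).prod 𝓘(ℝ, F × ℝ)) ∞ (VectorHull.embed EM F V A) := by
  rintro ⟨x, a⟩
  obtain ⟨U, hU, hx, σ, h', h⟩ := SmoothAffineBundle.exists_local (EM := EM) (F := F) (V := V)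
    (A := A) x
  have hσ : ContMDiffOn 𝓘(ℝ, EM) (𝓘(ℝ, EM).prod 𝓘(ℝ, F)) ∞ (fun x => TotalSpace.mk' F x (σ x)) U := by
    have h0 := (Bundle.contMDiff_zeroSection ℝ V (IB := 𝓘(ℝ, EM)) (F := F) (n := ∞)).contMDiffOn
      (s := U)
    refine (h'.comp h0 (fun x hx => hx)).congr fun x _ => ?_
    exact congrArg (TotalSpace.mk' F x) (zero_vadd (V x) (σ x)).symm
  let e := trivializationAt F V x
  have hxe : x ∈ e.baseSet := FiberBundle.mem_baseSet_trivializationAt' x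
  have hcont : Continuous (π F A) := SmoothAffineBundle.continuous_proj EM (V := V)
  obtain ⟨t, _, hb, ht⟩ := VectorHull.exists_trivialization hU hσ e
  rw [t.contMDiffAt_iff (by rw [t.mem_source, hb]; exact ⟨hx, hxe⟩)]
  have h3 := h.contMDiffAt (x := ⟨x, a⟩) ((hU.preimage hcont).mem_nhds hx)
  refine ⟨(Bundle.contMDiffAt_proj V (n := ∞)).comp (⟨x, a⟩ : TotalSpace F A) h3, ?_⟩
  have h1 : ContMDiffAt (𝓘(ℝ, EM).prod 𝓘(ℝ, F)) 𝓘(ℝ, F) ∞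
      (fun a : TotalSpace F A => (e ⟨a.1, a.2 -ᵥ σ a.1⟩).2) ⟨x, a⟩ :=
    ((e.contMDiffAt_iff (by rw [e.mem_source]; exact hxe)).1 h3).2
  have h2 := h1.prodMk_space (contMDiffAt_const (c := (1 : ℝ)))
  refine h2.congr_of_eventuallyEq ?_
  filter_upwards [(e.open_baseSet.preimage hcont).mem_nhds (x := ⟨x, a⟩) hxe] with p hp
  have hp' : p.1 ∈ e.baseSet := hp
  rw [ht, VectorHull.pretriv_apply]
  change (e.linearMapAt ℝ p.1 (VectorHull.split (σ p.1) (VectorHull.point p.1 p.2)).1,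
    (VectorHull.split (σ p.1) (VectorHull.point p.1 p.2)).2) = _
  rw [VectorHull.split_point]
  simp [Trivialization.linearMapAt_apply, hp']

/-- A section of `A` that is smooth as a section of the vector hull is smooth. -/
theorem VectorHull.contMDiffAt_of_point {s : ∀ x, A x} {x₀ : M}
    (hs : ContMDiffAt 𝓘(ℝ, EM) (𝓘(ℝ, EM).prod 𝓘(ℝ, F × ℝ)) ∞
      (fun x => TotalSpace.mk' (F × ℝ) (E := VectorHull EM F V A) x (VectorHull.point x (s x))) x₀) :
    ContMDiffAt 𝓘(ℝ, EM) (𝓘(ℝ, EM).prod 𝓘(ℝ, F)) ∞ (fun x => TotalSpace.mk' F x (s x)) x₀ := by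
  obtain ⟨U, hU, hx, σ, hσ⟩ := exists_localSection EM F V A x₀
  let e := trivializationAt F V x₀
  have hxe : x₀ ∈ e.baseSet := FiberBundle.mem_baseSet_trivializationAt' x₀
  obtain ⟨t, _, hb, ht⟩ := VectorHull.exists_trivialization hU hσ e
  have h1 := (t.contMDiffAt_section_iff (by rw [hb]; exact ⟨hx, hxe⟩)).1 hs
  have h2 : ContMDiffAt 𝓘(ℝ, EM) (𝓘(ℝ, EM).prod 𝓘(ℝ, F)) ∞
      (fun x => TotalSpace.mk' F x (s x -ᵥ σ x : V x)) x₀ := by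
    rw [e.contMDiffAt_section_iff hxe]
    refine ((contDiff_fst (𝕜 := ℝ) (E := F) (F := ℝ)).contMDiff.contMDiffAt.comp x₀ h1).congr_of_eventuallyEq ?_
    filter_upwards [e.open_baseSet.mem_nhds hxe] with x hx'
    simp only [Function.comp, ht, VectorHull.pretriv_apply]
    simp only [VectorHull.split_point]
    simp [Trivialization.linearMapAt_apply, hx']
  refine (contMDiffAt_vadd h2 (hσ.contMDiffAt (hU.mem_nhds hx))).congr_of_eventuallyEq
    (Filter.Eventually.of_forall fun x => ?_)
  simp

/-- An affine bundle has global smooth sections. -/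
instance AffineSection.instNonempty [FiniteDimensional ℝ EM] [T2Space M] [SigmaCompactSpace M] :
    Nonempty (AffineSection EM F V A) := by
  obtain ⟨s, hs⟩ := exists_contMDiffSection_forall_mem_convex_of_local 𝓘(ℝ, EM) (n := ⊤)
    (F_fiber := F × ℝ) (VectorHull EM F V A)
    (fun x => Set.range (VectorHull.point (EM := EM) (F := F) (V := V) (A := A) x))
    (fun x => by
      rw [← Set.image_univ]
      rintro _ ⟨a, -, rfl⟩ _ ⟨b, -, rfl⟩ p q _ _ hpq
      refine ⟨AffineMap.lineMap a b q, mem_univ _, ?_⟩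
      rw [AffineMap.apply_lineMap, AffineMap.lineMap_apply_module]
      rw [← hpq]; simp)
    (fun x => by
      obtain ⟨U, hU, hx, σ, hσ⟩ := exists_localSection EM F V A x
      exact ⟨U, hU.mem_nhds hx, fun x => VectorHull.point x (σ x),
        VectorHull.contMDiff_embed.comp_contMDiffOn hσ, fun y _ => ⟨_, rfl⟩⟩)
  choose a ha using hs
  refine ⟨⟨a, fun x => VectorHull.contMDiffAt_of_point (V := V) ?_⟩⟩
  simp only [ha]
  exact s.contMDiff x

/-- The smooth sections of `A` form an affine space over the smooth sections of `V`. -/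
instance AffineSection.instAddTorsor [FiniteDimensional ℝ EM] [T2Space M] [SigmaCompactSpace M] :
    AddTorsor Cₛ^∞⟮𝓘(ℝ, EM); F, V⟯ (AffineSection EM F V A) where
  vadd v s := ⟨fun x => v x +ᵥ s x, fun x => contMDiffAt_vadd (v.contMDiff x) (s.contMDiff_toFun x)⟩
  vsub s t := ⟨fun x => s x -ᵥ t x,
    fun x => contMDiffAt_vsub (s.contMDiff_toFun x) (t.contMDiff_toFun x)⟩
  zero_vadd s := AffineSection.ext (funext fun x => zero_vadd (V x) (s x))
  add_vadd v w s := AffineSection.ext (funext fun x => add_vadd (v x) (w x) (s x))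
  vsub_vadd' s t := AffineSection.ext (funext fun x => vsub_vadd (s x) (t x))
  vadd_vsub' v s := ContMDiffSection.ext fun x => vadd_vsub (v x) (s x)

/-- A section of `A` as a section of the vector hull. -/
def AffineSection.toHull (s : AffineSection EM F V A) :
    Cₛ^∞⟮𝓘(ℝ, EM); F × ℝ, VectorHull EM F V A⟯ :=
  ⟨fun x => VectorHull.point x (s x), VectorHull.contMDiff_embed.comp s.contMDiff_toFun⟩

variable (A) in
/-- A section of `V` as a section of the vector hull of `A`. -/
def vectorToHull (v : Cₛ^∞⟮𝓘(ℝ, EM); F, V⟯) : Cₛ^∞⟮𝓘(ℝ, EM); F × ℝ, VectorHull EM F V A⟯ :=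
  ⟨fun x => VectorHull.vector x (v x), VectorHull.contMDiff_vector.comp v.contMDiff⟩

end VectorHull

/-! ### Lie algebroids -/

/-- The derivative `v f` of a real function `f` on a manifold along a tangent vector `v`. -/
def dirDeriv {E H : Type*} [NormedAddCommGroup E] [NormedSpace ℝ E] [TopologicalSpace H]
    (I : ModelWithCorners ℝ E H) {N : Type*} [TopologicalSpace N] [ChartedSpace H N]
    (f : N → ℝ) (x : N) (v : TangentSpace I x) : ℝ :=
  mfderiv I 𝓘(ℝ, ℝ) f x v

section VectorBundle

variable {EM : Type*} [NormedAddCommGroup EM] [NormedSpace ℝ EM]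
  {M : Type*} [TopologicalSpace M] [ChartedSpace EM M]
  {F : Type*} [NormedAddCommGroup F] [NormedSpace ℝ F]
  {E : M → Type*} [∀ x, AddCommGroup (E x)] [∀ x, Module ℝ (E x)]
  [∀ x, TopologicalSpace (E x)] [TopologicalSpace (TotalSpace F E)] [FiberBundle F E]
  [VectorBundle ℝ F E]

/-- The product of a smooth function and a smooth section. -/
def funSMul (f : C^∞⟮𝓘(ℝ, EM), M; ℝ⟯) (s : Cₛ^∞⟮𝓘(ℝ, EM); F, E⟯) : Cₛ^∞⟮𝓘(ℝ, EM); F, E⟯ :=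
  ⟨fun x => f x • s x, f.contMDiff.smul_section s.contMDiff⟩

variable (EM F E) in
/-- Smooth sections of the dual bundle of `E`, identified with the smooth fibrewise linear functions
on the total space of `E`. -/
structure DualSection where
  /-- the underlying family of linear forms -/
  toFun : ∀ x, E x →ₗ[ℝ] ℝ
  contMDiff_toFun : ContMDiff (𝓘(ℝ, EM).prod 𝓘(ℝ, F)) 𝓘(ℝ, ℝ) ∞
    (fun p : TotalSpace F E => toFun p.1 p.2)

/-- The function on the total space of `E` that is linear on fibres and given by a section of the
dual bundle. -/
def DualSection.linearFun (μ : DualSection EM F E) (p : TotalSpace F E) : ℝ := μ.toFun p.1 p.2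

/-- The pairing of a section of the dual bundle and a section of `E`, a function on `M`. -/
def DualSection.pairing (μ : DualSection EM F E) (s : Cₛ^∞⟮𝓘(ℝ, EM); F, E⟯) (x : M) : ℝ :=
  μ.toFun x (s x)

variable (EM F E) in
/-- A Lie algebroid structure on a smooth vector bundle `E` over `M`. -/
@[ext] structure LieAlgebroid [IsManifold 𝓘(ℝ, EM) ∞ M] where
  /-- the anchor, a morphism of vector bundles from `E` to the tangent bundle of `M` -/
  anchor : ∀ x, E x →ₗ[ℝ] TangentSpace 𝓘(ℝ, EM) x
  contMDiff_anchor : ContMDiff (𝓘(ℝ, EM).prod 𝓘(ℝ, F)) 𝓘(ℝ, EM).tangent ∞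
    (fun p : TotalSpace F E => (⟨p.1, anchor p.1 p.2⟩ : TangentBundle 𝓘(ℝ, EM) M))
  /-- the bracket of sections -/
  bracket : Cₛ^∞⟮𝓘(ℝ, EM); F, E⟯ →ₗ[ℝ] Cₛ^∞⟮𝓘(ℝ, EM); F, E⟯ →ₗ[ℝ] Cₛ^∞⟮𝓘(ℝ, EM); F, E⟯
  skew : ∀ X Y, bracket X Y = -bracket Y X
  jacobi : ∀ X Y Z,
    bracket X (bracket Y Z) + bracket Y (bracket Z X) + bracket Z (bracket X Y) = 0
  leibniz : ∀ X (f : C^∞⟮𝓘(ℝ, EM), M; ℝ⟯) Y x, bracket X (funSMul f Y) x =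
    f x • bracket X Y x + dirDeriv 𝓘(ℝ, EM) f x (anchor x (X x)) • Y x

/-- Smooth vector fields on a manifold. -/
abbrev SmoothVectorField {E' H : Type*} [NormedAddCommGroup E'] [NormedSpace ℝ E']
    [TopologicalSpace H] (I : ModelWithCorners ℝ E' H) (N : Type*) [TopologicalSpace N]
    [ChartedSpace H N] [IsManifold I ∞ N] : Type _ :=
  Cₛ^∞⟮I; E', (TangentSpace I : N → Type _)⟯

variable [IsManifold 𝓘(ℝ, EM) ∞ M] [ContMDiffVectorBundle ∞ F E 𝓘(ℝ, EM)]

/-- The vector field `W` on the total space of the Lie algebroid `E` is the complete lift of the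
section `X`: it projects to the anchor of `X`, and its derivative of the linear function given by a
section `μ` of the dual bundle is the linear function given by the Lie derivative `ℒ_X μ`. Here
`⟨ℒ_X μ, Z⟩ = ρ(X)⟨μ, Z⟩ - ⟨μ, [X, Z]⟩`, and every point of `E` is the value `Z x` of a section. -/
structure LieAlgebroid.IsCompleteLift (L : LieAlgebroid EM F E) (X : Cₛ^∞⟮𝓘(ℝ, EM); F, E⟯)
    (W : SmoothVectorField (𝓘(ℝ, EM).prod 𝓘(ℝ, F)) (TotalSpace F E)) : Prop where
  basic : ∀ (f : C^∞⟮𝓘(ℝ, EM), M; ℝ⟯) (p : TotalSpace F E),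
    dirDeriv (𝓘(ℝ, EM).prod 𝓘(ℝ, F)) (fun q : TotalSpace F E => f q.1) p (W p) =
      dirDeriv 𝓘(ℝ, EM) f p.1 (L.anchor p.1 (X p.1))
  linear : ∀ (μ : DualSection EM F E) (Z : Cₛ^∞⟮𝓘(ℝ, EM); F, E⟯) (x : M),
    dirDeriv (𝓘(ℝ, EM).prod 𝓘(ℝ, F)) μ.linearFun (⟨x, Z x⟩ : TotalSpace F E) (W ⟨x, Z x⟩) =
      dirDeriv 𝓘(ℝ, EM) (μ.pairing Z) x (L.anchor x (X x)) - μ.pairing (L.bracket X Z) x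

/-- The vertical lift of a section `Y` of `E` to the total space of `E`: its value at `p` is the
velocity at `t = 0` of the curve `t ↦ p + t • Y`. -/
def verticalLift (Y : Cₛ^∞⟮𝓘(ℝ, EM); F, E⟯) (p : TotalSpace F E) :
    TangentSpace (𝓘(ℝ, EM).prod 𝓘(ℝ, F)) p :=
  mfderiv 𝓘(ℝ, ℝ) (𝓘(ℝ, EM).prod 𝓘(ℝ, F))
    (fun t : ℝ => (⟨p.1, p.2 + t • Y p.1⟩ : TotalSpace F E)) 0 (1 : ℝ)

end VectorBundle

/-! ### Lie affgebroids -/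

section LieAffgebroid

variable (EM : Type*) [NormedAddCommGroup EM] [NormedSpace ℝ EM] [FiniteDimensional ℝ EM]
  {M : Type*} [TopologicalSpace M] [T2Space M] [SigmaCompactSpace M] [ChartedSpace EM M]
  [IsManifold 𝓘(ℝ, EM) ∞ M]
  (F : Type*) [NormedAddCommGroup F] [NormedSpace ℝ F] [FiniteDimensional ℝ F]
  (V : M → Type*) [∀ x, AddCommGroup (V x)] [∀ x, Module ℝ (V x)]
  [∀ x, TopologicalSpace (V x)] [TopologicalSpace (TotalSpace F V)] [FiberBundle F V]
  [VectorBundle ℝ F V] [ContMDiffVectorBundle ∞ F V 𝓘(ℝ, EM)]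
  (A : M → Type*) [∀ x, AddTorsor (V x) (A x)] [TopologicalSpace (TotalSpace F A)]
  [ChartedSpace (ModelProd EM F) (TotalSpace F A)]
  [SmoothAffineBundle EM F V A]

/-- A Lie affgebroid structure on an affine bundle `A` modelled on `V`: an affine Lie bracket on the
affine space of sections of `A`, with values in the sections of `V`, and an anchor, a morphism of
affine bundles from `A` to the tangent bundle. The affine-linear part of the bracket is
`X ↦ (bracket α).linear X`. -/
structure LieAffgebroid where
  /-- the anchor -/
  anchor : ∀ x, A x →ᵃ[ℝ] TangentSpace 𝓘(ℝ, EM) x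
  contMDiff_anchor : ContMDiff (𝓘(ℝ, EM).prod 𝓘(ℝ, F)) 𝓘(ℝ, EM).tangent ∞
    (fun p : TotalSpace F A => (⟨p.1, anchor p.1 p.2⟩ : TangentBundle 𝓘(ℝ, EM) M))
  /-- the bi-affine bracket -/
  bracket : AffineSection EM F V A →ᵃ[ℝ] (AffineSection EM F V A →ᵃ[ℝ] Cₛ^∞⟮𝓘(ℝ, EM); F, V⟯)
  skew : ∀ α β, bracket α β = -bracket β α
  jacobi : ∀ α β γ, (bracket α).linear (bracket β γ) + (bracket β).linear (bracket γ α) +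
    (bracket γ).linear (bracket α β) = 0
  leibniz : ∀ α (f : C^∞⟮𝓘(ℝ, EM), M; ℝ⟯) (X : Cₛ^∞⟮𝓘(ℝ, EM); F, V⟯) x,
    (bracket α).linear (funSMul f X) x =
      f x • (bracket α).linear X x + dirDeriv 𝓘(ℝ, EM) f x (anchor x (α x)) • X x

variable {EM F V A}

namespace LieAffgebroid

/-- The affine-linear part of the bracket: the bracket of a section of `A` and a section of `V`. -/
def bracketAV (L : LieAffgebroid EM F V A) (α : AffineSection EM F V A)
    (Y : Cₛ^∞⟮𝓘(ℝ, EM); F, V⟯) : Cₛ^∞⟮𝓘(ℝ, EM); F, V⟯ :=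
  (L.bracket α).linear Y

/-- The bilinear part of the bracket: the bracket of two sections of `V`. -/
def bracketVV (L : LieAffgebroid EM F V A) (X Y : Cₛ^∞⟮𝓘(ℝ, EM); F, V⟯) :
    Cₛ^∞⟮𝓘(ℝ, EM); F, V⟯ :=
  (L.bracket.linear X).linear Y

/-- The Lie algebroid structure `H` on the vector hull of `A` extends the Lie affgebroid structure
`L` on `A`. -/
structure IsHull (L : LieAffgebroid EM F V A)
    (H : LieAlgebroid EM (F × ℝ) (VectorHull EM F V A)) : Prop where
  bracket : ∀ α β : AffineSection EM F V A,
    H.bracket α.toHull β.toHull = vectorToHull A (L.bracket α β)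
  anchor : ∀ (x : M) (a : A x), H.anchor x (VectorHull.point x a) = L.anchor x a

end LieAffgebroid

/-- The vector field `W'` on the vector hull of `A` is tangent to `A`, and `W` is its restriction
to `A`. -/
def IsRestriction [IsManifold (𝓘(ℝ, EM).prod 𝓘(ℝ, F)) ∞ (TotalSpace F A)]
    (W' : ∀ p : TotalSpace (F × ℝ) (VectorHull EM F V A),
      TangentSpace (𝓘(ℝ, EM).prod 𝓘(ℝ, F × ℝ)) p)
    (W : SmoothVectorField (𝓘(ℝ, EM).prod 𝓘(ℝ, F)) (TotalSpace F A)) : Prop :=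
  ∀ a : TotalSpace F A, mfderiv (𝓘(ℝ, EM).prod 𝓘(ℝ, F)) (𝓘(ℝ, EM).prod 𝓘(ℝ, F × ℝ))
    (VectorHull.embed EM F V A) a (W a) = W' (VectorHull.embed EM F V A a)

end LieAffgebroid

end

/-! Everything is tested on functions. On the total space of a vector bundle, the functions f ∘ π
and the fibrewise linear functions ι_μ together separate tangent vectors
(`eq_zero_of_basicOrLinear`). So a vector field is determined by its derivatives of these functions
and is smooth as soon as those derivatives are (`contMDiff_vectorField_of_separating`). A complete
lift sends f ∘ π to (ρ(X)f) ∘ π and ι_μ to the linear function of ℒ_X μ; a vertical lift kills f ∘ π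
and sends ι_μ to ⟨μ, Y⟩ ∘ π. Both operations stay inside the class of test functions, so a bracket
of lifts acts on a test function as a commutator of such operations. The required identities are
then that the anchor preserves brackets, that ℒ_X ℒ_Y - ℒ_Y ℒ_X = ℒ_[X,Y], and that ρ(X)⟨μ, Y⟩ -
⟨ℒ_X μ, Y⟩ = ⟨μ, [X, Y]⟩ (`completeAction_commutator`, `completeAction_verticalAction`).

The Lie algebroid on the hull comes from a global section σ of A. Sections of the hull are uniquely
fσ + v with v a section of V, and the Leibniz rule leaves only one possible bracket
(`bracket_hullEquiv`): the extension of the bilinear part B on V by D = [σ, ·]. It satisfies the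
Jacobi identity because the affine Jacobi identity says that B is a Lie bracket and D a derivation
of it, and because the anchors are compatible with B and D. This last point is not an axiom: it
follows by comparing the symbols of the two sides of the Jacobi identity (`symbol_commutator`), as
soon as there is a nonzero section to act on.

To pass to A, let h be the linear function on the hull that equals 1 on A, so that A is the level
set h = 1. It is closed: ⟨h, [X, Y]⟩ = ρ(X)⟨h, Y⟩ - ρ(Y)⟨h, X⟩ (`height_bracket`). Hence ℒ_X h
vanishes whenever ⟨h, X⟩ is constant, which covers the sections of A (constant 1) and of V (constant
0), and their complete lifts are tangent to A. Vertical lifts of sections of V kill h as well. A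
section σ gives a smooth retraction of the hull onto A, so the embedding is an immersion and the
restricted test functions still separate tangent vectors of A. The commutator identities therefore
yield (a) to (d) on A itself (`IsRestriction.mlieBracket_eq`). -/

noncomputable section

/-! ### Brackets and smoothness of vector fields, tested on functions -/

section VectorFields

variable {E H : Type*} [NormedAddCommGroup E] [NormedSpace ℝ E]
  [TopologicalSpace H] {I : ModelWithCorners ℝ E H} {N : Type*} [TopologicalSpace N]
  [ChartedSpace H N]

/-- A vector field acts on a function as its coordinate expression acts on the coordinate expression
of the function. -/
theorem fderiv_comp_extChartAt_symm [I.Boundaryless] [IsManifold I 1 N] (x : N) {g : N → ℝ} {y : E}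
    (hy : y ∈ (extChartAt I x).target) (U : ∀ x : N, TangentSpace I x)
    (hg : MDifferentiableAt I 𝓘(ℝ, ℝ) g ((extChartAt I x).symm y)) :
    fderiv ℝ (g ∘ (extChartAt I x).symm) y
        (VectorField.mpullbackWithin 𝓘(ℝ, E) I (extChartAt I x).symm U (range I) y) =
      dirDeriv I g ((extChartAt I x).symm y) (U ((extChartAt I x).symm y)) := by
  have hinv := isInvertible_mfderivWithin_extChartAt_symm (I := I) hy
  have hmd : MDifferentiableWithinAt 𝓘(ℝ, E) I (extChartAt I x).symm (range I) y :=
    mdifferentiableWithinAt_of_isInvertible_mfderivWithin hinv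
  rw [VectorField.mpullbackWithin_apply, dirDeriv, ← mfderiv_eq_fderiv, ← mfderivWithin_univ,
    ← I.range_eq_univ, mfderiv_comp_mfderivWithin y hg hmd
      (by rw [I.range_eq_univ]; exact uniqueMDiffWithinAt_univ _)]
  obtain ⟨e, he⟩ := hinv
  rw [← he, ContinuousLinearMap.inverse_equiv]
  change mfderiv I 𝓘(ℝ, ℝ) g _ (e (e.symm _)) = _
  rw [e.apply_symm_apply]

/-- The manifold bracket is the pullback of the bracket of coordinate expressions, so the claim is
the vector space identity in the chart at `x`. There it expresses the symmetry of the second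
derivative of the coordinate expression of `f`. -/
theorem dirDeriv_mlieBracket [CompleteSpace E] [IsManifold I ∞ N] [I.Boundaryless]
    {V W : ∀ x : N, TangentSpace I x} {x : N}
    (hV : MDifferentiableAt I I.tangent (fun y => (⟨y, V y⟩ : TangentBundle I N)) x)
    (hW : MDifferentiableAt I I.tangent (fun y => (⟨y, W y⟩ : TangentBundle I N)) x)
    {f : N → ℝ} (hf : ContMDiff I 𝓘(ℝ, ℝ) ∞ f)
    (hfV : MDifferentiableAt I 𝓘(ℝ, ℝ) (fun y => dirDeriv I f y (V y)) x)
    (hfW : MDifferentiableAt I 𝓘(ℝ, ℝ) (fun y => dirDeriv I f y (W y)) x) :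
    dirDeriv I f x (VectorField.mlieBracket I V W x) =
      dirDeriv I (fun y => dirDeriv I f y (W y)) x (V x) -
        dirDeriv I (fun y => dirDeriv I f y (V y)) x (W x) := by
  have : IsManifold I 2 N := .of_le (n := ∞) (by norm_cast)
  have : IsManifold I 1 N := .of_le (n := ∞) (by norm_cast)
  have hxt : extChartAt I x x ∈ (extChartAt I x).target := mem_extChartAt_target x
  have hx : (extChartAt I x).symm (extChartAt I x x) = x := extChartAt_to_inv x
  have hopen : (extChartAt I x).target ∈ 𝓝 (extChartAt I x x) := extChartAt_target_mem_nhds x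
  have hVc := MDifferentiableWithinAt.differentiableWithinAt_mpullbackWithin_vectorField
    (mdifferentiableWithinAt_univ.2 hV)
  have hWc := MDifferentiableWithinAt.differentiableWithinAt_mpullbackWithin_vectorField
    (mdifferentiableWithinAt_univ.2 hW)
  simp only [preimage_univ, univ_inter, I.range_eq_univ] at hVc hWc
  replace hVc := hVc.differentiableAt Filter.univ_mem
  replace hWc := hWc.differentiableAt Filter.univ_mem
  have hfd : ∀ y, MDifferentiableAt I 𝓘(ℝ, ℝ) f y := fun y =>
    (hf y).mdifferentiableAt (by simp)
  have hfc : ContDiffAt ℝ 2 (f ∘ (extChartAt I x).symm) (extChartAt I x x) := by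
    rw [← contMDiffAt_iff_contDiffAt]
    refine ContMDiffAt.comp _ ((hf _).of_le (by norm_cast)) ?_
    have := contMDiffWithinAt_extChartAt_symm_range (I := I) (n := 2) x hxt
    rwa [I.range_eq_univ, contMDiffWithinAt_univ] at this
  have hbr := VectorField.fderiv_apply_lieBracket hfc (by simp) hWc hVc
  -- This is an equality near the base point and not only at it, so it can be differentiated once
  -- more.
  have h1 : ∀ U : ∀ x : N, TangentSpace I x,
      (fun y => fderiv ℝ (f ∘ (extChartAt I x).symm) y
        (VectorField.mpullbackWithin 𝓘(ℝ, E) I (extChartAt I x).symm U univ y)) =ᶠ[𝓝 (extChartAt I x x)]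
      (fun y => dirDeriv I f y (U y)) ∘ (extChartAt I x).symm := fun U => by
    filter_upwards [hopen] with y hy
    rw [← I.range_eq_univ, fderiv_comp_extChartAt_symm x hy U (hfd _)]
    rfl
  rw [(h1 W).fderiv_eq, (h1 V).fderiv_eq, ← I.range_eq_univ,
    fderiv_comp_extChartAt_symm x hxt V (by rwa [hx]), fderiv_comp_extChartAt_symm x hxt W (by rwa [hx]),
    hx, I.range_eq_univ] at hbr
  rw [← hbr]
  have h2 := fderiv_comp_extChartAt_symm x hxt (VectorField.mlieBracket I V W) (by rw [hx]; exact hfd x)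
  rw [hx] at h2
  rw [← h2]
  -- At its own base point the chart has derivative the identity, so pulling back does not change
  -- the vector. The auxiliary statements with vectors in `E` avoid dependence on the base point,
  -- where the chart followed by its inverse equals `x` only propositionally.
  have h3 : VectorField.mpullbackWithin 𝓘(ℝ, E) I (extChartAt I x).symm
      (VectorField.mlieBracket I V W) (range I) (extChartAt I x x) =
      VectorField.mlieBracket I V W x := by
    have h4 : ∀ (P : E →L[ℝ] E) (v w : E), P = ContinuousLinearMap.id ℝ E → v = w →
        P.inverse v = w := by
      rintro P v w rfl rfl; simp
    exact h4 _ _ _ mfderivWithin_range_extChartAt_symm (congrArg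
      (fun z => (VectorField.mlieBracket I V W z : E)) hx)
  have h5 : VectorField.mlieBracket I V W x = VectorField.lieBracket ℝ
      (VectorField.mpullbackWithin 𝓘(ℝ, E) I (extChartAt I x).symm V (range I))
      (VectorField.mpullbackWithin 𝓘(ℝ, E) I (extChartAt I x).symm W (range I))
      (extChartAt I x x) := by
    rw [VectorField.mlieBracket, VectorField.mlieBracketWithin_apply, mfderiv_extChartAt_self,
      preimage_univ, univ_inter]
    have h4 : ∀ v w : E, v = w → (ContinuousLinearMap.id ℝ E).inverse v = w := by
      rintro v w rfl; simp
    refine h4 _ _ ?_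
    have h6 : ∀ (P Q : E → E) (s : Set E) (z : E), s = univ →
        VectorField.lieBracketWithin ℝ P Q s z = VectorField.lieBracket ℝ P Q z := by
      rintro P Q s z rfl; rw [VectorField.lieBracketWithin_univ]
    exact h6 _ _ _ _ I.range_eq_univ
  rw [h3, h5, I.range_eq_univ]

theorem contMDiff_dirDeriv [IsManifold I ∞ N] {V : ∀ x : N, TangentSpace I x} {f : N → ℝ}
    (hV : ContMDiff I I.tangent ∞ (fun y => (⟨y, V y⟩ : TangentBundle I N)))
    (hf : ContMDiff I 𝓘(ℝ, ℝ) ∞ f) : ContMDiff I 𝓘(ℝ, ℝ) ∞ (fun x => dirDeriv I f x (V x)) := by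
  have : IsManifold I 1 N := .of_le (n := ∞) (by norm_cast)
  have h := hf.contMDiff_tangentMap (m := ∞) (by simp)
  exact (contMDiff_snd_tangentBundle_modelSpace ℝ 𝓘(ℝ, ℝ)).comp (h.comp hV)

/-- Let L be a left inverse of dφ at `x`. In the chart at `x`, the endomorphisms B = L ∘ dφ depend
smoothly on the point and B is the identity at `x`, so B is invertible nearby and W = B⁻¹ L w is
smooth there. -/
theorem contMDiffAt_vectorField_of_injective [FiniteDimensional ℝ E] [IsManifold I ∞ N]
    [I.Boundaryless] {G : Type*} [NormedAddCommGroup G] [NormedSpace ℝ G] [FiniteDimensional ℝ G]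
    {W : ∀ x : N, TangentSpace I x} {x : N}
    {φ : N → G} (hφ : ContMDiffAt I 𝓘(ℝ, G) ∞ φ x)
    (hinj : ∀ v : TangentSpace I x, mfderiv I 𝓘(ℝ, G) φ x v = 0 → v = 0)
    {w : N → G} (hw : ContMDiffAt I 𝓘(ℝ, G) ∞ w x)
    (hWw : ∀ᶠ y in 𝓝 x, mfderiv I 𝓘(ℝ, G) φ y (W y) = w y) :
    ContMDiffAt I I.tangent ∞ (fun y => (⟨y, W y⟩ : TangentBundle I N)) x := by
  have : IsManifold I 1 N := .of_le (n := ∞) (by norm_cast)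
  obtain ⟨L, hL⟩ : ∃ L : G →L[ℝ] E, ∀ v : TangentSpace I x, L (mfderiv I 𝓘(ℝ, G) φ x v) = v := by
    let f : E →L[ℝ] G := mfderiv I 𝓘(ℝ, G) φ x
    obtain ⟨L, hL⟩ := (f : E →ₗ[ℝ] G).exists_leftInverse_of_injective
      (LinearMap.ker_eq_bot'.2 hinj)
    exact ⟨LinearMap.toContinuousLinearMap L, fun v => LinearMap.congr_fun hL v⟩
  set ψ := extChartAt I x with hψ
  let B : N → E →L[ℝ] E := fun y => L.comp (fderiv ℝ (φ ∘ ψ.symm) (ψ y))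
  have hx : ψ.symm (ψ x) = x := extChartAt_to_inv x
  have hφψ : ContDiffAt ℝ ∞ (φ ∘ ψ.symm) (ψ x) := by
    rw [← contMDiffAt_iff_contDiffAt]
    refine ContMDiffAt.comp (I' := I) _ (by rwa [hx]) ?_
    have := contMDiffWithinAt_extChartAt_symm_range (I := I) (n := ∞) x (mem_extChartAt_target x)
    rwa [I.range_eq_univ, contMDiffWithinAt_univ] at this
  have hBd : ContMDiffAt I 𝓘(ℝ, E →L[ℝ] E) ∞ B x := by
    have h1 : ContDiffAt ℝ ∞ (fun z => L.comp (fderiv ℝ (φ ∘ ψ.symm) z)) (ψ x) :=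
      contDiffAt_const.clm_comp (hφψ.fderiv_right (by simp))
    exact h1.contMDiffAt.comp x (contMDiffAt_extChartAt (I := I) (n := ∞))
  have hBx : ∀ᶠ y in 𝓝 x, ∀ v : TangentSpace I y,
      B y (mfderiv I 𝓘(ℝ, E) ψ y v) = L (mfderiv I 𝓘(ℝ, G) φ y v) := by
    have h1 : ∀ᶠ y in 𝓝 x, ContDiffAt ℝ 1 (φ ∘ ψ.symm) (ψ y) :=
      (continuousAt_extChartAt (I := I) x).eventually
        ((hφψ.of_le (m := 1) (by norm_cast)).eventually (by simp))
    filter_upwards [h1, extChartAt_source_mem_nhds (I := I) x] with y hy hys v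
    have h2 : φ =ᶠ[𝓝 y] (φ ∘ ψ.symm) ∘ ψ := by
      filter_upwards [(isOpen_extChartAt_source x).mem_nhds hys] with z hz
      exact (congrArg φ ((extChartAt I x).left_inv hz)).symm
    rw [h2.mfderiv_eq, mfderiv_comp y (hy.differentiableAt one_ne_zero).mdifferentiableAt
      (mdifferentiableAt_extChartAt (by simpa using hys)), mfderiv_eq_fderiv]
    rfl
  have hB1 : B x = ContinuousLinearMap.id ℝ E := by
    ext v
    have := hBx.self_of_nhds v
    rw [mfderiv_extChartAt_self] at this
    exact this.trans (hL v)
  rw [Bundle.contMDiffAt_section]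
  have hinv : ContMDiffAt I 𝓘(ℝ, E →L[ℝ] E) ∞ (fun y => (B y).inverse) x := by
    have h1 : ContDiffAt ℝ ∞ ContinuousLinearMap.inverse (B x) := by
      rw [hB1]; exact contDiffAt_map_inverse (ContinuousLinearEquiv.refl ℝ E)
    exact h1.contMDiffAt.comp x hBd
  refine (hinv.clm_apply (L.contMDiff.contMDiffAt.comp x hw)).congr_of_eventuallyEq ?_
  have hunit : ∀ᶠ y in 𝓝 x, (B y).IsInvertible := by
    refine hBd.continuousAt.eventually ?_
    rw [hB1]
    exact ContinuousLinearEquiv.nhds (ContinuousLinearEquiv.refl ℝ E)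
  filter_upwards [hunit, hBx, hWw, chart_source_mem_nhds H x] with y hy hy' hyw hyc
  have h3 := hy' (W y)
  rw [hyw] at h3
  -- The trivialization of the tangent bundle centred at `x` reads a vector through the derivative
  -- of the chart at `x`, which is how B was written.
  have h4 : (trivializationAt E (TangentSpace I) x ⟨y, W y⟩).2 = mfderiv I 𝓘(ℝ, E) ψ y (W y) := by
    have h5 : (trivializationAt E (TangentSpace I) x).continuousLinearMapAt ℝ y (W y) =
        (trivializationAt E (TangentSpace I) x ⟨y, W y⟩).2 := by
      rw [Trivialization.continuousLinearMapAt_apply, Trivialization.linearMapAt_apply,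
        if_pos (by exact hyc)]
    exact h5.symm.trans
      (DFunLike.congr_fun (TangentBundle.continuousLinearMapAt_trivializationAt hyc) (W y))
  rw [h4]
  obtain ⟨e, he⟩ := hy
  have h5 : (B y).inverse (L (w y)) = mfderiv I 𝓘(ℝ, E) ψ y (W y) := by
    rw [← h3, ← he, ContinuousLinearMap.inverse_equiv]
    exact e.symm_apply_apply _
  exact h5.symm

end VectorFields

/-! ### Calculus of derivatives along tangent vectors -/

section DirDeriv

variable {E H : Type*} [NormedAddCommGroup E] [NormedSpace ℝ E]
  [TopologicalSpace H] {I : ModelWithCorners ℝ E H} {N : Type*} [TopologicalSpace N]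
  [ChartedSpace H N] {f g : N → ℝ} {x : N}

theorem dirDeriv_vec_add (v w : TangentSpace I x) :
    dirDeriv I f x (v + w) = dirDeriv I f x v + dirDeriv I f x w :=
  map_add (mfderiv I 𝓘(ℝ, ℝ) f x) v w

theorem dirDeriv_vec_sub (v w : TangentSpace I x) :
    dirDeriv I f x (v - w) = dirDeriv I f x v - dirDeriv I f x w :=
  map_sub (mfderiv I 𝓘(ℝ, ℝ) f x) v w

theorem dirDeriv_vec_smul (c : ℝ) (v : TangentSpace I x) :
    dirDeriv I f x (c • v) = c * dirDeriv I f x v :=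
  map_smul (mfderiv I 𝓘(ℝ, ℝ) f x) c v

@[simp] theorem dirDeriv_vec_zero : dirDeriv I f x (0 : TangentSpace I x) = 0 :=
  map_zero (mfderiv I 𝓘(ℝ, ℝ) f x)

theorem dirDeriv_add (hf : MDifferentiableAt I 𝓘(ℝ, ℝ) f x) (hg : MDifferentiableAt I 𝓘(ℝ, ℝ) g x)
    (v : TangentSpace I x) :
    dirDeriv I (fun y => f y + g y) x v = dirDeriv I f x v + dirDeriv I g x v :=
  DFunLike.congr_fun (hf.hasMFDerivAt.add hg.hasMFDerivAt).mfderiv v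

theorem dirDeriv_sub (hf : MDifferentiableAt I 𝓘(ℝ, ℝ) f x) (hg : MDifferentiableAt I 𝓘(ℝ, ℝ) g x)
    (v : TangentSpace I x) :
    dirDeriv I (fun y => f y - g y) x v = dirDeriv I f x v - dirDeriv I g x v :=
  DFunLike.congr_fun (hf.hasMFDerivAt.sub hg.hasMFDerivAt).mfderiv v

theorem dirDeriv_mul (hf : MDifferentiableAt I 𝓘(ℝ, ℝ) f x) (hg : MDifferentiableAt I 𝓘(ℝ, ℝ) g x)
    (v : TangentSpace I x) :
    dirDeriv I (fun y => f y * g y) x v = f x * dirDeriv I g x v + g x * dirDeriv I f x v :=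
  DFunLike.congr_fun (hf.hasMFDerivAt.mul hg.hasMFDerivAt).mfderiv v

@[simp] theorem dirDeriv_const (c : ℝ) (v : TangentSpace I x) :
    dirDeriv I (fun _ : N => c) x v = 0 :=
  DFunLike.congr_fun (hasMFDerivAt_const c x).mfderiv v

theorem dirDeriv_congr (h : f =ᶠ[𝓝 x] g) (v : TangentSpace I x) :
    dirDeriv I f x v = dirDeriv I g x v :=
  DFunLike.congr_fun h.mfderiv_eq v

theorem dirDeriv_comp {E' H' : Type*} [NormedAddCommGroup E'] [NormedSpace ℝ E']
    [TopologicalSpace H'] {I' : ModelWithCorners ℝ E' H'} {N' : Type*} [TopologicalSpace N']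
    [ChartedSpace H' N'] {φ : N' → N} {y : N'} (hf : MDifferentiableAt I 𝓘(ℝ, ℝ) f (φ y))
    (hφ : MDifferentiableAt I' I φ y) (v : TangentSpace I' y) :
    dirDeriv I' (fun z => f (φ z)) y v = dirDeriv I f (φ y) (mfderiv I' I φ y v) :=
  DFunLike.congr_fun (mfderiv_comp y hf hφ) v

/-- A vector field is smooth if its derivatives of sufficiently many smooth functions are. -/
theorem contMDiff_vectorField_of_separating [FiniteDimensional ℝ E] [IsManifold I ∞ N]
    [I.Boundaryless] {W : ∀ x : N, TangentSpace I x} {ι : Type*} (g : ι → N → ℝ)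
    (hg : ∀ i, ContMDiff I 𝓘(ℝ, ℝ) ∞ (g i))
    (hsep : ∀ (x : N) (v : TangentSpace I x), (∀ i, dirDeriv I (g i) x v = 0) → v = 0)
    (hW : ∀ i, ContMDiff I 𝓘(ℝ, ℝ) ∞ fun y => dirDeriv I (g i) y (W y)) :
    ContMDiff I I.tangent ∞ (fun y => (⟨y, W y⟩ : TangentBundle I N)) := by
  intro x
  let d : ι → Dual ℝ E := fun i =>
    { toFun := fun v => dirDeriv I (g i) x v
      map_add' := fun v w => dirDeriv_vec_add (I := I) (x := x) v w
      map_smul' := fun c v => dirDeriv_vec_smul (I := I) (x := x) c v }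
  -- The differentials at `x` lie in a finite-dimensional dual space, so finitely many of them are
  -- independent and span all the others. The corresponding functions form a map to a
  -- finite-dimensional space that is immersive at `x`.
  obtain ⟨s, idx, -, hspan, hind⟩ := exists_linearIndependent' ℝ d
  have : Finite s := hind.finite
  have : Fintype s := Fintype.ofFinite s
  let φ : N → (s → ℝ) := fun y i => g (idx i) y
  have hφ : ContMDiff I 𝓘(ℝ, s → ℝ) ∞ φ := contMDiff_pi_space.2 fun i => hg _
  have hd : ∀ (y : N) (v : TangentSpace I y), mfderiv I 𝓘(ℝ, s → ℝ) φ y v =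
      fun i : s => dirDeriv I (g (idx i)) y v := by
    intro y v
    funext i
    have h1 := dirDeriv_comp (I := 𝓘(ℝ, s → ℝ)) (f := fun a : s → ℝ => a i) (φ := φ) (y := y)
      (ContinuousLinearMap.proj (R := ℝ) (φ := fun _ : s => ℝ) i).mdifferentiableAt
      (hφ.mdifferentiableAt (by simp)) v
    refine Eq.trans ?_ h1.symm
    have h2 := (ContinuousLinearMap.proj (R := ℝ) (φ := fun _ : s => ℝ) i).mfderiv_eq (x := φ y)
    exact (DFunLike.congr_fun h2 (mfderiv I 𝓘(ℝ, s → ℝ) φ y v)).symm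
  refine contMDiffAt_vectorField_of_injective hφ.contMDiffAt (fun v hv => ?_)
    (w := fun y i => dirDeriv I (g (idx i)) y (W y)) (contMDiff_pi_space.2 fun i => hW _).contMDiffAt
    (Filter.Eventually.of_forall fun y => hd y (W y))
  rw [hd] at hv
  have h2 : ∀ u : E, (∀ i, d (idx i) u = 0) →
      ∀ a ∈ Submodule.span ℝ (range (d ∘ idx)), a u = 0 := by
    intro u hu a ha
    induction ha using Submodule.span_induction with
    | mem a ha =>
      obtain ⟨i, rfl⟩ := ha
      exact hu i
    | zero => rfl
    | add a b _ _ ha hb => rw [LinearMap.add_apply, ha, hb, add_zero]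
    | smul c a _ ha => rw [LinearMap.smul_apply, ha, smul_zero]
  exact hsep x v fun i => h2 v (fun j => congrFun hv j) (d i)
    (hspan ▸ Submodule.subset_span ⟨i, rfl⟩)

end DirDeriv

/-! ### Dual frames and test functions on the total space of a vector bundle -/

section SeparatingFunctions

set_option linter.unusedSectionVars false

variable {EM : Type*} [NormedAddCommGroup EM] [NormedSpace ℝ EM] [FiniteDimensional ℝ EM]
  {M : Type*} [TopologicalSpace M] [T2Space M] [ChartedSpace EM M] [IsManifold 𝓘(ℝ, EM) ∞ M]
  {F : Type*} [NormedAddCommGroup F] [NormedSpace ℝ F] [FiniteDimensional ℝ F]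
  {E : M → Type*} [∀ x, AddCommGroup (E x)] [∀ x, Module ℝ (E x)]
  [∀ x, TopologicalSpace (E x)] [TopologicalSpace (TotalSpace F E)] [FiberBundle F E]
  [VectorBundle ℝ F E] [ContMDiffVectorBundle ∞ F E 𝓘(ℝ, EM)]

theorem exists_bump {x₀ : M} {U : Set M} (hU : U ∈ 𝓝 x₀) :
    ∃ θ : C^∞⟮𝓘(ℝ, EM), M; ℝ⟯, θ =ᶠ[𝓝 x₀] 1 ∧ tsupport θ ⊆ U := by
  obtain ⟨θ, hθ, -⟩ := (SmoothBumpFunction.nhds_basis_support (I := 𝓘(ℝ, EM)) hU).mem_iff.1 hU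
  exact ⟨⟨θ, θ.contMDiff⟩, θ.eventuallyEq_one, hθ⟩

/-- A linear form on the model fibre, cut off and extended to a section of the dual bundle. -/
theorem exists_dualSection_eventuallyEq (e : Trivialization F (π F E)) [MemTrivializationAtlas e]
    {θ : C^∞⟮𝓘(ℝ, EM), M; ℝ⟯} (hθ : tsupport θ ⊆ e.baseSet) (ℓ : F →L[ℝ] ℝ) :
    ∃ μ : DualSection EM F E, ∀ y v, μ.toFun y v = θ y * ℓ (e.linearMapAt ℝ y v) := by
  refine ⟨⟨fun y => θ y • ((ℓ : F →ₗ[ℝ] ℝ) ∘ₗ e.linearMapAt ℝ y), ?_⟩, fun y v => rfl⟩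
  -- Only points over the support of `θ` matter, and there the trivialization is available.
  refine contMDiff_of_tsupport fun p hp => ?_
  have hp1 : p.1 ∈ tsupport θ := by
    have hcl : IsClosed (π F E ⁻¹' tsupport θ) :=
      (isClosed_tsupport θ).preimage (FiberBundle.continuous_proj F E)
    refine closure_minimal (fun q hq => ?_) hcl hp
    refine subset_tsupport _ fun h => hq ?_
    simp [h]
  have hpe : p.1 ∈ e.baseSet := hθ hp1
  have h1 : ContMDiffAt (𝓘(ℝ, EM).prod 𝓘(ℝ, F)) 𝓘(ℝ, F) ∞ (fun q : TotalSpace F E => (e q).2) p :=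
    ((e.contMDiffAt_iff (by rw [e.mem_source]; exact hpe)).1 contMDiffAt_id).2
  have h2 : ContMDiffAt (𝓘(ℝ, EM).prod 𝓘(ℝ, F)) 𝓘(ℝ, ℝ) ∞ (fun q : TotalSpace F E => θ q.1) p :=
    θ.contMDiff.contMDiffAt.comp p (Bundle.contMDiffAt_proj E)
  refine (h2.mul (ℓ.contMDiff.contMDiffAt.comp p h1)).congr_of_eventuallyEq ?_
  filter_upwards [(e.open_baseSet.preimage (FiberBundle.continuous_proj F E)).mem_nhds hpe] with q hq
  have hq' : q.1 ∈ e.baseSet := hq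
  simp [hq']

/-- A vector of the model fibre, cut off and extended to a section. -/
theorem exists_section_eq (e : Trivialization F (π F E)) [MemTrivializationAtlas e]
    {θ : C^∞⟮𝓘(ℝ, EM), M; ℝ⟯} (hθ : tsupport θ ⊆ e.baseSet) (w : F) :
    ∃ Z : Cₛ^∞⟮𝓘(ℝ, EM); F, E⟯, ∀ y, Z y = θ y • e.symm y w := by
  have h : ContMDiffOn 𝓘(ℝ, EM) (𝓘(ℝ, EM).prod 𝓘(ℝ, F)) ∞
      (fun y => TotalSpace.mk' F y (e.symm y w)) e.baseSet := by
    rw [e.contMDiffOn_section_baseSet_iff]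
    refine (contMDiffOn_const (c := w)).congr fun y hy => ?_
    rw [e.apply_mk_symm hy]
  exact ⟨⟨_, θ.contMDiff.contMDiffOn.smul_section_of_tsupport e.open_baseSet hθ h⟩, fun y => rfl⟩

variable (EM F E) in
/-- Global sections of a vector bundle and its dual that are dual frames near a given point. -/
theorem exists_dual_frames (x₀ : M) :
    ∃ (Z : Fin (finrank ℝ F) → Cₛ^∞⟮𝓘(ℝ, EM); F, E⟯)
      (c : Fin (finrank ℝ F) → DualSection EM F E) (ψ : C^∞⟮𝓘(ℝ, EM), M; ℝ⟯),
      ψ =ᶠ[𝓝 x₀] 1 ∧ ∀ y v, ψ y • v = ∑ i, (c i).toFun y v • Z i y := by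
  let e := trivializationAt F E x₀
  obtain ⟨θ, hθ1, hθ⟩ := exists_bump (EM := EM)
    (e.open_baseSet.mem_nhds (FiberBundle.mem_baseSet_trivializationAt' x₀))
  let b := finBasis ℝ F
  choose Z hZ using fun i => exists_section_eq e hθ (b i)
  choose c hc using fun i => exists_dualSection_eventuallyEq e hθ
    (LinearMap.toContinuousLinearMap (b.coord i))
  -- The frame and the coframe each carry one factor `θ`, hence the square.
  refine ⟨Z, c, θ * θ, ?_, fun y v => ?_⟩
  · filter_upwards [hθ1] with y hy
    simp [hy]
  · by_cases hy : y ∈ e.baseSet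
    · have h1 : v = e.symmₗ ℝ y (e.linearMapAt ℝ y v) := by simp [hy]
      conv_lhs => rw [h1, ← b.sum_repr (e.linearMapAt ℝ y v), map_sum, Finset.smul_sum]
      refine Finset.sum_congr rfl fun i _ => ?_
      rw [hc, hZ, map_smul, smul_smul, smul_smul]
      simp [mul_comm, mul_assoc, Trivialization.symmₗ_apply, hy]
    · have h0 : θ y = 0 := image_eq_zero_of_notMem_tsupport fun h => hy (hθ h)
      simp [hc, h0]

-- The complete lift is prescribed along values of global sections; this makes it a condition at
-- every point of the total space.
variable (EM F) in
theorem exists_section_apply_eq {x : M} (v : E x) : ∃ Z : Cₛ^∞⟮𝓘(ℝ, EM); F, E⟯, Z x = v := by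
  obtain ⟨Z, c, ψ, hψ, h⟩ := exists_dual_frames EM F E x
  refine ⟨∑ i, (c i).toFun x v • Z i, ?_⟩
  have h1 := h x v
  rw [hψ.self_of_nhds] at h1
  have h2 : ∀ (s : Finset (Fin (finrank ℝ F))) (Y : Fin (finrank ℝ F) → Cₛ^∞⟮𝓘(ℝ, EM); F, E⟯),
      (∑ i ∈ s, Y i) x = ∑ i ∈ s, Y i x := fun s Y =>
    map_sum ((Pi.evalAddMonoidHom E x).comp (ContMDiffSection.coeAddHom 𝓘(ℝ, EM) F ∞ E)) Y s
  rw [h2]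
  simpa using h1.symm

/-- The functions on the total space of a vector bundle that are constant on the fibres or linear on
the fibres. -/
def basicOrLinear : C^∞⟮𝓘(ℝ, EM), M; ℝ⟯ ⊕ DualSection EM F E → TotalSpace F E → ℝ
  | .inl f => fun p => f p.1
  | .inr μ => μ.linearFun

theorem contMDiff_basicOrLinear (i : C^∞⟮𝓘(ℝ, EM), M; ℝ⟯ ⊕ DualSection EM F E) :
    ContMDiff (𝓘(ℝ, EM).prod 𝓘(ℝ, F)) 𝓘(ℝ, ℝ) ∞ (basicOrLinear i) := by
  cases i with
  | inl f => exact f.contMDiff.comp (Bundle.contMDiff_proj E)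
  | inr μ => exact μ.contMDiff_toFun

/-- The functions that are constant or linear on the fibres separate tangent vectors. -/
theorem eq_zero_of_basicOrLinear (p : TotalSpace F E)
    (u : TangentSpace (𝓘(ℝ, EM).prod 𝓘(ℝ, F)) p)
    (hu : ∀ i, dirDeriv (𝓘(ℝ, EM).prod 𝓘(ℝ, F)) (basicOrLinear (EM := EM) i) p u = 0) : u = 0 := by
  -- A bundle chart has components (base chart, fibre coordinate). Hence each linear form ℓ on the
  -- model space, read in the chart, is near `p` the sum of a basic function (ℓ on the first factor)
  -- and a linear one (ℓ on the second), both cut off to be global.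
  have key : ∀ ℓ : EM × F →L[ℝ] ℝ, ℓ u = 0 := by
    intro ℓ
    let e := trivializationAt F E p.1
    have hpe : p.1 ∈ e.baseSet := FiberBundle.mem_baseSet_trivializationAt' p.1
    obtain ⟨θ, hθ1, hθ⟩ := exists_bump (EM := EM) (e.open_baseSet.mem_nhds hpe)
    obtain ⟨μ, hμ⟩ := exists_dualSection_eventuallyEq e hθ (ℓ.comp (.inr ℝ EM F))
    obtain ⟨f, hf⟩ : ∃ f : C^∞⟮𝓘(ℝ, EM), M; ℝ⟯,
        f =ᶠ[𝓝 p.1] fun y => ℓ (extChartAt 𝓘(ℝ, EM) p.1 y, 0) := by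
      let η : SmoothBumpFunction 𝓘(ℝ, EM) p.1 := Classical.arbitrary _
      refine ⟨⟨_, η.contMDiff_smul (g := fun y => ℓ (extChartAt 𝓘(ℝ, EM) p.1 y, 0)) ?_⟩, ?_⟩
      · exact (ℓ.comp (.inl ℝ EM F)).contMDiff.comp_contMDiffOn contMDiffOn_extChartAt
      · filter_upwards [η.eventuallyEq_one] with y hy
        simp [hy]
    have hloc : (fun q => ℓ (extChartAt (𝓘(ℝ, EM).prod 𝓘(ℝ, F)) p q)) =ᶠ[𝓝 p]
        fun q => basicOrLinear (.inl f) q + basicOrLinear (.inr μ) q := by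
      have hπ := (FiberBundle.continuous_proj F E).continuousAt (x := p)
      filter_upwards [hπ.eventually hf, hπ.eventually hθ1,
        hπ.eventually (e.open_baseSet.mem_nhds hpe)] with q hqf hqθ hqe
      have hqe' : q.1 ∈ e.baseSet := hqe
      have h1 : f q.1 = ℓ (extChartAt 𝓘(ℝ, EM) p.1 q.1, 0) := hqf
      have h2 : θ q.1 = 1 := hqθ
      change _ = f q.1 + μ.toFun q.1 q.2
      rw [h1, hμ, h2, one_mul, FiberBundle.extChartAt]
      simp [Trivialization.linearMapAt_apply, hqe', ← map_add, e]
    have hμ' := hu (.inr μ)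
    have hf' := hu (.inl f)
    have hd := dirDeriv_congr hloc u
    have hmd : ∀ i, MDifferentiableAt (𝓘(ℝ, EM).prod 𝓘(ℝ, F)) 𝓘(ℝ, ℝ)
        (basicOrLinear (EM := EM) (F := F) (E := E) i) p :=
      fun i => (contMDiff_basicOrLinear i).mdifferentiableAt (by simp)
    rw [dirDeriv_add (hmd _) (hmd _), hf', hμ', add_zero] at hd
    have hn : IsManifold (𝓘(ℝ, EM).prod 𝓘(ℝ, F)) 1 (TotalSpace F E) := .of_le (n := ∞) (by norm_cast)
    -- The chart at `p` has derivative the identity at `p`, so the left side is ℓ(u).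
    rw [dirDeriv_comp (I := 𝓘(ℝ, EM × F)) (f := ℓ) ℓ.mdifferentiableAt
      (mdifferentiableAt_extChartAt (mem_chart_source _ p)), mfderiv_extChartAt_self] at hd
    exact (DFunLike.congr_fun ℓ.mfderiv_eq _).symm.trans hd
  exact SeparatingDual.eq_zero_of_forall_dual_eq_zero (R := ℝ) (V := EM × F) key

end SeparatingFunctions

/-- The symbol of a commutator of derivative endomorphisms is the commutator of their symbols. -/
theorem symbol_commutator {R S : Type*} [CommRing R] [AddCommGroup S] [Module R S]
    {D₁ D₂ D₃ : S → S} {δ₁ δ₂ δ₃ : R → R}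
    (ha₁ : ∀ z w, D₁ (z + w) = D₁ z + D₁ w) (ha₂ : ∀ z w, D₂ (z + w) = D₂ z + D₂ w)
    (h₁ : ∀ f z, D₁ (f • z) = f • D₁ z + δ₁ f • z) (h₂ : ∀ f z, D₂ (f • z) = f • D₂ z + δ₂ f • z)
    (h₃ : ∀ f z, D₃ (f • z) = f • D₃ z + δ₃ f • z) (hc : ∀ z, D₁ (D₂ z) - D₂ (D₁ z) = D₃ z)
    (f : R) (z : S) : (δ₁ (δ₂ f) - δ₂ (δ₁ f)) • z = δ₃ f • z := by
  have h := hc (f • z)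
  rw [h₃, ← hc z, h₂, h₁, ha₁, ha₂, h₁, h₁, h₂, h₂] at h
  rw [← sub_eq_zero] at h ⊢
  rw [← h]
  module

/-! ### Lie derivatives and complete lifts on a Lie algebroid -/

section CompleteLift

set_option linter.unusedSectionVars false

variable {EM : Type*} [NormedAddCommGroup EM] [NormedSpace ℝ EM] [FiniteDimensional ℝ EM]
  {M : Type*} [TopologicalSpace M] [T2Space M] [ChartedSpace EM M] [IsManifold 𝓘(ℝ, EM) ∞ M]
  {F : Type*} [NormedAddCommGroup F] [NormedSpace ℝ F] [FiniteDimensional ℝ F]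
  {E : M → Type*} [∀ x, AddCommGroup (E x)] [∀ x, Module ℝ (E x)]
  [∀ x, TopologicalSpace (E x)] [TopologicalSpace (TotalSpace F E)] [FiberBundle F E]
  [VectorBundle ℝ F E] [ContMDiffVectorBundle ∞ F E 𝓘(ℝ, EM)]

instance instModuleSections : Module C^∞⟮𝓘(ℝ, EM), M; ℝ⟯ Cₛ^∞⟮𝓘(ℝ, EM); F, E⟯ where
  smul := funSMul
  one_smul s := ContMDiffSection.ext fun x => one_smul ℝ (s x)
  mul_smul f g s := ContMDiffSection.ext fun x => mul_smul (f x) (g x) (s x)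
  smul_zero f := ContMDiffSection.ext fun x => smul_zero (f x)
  smul_add f s t := ContMDiffSection.ext fun x => smul_add (f x) (s x) (t x)
  add_smul f g s := ContMDiffSection.ext fun x => add_smul (f x) (g x) (s x)
  zero_smul s := ContMDiffSection.ext fun x => zero_smul ℝ (s x)

theorem smul_section_apply (f : C^∞⟮𝓘(ℝ, EM), M; ℝ⟯) (s : Cₛ^∞⟮𝓘(ℝ, EM); F, E⟯) (x : M) :
    (f • s) x = f x • s x :=
  rfl

theorem sum_section_apply {ι : Type*} (s : Finset ι) (Y : ι → Cₛ^∞⟮𝓘(ℝ, EM); F, E⟯) (x : M) :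
    (∑ i ∈ s, Y i) x = ∑ i ∈ s, Y i x :=
  map_sum ((Pi.evalAddMonoidHom E x).comp (ContMDiffSection.coeAddHom 𝓘(ℝ, EM) F ∞ E)) Y s

theorem DualSection.contMDiff_pairing (μ : DualSection EM F E) (Z : Cₛ^∞⟮𝓘(ℝ, EM); F, E⟯) :
    ContMDiff 𝓘(ℝ, EM) 𝓘(ℝ, ℝ) ∞ (μ.pairing Z) :=
  μ.contMDiff_toFun.comp Z.contMDiff

/-- The pairing of a section of the dual bundle and a section, as a smooth function. -/
def DualSection.smoothPairing (μ : DualSection EM F E) (Z : Cₛ^∞⟮𝓘(ℝ, EM); F, E⟯) :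
    C^∞⟮𝓘(ℝ, EM), M; ℝ⟯ :=
  ⟨μ.pairing Z, μ.contMDiff_pairing Z⟩

/-- An additive operation on sections that is linear over the smooth functions at a point depends
only on the value of the section at the point. -/
theorem eq_of_tensorial {x : M} (T : Cₛ^∞⟮𝓘(ℝ, EM); F, E⟯ →+ ℝ)
    (hT : ∀ (f : C^∞⟮𝓘(ℝ, EM), M; ℝ⟯) Z, T (f • Z) = f x * T Z)
    {Z Z' : Cₛ^∞⟮𝓘(ℝ, EM); F, E⟯} (h : Z x = Z' x) : T Z = T Z' := by
  obtain ⟨Y, c, ψ, hψ, hY⟩ := exists_dual_frames EM F E x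
  have key : ∀ Z, T Z = ∑ i, (c i).toFun x (Z x) * T (Y i) := by
    intro Z
    -- Multiplication by ψ makes the local frame expansion of `Z` global, with smooth coefficients,
    -- and costs nothing at `x`, where ψ is 1.
    have h1 : ψ • Z = ∑ i, (c i).smoothPairing Z • Y i := by
      refine ContMDiffSection.ext fun y => ?_
      rw [sum_section_apply]
      exact hY y (Z y)
    have h2 := hT ψ Z
    rw [hψ.self_of_nhds, h1, map_sum] at h2
    simp only [Pi.one_apply, one_mul, hT] at h2
    exact h2.symm
  rw [key Z, key Z', h]

variable (L : LieAlgebroid EM F E)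

/-- The derivative of a function along the anchor of a section. -/
def LieAlgebroid.anchorDeriv (X : Cₛ^∞⟮𝓘(ℝ, EM); F, E⟯) (f : C^∞⟮𝓘(ℝ, EM), M; ℝ⟯) :
    C^∞⟮𝓘(ℝ, EM), M; ℝ⟯ :=
  ⟨fun x => dirDeriv 𝓘(ℝ, EM) f x (L.anchor x (X x)),
    contMDiff_dirDeriv (L.contMDiff_anchor.comp X.contMDiff) f.contMDiff⟩

theorem LieAlgebroid.bracket_smul (X Y : Cₛ^∞⟮𝓘(ℝ, EM); F, E⟯) (f : C^∞⟮𝓘(ℝ, EM), M; ℝ⟯) :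
    L.bracket X (f • Y) = f • L.bracket X Y + L.anchorDeriv X f • Y :=
  ContMDiffSection.ext fun x => L.leibniz X f Y x

/-- The Jacobi identity as a commutator of operators, the form whose symbols can be compared. -/
theorem LieAlgebroid.bracket_bracket (X Y Z : Cₛ^∞⟮𝓘(ℝ, EM); F, E⟯) :
    L.bracket X (L.bracket Y Z) - L.bracket Y (L.bracket X Z) = L.bracket (L.bracket X Y) Z := by
  have h := L.jacobi X Y Z
  rw [L.skew Z X, L.skew Z (L.bracket X Y), map_neg] at h
  rw [← sub_eq_zero, ← h]
  abel

/-- Smooth functions that act in the same way on the sections of a bundle of positive rank are equal. -/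
theorem eq_of_forall_smul_section [Nontrivial F] {f g : C^∞⟮𝓘(ℝ, EM), M; ℝ⟯}
    (h : ∀ Z : Cₛ^∞⟮𝓘(ℝ, EM); F, E⟯, f • Z = g • Z) : f = g := by
  ext x
  obtain ⟨w, hw⟩ := exists_ne (0 : F)
  let e := (trivializationAt F E x).linearEquivAt ℝ x (FiberBundle.mem_baseSet_trivializationAt' x)
  obtain ⟨Z, hZ⟩ := exists_section_apply_eq EM F (e.symm w)
  have hZ0 : Z x ≠ 0 := by rw [hZ]; simpa using hw
  exact smul_left_injective ℝ hZ0 (congrArg (fun s => s x) (h Z))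

/-- The anchor of a Lie algebroid of positive rank is a homomorphism of brackets. -/
theorem LieAlgebroid.anchorDeriv_bracket [Nontrivial F] (X Y : Cₛ^∞⟮𝓘(ℝ, EM); F, E⟯)
    (f : C^∞⟮𝓘(ℝ, EM), M; ℝ⟯) :
    L.anchorDeriv (L.bracket X Y) f =
      L.anchorDeriv X (L.anchorDeriv Y f) - L.anchorDeriv Y (L.anchorDeriv X f) :=
  (eq_of_forall_smul_section (F := F) (E := E) fun Z => symbol_commutator (map_add (L.bracket X))
    (map_add (L.bracket Y)) (fun f Z => L.bracket_smul X Z f) (fun f Z => L.bracket_smul Y Z f)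
    (fun f Z => L.bracket_smul (L.bracket X Y) Z f) (L.bracket_bracket X Y) f Z).symm

/-- The value of the Lie derivative of a section of the dual bundle on a section. -/
def LieAlgebroid.lieDerivPairing (X : Cₛ^∞⟮𝓘(ℝ, EM); F, E⟯) (μ : DualSection EM F E) (x : M) :
    Cₛ^∞⟮𝓘(ℝ, EM); F, E⟯ →+ ℝ where
  toFun Z := dirDeriv 𝓘(ℝ, EM) (μ.pairing Z) x (L.anchor x (X x)) - μ.pairing (L.bracket X Z) x
  map_zero' := by
    have h : μ.pairing (0 : Cₛ^∞⟮𝓘(ℝ, EM); F, E⟯) = fun _ => 0 :=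
      funext fun y => map_zero (μ.toFun y)
    rw [map_zero, h]
    simp
  map_add' Z Z' := by
    have h : ∀ Y Y', μ.pairing (Y + Y') = fun y => μ.pairing Y y + μ.pairing Y' y :=
      fun Y Y' => funext fun y => map_add (μ.toFun y) (Y y) (Y' y)
    rw [map_add, h, h, dirDeriv_add ((μ.contMDiff_pairing Z).mdifferentiableAt (by simp))
      ((μ.contMDiff_pairing Z').mdifferentiableAt (by simp))]
    ring

/-- The product rule for the pairing and the Leibniz rule for the bracket produce the same term
(ρ(X)f)⟨μ, Z⟩, which cancels. This tensoriality is what makes ℒ_X μ a section of the dual bundle. -/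
theorem LieAlgebroid.lieDerivPairing_smul (X : Cₛ^∞⟮𝓘(ℝ, EM); F, E⟯) (μ : DualSection EM F E)
    (x : M) (f : C^∞⟮𝓘(ℝ, EM), M; ℝ⟯) (Z : Cₛ^∞⟮𝓘(ℝ, EM); F, E⟯) :
    L.lieDerivPairing X μ x (f • Z) = f x * L.lieDerivPairing X μ x Z := by
  have h1 : μ.pairing (f • Z) = fun y => f y * μ.pairing Z y :=
    funext fun y => map_smul (μ.toFun y) (f y) (Z y)
  have h2 : μ.pairing (L.bracket X (f • Z)) x = f x * μ.pairing (L.bracket X Z) x +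
      dirDeriv 𝓘(ℝ, EM) f x (L.anchor x (X x)) * μ.pairing Z x := by
    rw [L.bracket_smul]
    refine (map_add (μ.toFun x) (f x • L.bracket X Z x) (L.anchorDeriv X f x • Z x)).trans ?_
    rw [map_smul, map_smul]
    rfl
  change dirDeriv 𝓘(ℝ, EM) (μ.pairing (f • Z)) x (L.anchor x (X x)) -
      μ.pairing (L.bracket X (f • Z)) x = f x *
    (dirDeriv 𝓘(ℝ, EM) (μ.pairing Z) x (L.anchor x (X x)) - μ.pairing (L.bracket X Z) x)
  rw [h1, h2, dirDeriv_mul (f.contMDiff.mdifferentiableAt (by simp))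
    ((μ.contMDiff_pairing Z).mdifferentiableAt (by simp))]
  ring

/-- The Lie derivative of sections of the dual bundle. -/
theorem LieAlgebroid.exists_lieDeriv (X : Cₛ^∞⟮𝓘(ℝ, EM); F, E⟯) (μ : DualSection EM F E) :
    ∃ ν : DualSection EM F E, ∀ (Z : Cₛ^∞⟮𝓘(ℝ, EM); F, E⟯) (x : M),
      ν.toFun x (Z x) = L.lieDerivPairing X μ x Z := by
  -- The form is evaluated on an arbitrary section through each vector. No regularity of the choice
  -- is needed, since the value does not depend on it.
  choose s hs using fun (x : M) (v : E x) => exists_section_apply_eq EM F v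
  have hws : ∀ (Z : Cₛ^∞⟮𝓘(ℝ, EM); F, E⟯) (x : M),
      L.lieDerivPairing X μ x (s x (Z x)) = L.lieDerivPairing X μ x Z := fun Z x =>
    eq_of_tensorial _ (L.lieDerivPairing_smul X μ x) (hs x (Z x))
  refine ⟨⟨fun x =>
    { toFun := fun v => L.lieDerivPairing X μ x (s x v)
      map_add' := fun v w => ?_
      map_smul' := fun c v => ?_ }, ?_⟩, hws⟩
  · rw [← map_add]
    refine eq_of_tensorial _ (L.lieDerivPairing_smul X μ x) ?_
    rw [hs]
    change _ = s x v x + s x w x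
    rw [hs, hs]
  · have h1 := L.lieDerivPairing_smul X μ x (ContMDiffMap.const c) (s x v)
    refine Eq.trans (eq_of_tensorial _ (L.lieDerivPairing_smul X μ x) ?_) h1
    rw [hs, smul_section_apply, hs]
    rfl
  · intro p
    obtain ⟨Y, c, ψ, hψ, hY⟩ := exists_dual_frames EM F E p.1
    -- Near `p` the new form is Σ cᵢ · (ℒ_X μ)(Yᵢ) in a dual frame, with smooth coefficients.
    have hsm : ContMDiffAt (𝓘(ℝ, EM).prod 𝓘(ℝ, F)) 𝓘(ℝ, ℝ) ∞ (fun q : TotalSpace F E =>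
        ∑ i, (c i).linearFun q * L.lieDerivPairing X μ q.1 (Y i)) p := by
      refine ContMDiffAt.sum fun i _ => ?_
      refine (c i).contMDiff_toFun.contMDiffAt.mul ?_
      have h1 : ContMDiff 𝓘(ℝ, EM) 𝓘(ℝ, ℝ) ∞ fun y => L.lieDerivPairing X μ y (Y i) :=
        (contMDiff_dirDeriv (L.contMDiff_anchor.comp X.contMDiff) (μ.contMDiff_pairing (Y i))).sub
          (μ.contMDiff_pairing _)
      exact h1.contMDiffAt.comp p (Bundle.contMDiffAt_proj E)
    refine hsm.congr_of_eventuallyEq ?_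
    filter_upwards [(FiberBundle.continuous_proj F E).continuousAt.eventually hψ] with q hq
    have h2 := hY q.1 q.2
    have h3 : ψ q.1 = 1 := hq
    rw [h3, one_smul] at h2
    -- The vector `q.2` is the value of a combination of the frame with constant coefficients, so
    -- tensoriality applies with constant functions.
    have h4 : L.lieDerivPairing X μ q.1 (s q.1 q.2) = L.lieDerivPairing X μ q.1
        (∑ i, (ContMDiffMap.const ((c i).linearFun q) : C^∞⟮𝓘(ℝ, EM), M; ℝ⟯) • Y i) := by
      refine eq_of_tensorial _ (L.lieDerivPairing_smul X μ q.1) ?_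
      rw [hs, sum_section_apply]
      exact h2
    refine h4.trans ?_
    rw [map_sum]
    simp only [L.lieDerivPairing_smul]
    rfl

theorem contMDiff_verticalCurve {x : M} (v w : E x) :
    ContMDiff 𝓘(ℝ, ℝ) (𝓘(ℝ, EM).prod 𝓘(ℝ, F)) ∞
      (fun t : ℝ => (⟨x, v + t • w⟩ : TotalSpace F E)) := by
  intro t
  let e := trivializationAt F E x
  have hx : x ∈ e.baseSet := FiberBundle.mem_baseSet_trivializationAt' x
  rw [e.contMDiffAt_iff (by rw [e.mem_source]; exact hx)]
  refine ⟨contMDiffAt_const, ?_⟩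
  have h : (fun t : ℝ => (e ⟨x, v + t • w⟩).2) = fun t =>
      e.linearMapAt ℝ x v + t • e.linearMapAt ℝ x w := by
    funext t
    rw [← map_smul, ← map_add, Trivialization.linearMapAt_apply, if_pos hx]
  rw [h]
  exact ContDiff.contMDiff (by fun_prop) |>.contMDiffAt

theorem dirDeriv_verticalLift (Y : Cₛ^∞⟮𝓘(ℝ, EM); F, E⟯) (p : TotalSpace F E)
    {g : TotalSpace F E → ℝ} (hg : ContMDiff (𝓘(ℝ, EM).prod 𝓘(ℝ, F)) 𝓘(ℝ, ℝ) ∞ g) :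
    dirDeriv (𝓘(ℝ, EM).prod 𝓘(ℝ, F)) g p (verticalLift Y p) =
      deriv (fun t : ℝ => g ⟨p.1, p.2 + t • Y p.1⟩) 0 := by
  have h := dirDeriv_comp (I := 𝓘(ℝ, EM).prod 𝓘(ℝ, F)) (f := g)
    (φ := fun t : ℝ => (⟨p.1, p.2 + t • Y p.1⟩ : TotalSpace F E)) (y := 0)
    (hg.mdifferentiableAt (by simp))
    ((contMDiff_verticalCurve p.2 (Y p.1)).mdifferentiableAt (by simp)) (1 : ℝ)
  -- The curve starts at p + 0 • Y, which equals `p` only propositionally; this moves a tangent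
  -- vector between the two base points.
  have h1 : ∀ (q : TotalSpace F E) (u : EM × F), q = p →
      dirDeriv (𝓘(ℝ, EM).prod 𝓘(ℝ, F)) g p u = dirDeriv (𝓘(ℝ, EM).prod 𝓘(ℝ, F)) g q u := by
    rintro q u rfl; rfl
  refine (h1 ⟨p.1, p.2 + (0 : ℝ) • Y p.1⟩ _ (by simp)).trans (h.symm.trans ?_)
  exact DFunLike.congr_fun (mfderiv_eq_fderiv (f := fun t : ℝ => g ⟨p.1, p.2 + t • Y p.1⟩) (x := 0))
    (1 : ℝ)

theorem dirDeriv_basic_verticalLift (Y : Cₛ^∞⟮𝓘(ℝ, EM); F, E⟯) (p : TotalSpace F E)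
    (f : C^∞⟮𝓘(ℝ, EM), M; ℝ⟯) : dirDeriv (𝓘(ℝ, EM).prod 𝓘(ℝ, F))
      (fun q : TotalSpace F E => f q.1) p (verticalLift Y p) = 0 := by
  refine (dirDeriv_verticalLift Y p (contMDiff_basicOrLinear (.inl f))).trans ?_
  simp [basicOrLinear]

theorem dirDeriv_linear_verticalLift (Y : Cₛ^∞⟮𝓘(ℝ, EM); F, E⟯) (p : TotalSpace F E)
    (μ : DualSection EM F E) : dirDeriv (𝓘(ℝ, EM).prod 𝓘(ℝ, F)) μ.linearFun p (verticalLift Y p) =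
      μ.pairing Y p.1 := by
  refine (dirDeriv_verticalLift Y p μ.contMDiff_toFun).trans ?_
  have h : (fun t : ℝ => μ.toFun p.1 (p.2 + t • Y p.1)) =
      fun t => μ.toFun p.1 p.2 + t * μ.toFun p.1 (Y p.1) := by
    funext t
    simp
  rw [h]
  simp [DualSection.pairing]

/-- For a section Z through `p`, the vector is TZ(ρ(X)) minus the vertical lift of [X, Z]. The first
term contributes ρ(X)f and ρ(X)⟨μ, Z⟩, the second contributes nothing to f and -⟨μ, [X, Z]⟩ to μ.
Tensoriality gives the same formula for every other section through `p`. -/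
theorem LieAlgebroid.exists_completeLift_apply (X : Cₛ^∞⟮𝓘(ℝ, EM); F, E⟯) (p : TotalSpace F E) :
    ∃ u : TangentSpace (𝓘(ℝ, EM).prod 𝓘(ℝ, F)) p,
      (∀ f : C^∞⟮𝓘(ℝ, EM), M; ℝ⟯,
        dirDeriv (𝓘(ℝ, EM).prod 𝓘(ℝ, F)) (fun q : TotalSpace F E => f q.1) p u =
          dirDeriv 𝓘(ℝ, EM) f p.1 (L.anchor p.1 (X p.1))) ∧
      ∀ (μ : DualSection EM F E) (Z : Cₛ^∞⟮𝓘(ℝ, EM); F, E⟯), Z p.1 = p.2 →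
        dirDeriv (𝓘(ℝ, EM).prod 𝓘(ℝ, F)) μ.linearFun p u = L.lieDerivPairing X μ p.1 Z := by
  obtain ⟨x, v⟩ := p
  obtain ⟨Z, rfl⟩ := exists_section_apply_eq EM F v
  have hZ : MDifferentiableAt 𝓘(ℝ, EM) (𝓘(ℝ, EM).prod 𝓘(ℝ, F))
      (fun y => TotalSpace.mk' F y (Z y)) x := Z.contMDiff.mdifferentiableAt (by simp)
  refine ⟨mfderiv 𝓘(ℝ, EM) (𝓘(ℝ, EM).prod 𝓘(ℝ, F)) (fun y => TotalSpace.mk' F y (Z y)) x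
    (L.anchor x (X x)) - verticalLift (L.bracket X Z) ⟨x, Z x⟩, fun f => ?_, fun μ Z' hZ' => ?_⟩
  · rw [dirDeriv_vec_sub, dirDeriv_basic_verticalLift, sub_zero]
    exact (dirDeriv_comp ((contMDiff_basicOrLinear (.inl f)).mdifferentiableAt (by simp)) hZ _).symm
  · rw [dirDeriv_vec_sub, dirDeriv_linear_verticalLift,
      eq_of_tensorial _ (L.lieDerivPairing_smul X μ x) hZ']
    congr 1
    exact (dirDeriv_comp (μ.contMDiff_toFun.mdifferentiableAt (by simp)) hZ _).symm

/-- The pointwise vectors form a smooth field because their derivatives of basic and linear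
functions are again basic and linear functions, hence smooth. -/
theorem LieAlgebroid.exists_completeLift (X : Cₛ^∞⟮𝓘(ℝ, EM); F, E⟯) :
    ∃ W, L.IsCompleteLift X W := by
  choose W hf hμ using L.exists_completeLift_apply X
  have hsm := contMDiff_vectorField_of_separating (W := W) basicOrLinear
    (contMDiff_basicOrLinear (EM := EM) (F := F) (E := E)) eq_zero_of_basicOrLinear fun i => by
      cases i with
      | inl f =>
        have h : (fun p => dirDeriv (𝓘(ℝ, EM).prod 𝓘(ℝ, F)) (fun q : TotalSpace F E => f q.1) p (W p))
            = fun p => L.anchorDeriv X f p.1 := funext fun p => hf p f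
        exact h ▸ (L.anchorDeriv X f).contMDiff.comp (Bundle.contMDiff_proj E)
      | inr μ =>
        obtain ⟨ν, hν⟩ := L.exists_lieDeriv X μ
        have h : (fun p => dirDeriv (𝓘(ℝ, EM).prod 𝓘(ℝ, F)) μ.linearFun p (W p)) = ν.linearFun := by
          funext ⟨x, v⟩
          obtain ⟨Z, rfl⟩ := exists_section_apply_eq EM F v
          rw [hμ _ μ Z rfl, ← hν]
          rfl
        exact h ▸ ν.contMDiff_toFun
  exact ⟨⟨W, hsm⟩, fun f p => hf p f, fun μ Z x => hμ ⟨x, Z x⟩ μ Z rfl⟩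

variable {L}

theorem LieAlgebroid.IsCompleteLift.unique {X : Cₛ^∞⟮𝓘(ℝ, EM); F, E⟯}
    {W W' : SmoothVectorField (𝓘(ℝ, EM).prod 𝓘(ℝ, F)) (TotalSpace F E)}
    (h : L.IsCompleteLift X W) (h' : L.IsCompleteLift X W') : W = W' := by
  refine ContMDiffSection.ext fun p => sub_eq_zero.1 (eq_zero_of_basicOrLinear p _ fun i => ?_)
  rw [dirDeriv_vec_sub, sub_eq_zero]
  cases i with
  | inl f => exact (h.basic f p).trans (h'.basic f p).symm
  | inr μ =>
    obtain ⟨x, v⟩ := p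
    obtain ⟨Z, rfl⟩ := exists_section_apply_eq EM F v
    exact (h.linear μ Z x).trans (h'.linear μ Z x).symm

end CompleteLift

/-! ### The affine bundle as the level set height = 1 of its vector hull -/

section Hull

set_option linter.unusedSectionVars false

variable {EM : Type*} [NormedAddCommGroup EM] [NormedSpace ℝ EM] [FiniteDimensional ℝ EM]
  {M : Type*} [TopologicalSpace M] [T2Space M] [SigmaCompactSpace M] [ChartedSpace EM M]
  [IsManifold 𝓘(ℝ, EM) ∞ M]
  {F : Type*} [NormedAddCommGroup F] [NormedSpace ℝ F] [FiniteDimensional ℝ F]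
  {V : M → Type*} [∀ x, AddCommGroup (V x)] [∀ x, Module ℝ (V x)]
  [∀ x, TopologicalSpace (V x)] [TopologicalSpace (TotalSpace F V)] [FiberBundle F V]
  [VectorBundle ℝ F V] [ContMDiffVectorBundle ∞ F V 𝓘(ℝ, EM)]
  {A : M → Type*} [∀ x, AddTorsor (V x) (A x)] [TopologicalSpace (TotalSpace F A)]
  [ChartedSpace (ModelProd EM F) (TotalSpace F A)]
  [SmoothAffineBundle EM F V A]

namespace VectorHull

theorem eq_vector_add_smul_point {x : M} (a : A x) (α : VectorHull EM F V A x) :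
    α = vector x (split a α).1 + (split a α).2 • point x a :=
  ((split a).symm_apply_apply α).symm

theorem exists_global_trivialization (σ : AffineSection EM F V A) (e : Trivialization F (π F V))
    [MemTrivializationAtlas e] :
    ∃ t : Trivialization (F × ℝ) (π (F × ℝ) (VectorHull EM F V A)),
      MemTrivializationAtlas t ∧ t.baseSet = e.baseSet ∧
      ∀ p, t p = (p.1, e.linearMapAt ℝ p.1 (split (σ p.1) p.2).1, (split (σ p.1) p.2).2) := by
  obtain ⟨t, h, hb, ht⟩ := exists_trivialization (EM := EM) (V := V) isOpen_univ
    (σ.contMDiff_toFun.contMDiffOn) e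
  exact ⟨t, h, by rw [hb, univ_inter], ht⟩

theorem contMDiffAt_trivialization_snd {E : M → Type*} [∀ x, AddCommGroup (E x)] [∀ x, Module ℝ (E x)]
    [∀ x, TopologicalSpace (E x)] [TopologicalSpace (TotalSpace F E)] [FiberBundle F E]
    [VectorBundle ℝ F E] [ContMDiffVectorBundle ∞ F E 𝓘(ℝ, EM)]
    (e : Trivialization F (π F E)) [MemTrivializationAtlas e] {p : TotalSpace F E}
    (hp : p.1 ∈ e.baseSet) :
    ContMDiffAt (𝓘(ℝ, EM).prod 𝓘(ℝ, F)) 𝓘(ℝ, F) ∞ (fun q : TotalSpace F E => (e q).2) p :=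
  ((e.contMDiffAt_iff (by rw [e.mem_source]; exact hp)).1 contMDiffAt_id).2

/-- The vector component of the points of the vector hull with respect to a section of `A`. -/
theorem contMDiff_vectorPart (σ : AffineSection EM F V A) :
    ContMDiff (𝓘(ℝ, EM).prod 𝓘(ℝ, F × ℝ)) (𝓘(ℝ, EM).prod 𝓘(ℝ, F)) ∞
      (fun p : TotalSpace (F × ℝ) (VectorHull EM F V A) =>
        TotalSpace.mk' F (E := V) p.1 (split (σ p.1) p.2).1) := by
  intro p
  let e := trivializationAt F V p.1
  have hp : p.1 ∈ e.baseSet := FiberBundle.mem_baseSet_trivializationAt' p.1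
  obtain ⟨t, _, hb, ht⟩ := exists_global_trivialization σ e
  have hpt : p.1 ∈ t.baseSet := by rwa [hb]
  rw [e.contMDiffAt_iff (by rw [e.mem_source]; exact hp)]
  refine ⟨Bundle.contMDiffAt_proj _, ?_⟩
  refine ((contDiff_fst (𝕜 := ℝ) (E := F) (F := ℝ)).contMDiff.contMDiffAt.comp p
    (contMDiffAt_trivialization_snd t hpt)).congr_of_eventuallyEq ?_
  filter_upwards [(FiberBundle.continuous_proj (F × ℝ) (VectorHull EM F V A)).continuousAt.eventually
    (e.open_baseSet.mem_nhds hp)] with q hq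
  have hq' : q.1 ∈ e.baseSet := hq
  simp [ht, Trivialization.linearMapAt_apply, hq']

variable (EM F V A) in
/-- The fibrewise linear function on the vector hull that is `1` on `A`. -/
def height : DualSection EM (F × ℝ) (VectorHull EM F V A) where
  toFun x :=
    { toFun := fun α => (show Dual ℝ (A x →ᵃ[ℝ] ℝ) from α) (AffineMap.const ℝ (A x) 1)
      map_add' := fun _ _ => rfl
      map_smul' := fun _ _ => rfl }
  contMDiff_toFun := by
    intro p
    obtain ⟨σ⟩ : Nonempty (AffineSection EM F V A) := inferInstance
    let e := trivializationAt F V p.1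
    have hp : p.1 ∈ e.baseSet := FiberBundle.mem_baseSet_trivializationAt' p.1
    obtain ⟨t, _, hb, ht⟩ := exists_global_trivialization σ e
    have hpt : p.1 ∈ t.baseSet := by rwa [hb]
    refine ((contDiff_snd (𝕜 := ℝ) (E := F) (F := ℝ)).contMDiff.contMDiffAt.comp p
      (contMDiffAt_trivialization_snd t hpt)).congr_of_eventuallyEq ?_
    refine Filter.Eventually.of_forall fun q => ?_
    simp only [Function.comp, ht]
    rfl

theorem split_snd {x : M} (a : A x) (α : VectorHull EM F V A x) :
    (split a α).2 = (height EM F V A).toFun x α := rfl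

/-- An affine bundle is only required to have smooth translations by some local section τ.
Translation by σ is addition of σ - τ in V followed by translation by τ. -/
theorem contMDiff_translate (σ : AffineSection EM F V A) :
    ContMDiff (𝓘(ℝ, EM).prod 𝓘(ℝ, F)) (𝓘(ℝ, EM).prod 𝓘(ℝ, F)) ∞
      (fun p : TotalSpace F V => TotalSpace.mk' F p.1 (p.2 +ᵥ σ p.1 : A p.1)) := by
  intro p
  obtain ⟨U, hU, hx, τ, hτ, hτ'⟩ := SmoothAffineBundle.exists_local (EM := EM) (F := F) (V := V)
    (A := A) p.1
  let e := trivializationAt F V p.1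
  have hp : p.1 ∈ e.baseSet := FiberBundle.mem_baseSet_trivializationAt' p.1
  have hcont := FiberBundle.continuous_proj F V
  have hopA : IsOpen (π F A ⁻¹' U) := hU.preimage (SmoothAffineBundle.continuous_proj EM (V := V))
  have h1 : ContMDiffAt 𝓘(ℝ, EM) (𝓘(ℝ, EM).prod 𝓘(ℝ, F)) ∞
      (fun x => TotalSpace.mk' F x (σ x -ᵥ τ x : V x)) p.1 :=
    (hτ'.contMDiffAt (hopA.mem_nhds (x := TotalSpace.mk' F p.1 (σ p.1)) hx)).comp p.1
      (σ.contMDiff_toFun p.1)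
  have h2 : ContMDiffAt (𝓘(ℝ, EM).prod 𝓘(ℝ, F)) (𝓘(ℝ, EM).prod 𝓘(ℝ, F)) ∞
      (fun q : TotalSpace F V => TotalSpace.mk' F q.1 (q.2 + (σ q.1 -ᵥ τ q.1))) p := by
    rw [e.contMDiffAt_iff (by rw [e.mem_source]; exact hp)]
    refine ⟨Bundle.contMDiffAt_proj _, ?_⟩
    have h3 := (e.contMDiffAt_section_iff hp).1 h1
    refine ((contMDiffAt_trivialization_snd e hp).add
      (h3.comp p (Bundle.contMDiffAt_proj V))).congr_of_eventuallyEq ?_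
    filter_upwards [hcont.continuousAt.eventually (e.open_baseSet.mem_nhds hp)] with q hq
    exact (e.linear ℝ hq).map_add _ _
  have h4 := (hτ.contMDiffAt ((hU.preimage hcont).mem_nhds
    (x := TotalSpace.mk' F p.1 (p.2 + (σ p.1 -ᵥ τ p.1))) hx)).comp p h2
  refine h4.congr_of_eventuallyEq (Filter.Eventually.of_forall fun q => ?_)
  simp [add_vadd]

/-- The retraction of the vector hull onto `A` along the multiples of a section of `A`. -/
def retract (σ : AffineSection EM F V A) (p : TotalSpace (F × ℝ) (VectorHull EM F V A)) :
    TotalSpace F A :=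
  ⟨p.1, (split (σ p.1) p.2).1 +ᵥ σ p.1⟩

theorem contMDiff_retract (σ : AffineSection EM F V A) :
    ContMDiff (𝓘(ℝ, EM).prod 𝓘(ℝ, F × ℝ)) (𝓘(ℝ, EM).prod 𝓘(ℝ, F)) ∞ (retract σ) :=
  (contMDiff_translate σ).comp (contMDiff_vectorPart σ)

theorem retract_embed (σ : AffineSection EM F V A) (a : TotalSpace F A) :
    retract σ (embed EM F V A a) = a := by
  obtain ⟨x, a⟩ := a
  have h : (split (EM := EM) (F := F) (σ x) (point x a)).1 +ᵥ σ x = a := by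
    rw [split_point, vsub_vadd]
  exact congrArg (TotalSpace.mk' F x) h

/-- The retraction moves along σ until the height is 1. The explicit correction term allows linear
functions to be differentiated along it. -/
theorem embed_retract (σ : AffineSection EM F V A)
    (p : TotalSpace (F × ℝ) (VectorHull EM F V A)) :
    embed EM F V A (retract σ p) =
      ⟨p.1, p.2 + (1 - (height EM F V A).linearFun p) • point p.1 (σ p.1)⟩ := by
  obtain ⟨x, α⟩ := p
  have h : point (EM := EM) (F := F) x ((split (σ x) α).1 +ᵥ σ x) =
      α + (1 - (height EM F V A).toFun x α) • point x (σ x) := by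
    have h1 : point (EM := EM) (F := F) x ((split (σ x) α).1 +ᵥ σ x) =
        vector x (split (EM := EM) (F := F) (σ x) α).1 + point x (σ x) :=
      (point (EM := EM) (F := F) x).map_vadd _ _
    have h2 := eq_vector_add_smul_point (σ x) α
    rw [split_snd] at h2
    rw [h1, sub_smul, one_smul]
    nth_rewrite 2 [h2]
    abel
  exact congrArg (TotalSpace.mk' (F × ℝ) x) h

/-- The chain rule for a map with a smooth left inverse; in particular the embedding is an
immersion. -/
theorem mfderiv_retract_mfderiv_embed [IsManifold (𝓘(ℝ, EM).prod 𝓘(ℝ, F)) ∞ (TotalSpace F A)]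
    (σ : AffineSection EM F V A) (a : TotalSpace F A)
    (v : TangentSpace (𝓘(ℝ, EM).prod 𝓘(ℝ, F)) a) :
    (mfderiv (𝓘(ℝ, EM).prod 𝓘(ℝ, F × ℝ)) (𝓘(ℝ, EM).prod 𝓘(ℝ, F)) (retract σ) (embed EM F V A a)
      (mfderiv (𝓘(ℝ, EM).prod 𝓘(ℝ, F)) (𝓘(ℝ, EM).prod 𝓘(ℝ, F × ℝ)) (embed EM F V A) a v) :
      EM × F) = v := by
  have h1 := mfderiv_comp a ((contMDiff_retract σ).mdifferentiableAt (by simp)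
    (x := embed EM F V A a)) ((contMDiff_embed (EM := EM) (F := F) (V := V) (A := A)).mdifferentiableAt
      (by simp) (x := a))
  have h2 : retract σ ∘ embed EM F V A = id := funext (retract_embed σ)
  rw [h2, mfderiv_id] at h1
  exact (DFunLike.congr_fun h1 v).symm

/-- The functions that are constant or linear on the fibres of the vector hull separate the tangent
vectors of `A`. -/
theorem eq_zero_of_basicOrLinear_comp_embed
    [IsManifold (𝓘(ℝ, EM).prod 𝓘(ℝ, F)) ∞ (TotalSpace F A)] (a : TotalSpace F A)
    (v : TangentSpace (𝓘(ℝ, EM).prod 𝓘(ℝ, F)) a)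
    (hv : ∀ i, dirDeriv (𝓘(ℝ, EM).prod 𝓘(ℝ, F))
      (fun b => basicOrLinear (EM := EM) i (embed EM F V A b)) a v = 0) : v = 0 := by
  obtain ⟨σ⟩ : Nonempty (AffineSection EM F V A) := inferInstance
  have h1 : mfderiv (𝓘(ℝ, EM).prod 𝓘(ℝ, F)) (𝓘(ℝ, EM).prod 𝓘(ℝ, F × ℝ)) (embed EM F V A) a v = 0 := by
    refine eq_zero_of_basicOrLinear _ _ fun i => ?_
    rw [← hv i]
    exact (dirDeriv_comp ((contMDiff_basicOrLinear i).mdifferentiableAt (by simp))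
      (contMDiff_embed.mdifferentiableAt (by simp)) v).symm
  have h2 := mfderiv_retract_mfderiv_embed σ a v
  rw [h1, map_zero] at h2
  exact h2.symm

/-- A tangent vector of the vector hull at a point of `A` is tangent to `A` if it annihilates the
height function. -/
theorem exists_mfderiv_embed_eq [IsManifold (𝓘(ℝ, EM).prod 𝓘(ℝ, F)) ∞ (TotalSpace F A)]
    (a : TotalSpace F A)
    (u : TangentSpace (𝓘(ℝ, EM).prod 𝓘(ℝ, F × ℝ)) (embed EM F V A a))
    (hu : dirDeriv (𝓘(ℝ, EM).prod 𝓘(ℝ, F × ℝ)) (height EM F V A).linearFun (embed EM F V A a) u = 0) :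
    ∃ v : TangentSpace (𝓘(ℝ, EM).prod 𝓘(ℝ, F)) a,
      mfderiv (𝓘(ℝ, EM).prod 𝓘(ℝ, F)) (𝓘(ℝ, EM).prod 𝓘(ℝ, F × ℝ)) (embed EM F V A) a v = u := by
  obtain ⟨σ⟩ : Nonempty (AffineSection EM F V A) := inferInstance
  -- The candidate is the image of `u` under the derivative of the retraction. It remains to see
  -- that embedding after retraction fixes `u`, which is checked on test functions.
  obtain ⟨v, hv⟩ : ∃ v : EM × F, v = mfderiv (𝓘(ℝ, EM).prod 𝓘(ℝ, F × ℝ)) (𝓘(ℝ, EM).prod 𝓘(ℝ, F))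
    (retract σ) (embed EM F V A a) u := ⟨_, rfl⟩
  refine ⟨v, sub_eq_zero.1 (eq_zero_of_basicOrLinear _ _ fun i => ?_)⟩
  have hsm := contMDiff_basicOrLinear (E := VectorHull EM F V A) i
  rw [dirDeriv_vec_sub, sub_eq_zero]
  have h1 : dirDeriv (𝓘(ℝ, EM).prod 𝓘(ℝ, F)) (fun b => basicOrLinear (EM := EM) i (embed EM F V A b))
      a v = dirDeriv (𝓘(ℝ, EM).prod 𝓘(ℝ, F × ℝ))
        (fun q => basicOrLinear (EM := EM) i (embed EM F V A (retract σ q))) (embed EM F V A a) u := by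
    have h2 := dirDeriv_comp (I := 𝓘(ℝ, EM).prod 𝓘(ℝ, F))
      (f := fun b => basicOrLinear (EM := EM) i (embed EM F V A b))
      ((hsm.comp contMDiff_embed).mdifferentiableAt (by simp))
      ((contMDiff_retract σ).mdifferentiableAt (by simp) (x := embed EM F V A a)) u
    rw [h2, hv]
    have h3 : ∀ (b c : TotalSpace F A) (w : EM × F), b = c →
        dirDeriv (𝓘(ℝ, EM).prod 𝓘(ℝ, F)) (fun b => basicOrLinear (EM := EM) i (embed EM F V A b)) b w =
        dirDeriv (𝓘(ℝ, EM).prod 𝓘(ℝ, F))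
          (fun b => basicOrLinear (EM := EM) i (embed EM F V A b)) c w := by
      rintro b c w rfl; rfl
    exact h3 _ _ _ (retract_embed σ a).symm
  refine (dirDeriv_comp (hsm.mdifferentiableAt (by simp))
    (contMDiff_embed.mdifferentiableAt (by simp)) v).symm.trans (h1.trans ?_)
  cases i with
  | inl f => rfl
  | inr μ =>
    -- Composing a linear function with embedding after retraction adds (1 - h)⟨μ, σ⟩. Its
    -- derivative along `u` vanishes: on A the factor 1 - h is zero, and `hu` kills the derivative
    -- of that factor.
    have h4 : (fun q => basicOrLinear (EM := EM) (.inr μ) (embed EM F V A (retract σ q))) =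
        fun q => μ.linearFun q + (1 - (height EM F V A).linearFun q) * μ.smoothPairing σ.toHull q.1 := by
      funext q
      rw [embed_retract]
      change μ.toFun q.1 _ = _
      rw [map_add, map_smul]
      rfl
    have hπ : ContMDiff (𝓘(ℝ, EM).prod 𝓘(ℝ, F × ℝ)) 𝓘(ℝ, ℝ) ∞
        (fun q : TotalSpace (F × ℝ) (VectorHull EM F V A) => μ.smoothPairing σ.toHull q.1) :=
      (μ.smoothPairing σ.toHull).contMDiff.comp (Bundle.contMDiff_proj _)
    have hs : ContMDiff (𝓘(ℝ, EM).prod 𝓘(ℝ, F × ℝ)) 𝓘(ℝ, ℝ) ∞ (height EM F V A).linearFun :=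
      (height EM F V A).contMDiff_toFun
    have hμ : ContMDiff (𝓘(ℝ, EM).prod 𝓘(ℝ, F × ℝ)) 𝓘(ℝ, ℝ) ∞ μ.linearFun := μ.contMDiff_toFun
    have h1s : ContMDiff (𝓘(ℝ, EM).prod 𝓘(ℝ, F × ℝ)) 𝓘(ℝ, ℝ) ∞
        (fun q => 1 - (height EM F V A).linearFun q) := contMDiff_const.sub hs
    have hm : ContMDiff (𝓘(ℝ, EM).prod 𝓘(ℝ, F × ℝ)) 𝓘(ℝ, ℝ) ∞
        (fun q => (1 - (height EM F V A).linearFun q) * μ.smoothPairing σ.toHull q.1) := h1s.mul hπ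
    rw [h4, dirDeriv_add (hμ.mdifferentiableAt (by simp)) (hm.mdifferentiableAt (by simp)),
      dirDeriv_mul (f := fun q => 1 - (height EM F V A).linearFun q)
        (h1s.mdifferentiableAt (by simp)) (hπ.mdifferentiableAt (by simp)),
      dirDeriv_sub (f := fun _ => 1) mdifferentiableAt_const
        (hs.mdifferentiableAt (by simp)), hu]
    have h5 : (height EM F V A).linearFun (embed EM F V A a) = 1 := rfl
    rw [h5]
    simp [basicOrLinear]

end VectorHull

/-! ### Restriction of tangent vector fields to the affine bundle -/

section Restriction

variable [IsManifold (𝓘(ℝ, EM).prod 𝓘(ℝ, F)) ∞ (TotalSpace F A)]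

open VectorHull

theorem contMDiff_basicOrLinear_comp_embed
    (i : C^∞⟮𝓘(ℝ, EM), M; ℝ⟯ ⊕ DualSection EM (F × ℝ) (VectorHull EM F V A)) :
    ContMDiff (𝓘(ℝ, EM).prod 𝓘(ℝ, F)) 𝓘(ℝ, ℝ) ∞
      (fun b => basicOrLinear (EM := EM) i (embed EM F V A b)) :=
  (contMDiff_basicOrLinear i).comp contMDiff_embed

theorem IsRestriction.dirDeriv_eq {W' : ∀ p : TotalSpace (F × ℝ) (VectorHull EM F V A),
      TangentSpace (𝓘(ℝ, EM).prod 𝓘(ℝ, F × ℝ)) p}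
    {W : SmoothVectorField (𝓘(ℝ, EM).prod 𝓘(ℝ, F)) (TotalSpace F A)}
    (h : IsRestriction W' W)
    (i : C^∞⟮𝓘(ℝ, EM), M; ℝ⟯ ⊕ DualSection EM (F × ℝ) (VectorHull EM F V A)) (a : TotalSpace F A) :
    dirDeriv (𝓘(ℝ, EM).prod 𝓘(ℝ, F)) (fun b => basicOrLinear (EM := EM) i (embed EM F V A b)) a (W a) =
      dirDeriv (𝓘(ℝ, EM).prod 𝓘(ℝ, F × ℝ)) (basicOrLinear i) (embed EM F V A a)
        (W' (embed EM F V A a)) := by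
  rw [← h a]
  exact dirDeriv_comp ((contMDiff_basicOrLinear i).mdifferentiableAt (by simp))
    (contMDiff_embed.mdifferentiableAt (by simp)) (W a)

/-- Annihilating the height gives tangency, hence a vector of A at each point. Since the restricted
test functions separate, they give both smoothness and uniqueness; the equivalence records existence
and uniqueness together. -/
theorem exists_restriction {W' : ∀ p : TotalSpace (F × ℝ) (VectorHull EM F V A),
      TangentSpace (𝓘(ℝ, EM).prod 𝓘(ℝ, F × ℝ)) p}
    (htan : ∀ a, dirDeriv (𝓘(ℝ, EM).prod 𝓘(ℝ, F × ℝ)) (height EM F V A).linearFun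
      (embed EM F V A a) (W' (embed EM F V A a)) = 0)
    (hsm : ∀ i, ContMDiff (𝓘(ℝ, EM).prod 𝓘(ℝ, F × ℝ)) 𝓘(ℝ, ℝ) ∞
      (fun p => dirDeriv (𝓘(ℝ, EM).prod 𝓘(ℝ, F × ℝ)) (basicOrLinear (EM := EM) i) p (W' p))) :
    ∃ W₀ : SmoothVectorField (𝓘(ℝ, EM).prod 𝓘(ℝ, F)) (TotalSpace F A),
      ∀ W, IsRestriction W' W ↔ W = W₀ := by
  choose W hW using fun a => exists_mfderiv_embed_eq a (W' (embed EM F V A a)) (htan a)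
  have hWsm := contMDiff_vectorField_of_separating (W := W)
    (fun i b => basicOrLinear (EM := EM) i (embed EM F V A b)) contMDiff_basicOrLinear_comp_embed
    eq_zero_of_basicOrLinear_comp_embed fun i => by
      have h : (fun a => dirDeriv (𝓘(ℝ, EM).prod 𝓘(ℝ, F))
          (fun b => basicOrLinear (EM := EM) i (embed EM F V A b)) a (W a)) =
          fun a => dirDeriv (𝓘(ℝ, EM).prod 𝓘(ℝ, F × ℝ)) (basicOrLinear i) (embed EM F V A a)
            (W' (embed EM F V A a)) := by
        funext a
        rw [← hW a]
        exact dirDeriv_comp ((contMDiff_basicOrLinear i).mdifferentiableAt (by simp))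
          (contMDiff_embed.mdifferentiableAt (by simp)) (W a)
      exact h ▸ (hsm i).comp contMDiff_embed
  have hres : IsRestriction W' (⟨W, hWsm⟩ : SmoothVectorField _ _) := hW
  refine ⟨⟨W, hWsm⟩, fun W₁ => ⟨fun h => ?_, fun h => h ▸ hres⟩⟩
  refine ContMDiffSection.ext fun a =>
    sub_eq_zero.1 (eq_zero_of_basicOrLinear_comp_embed a _ fun i => ?_)
  rw [dirDeriv_vec_sub, h.dirDeriv_eq, hres.dirDeriv_eq, sub_self]

end Restriction

end Hull

/-! ### Algebra: extension of a Lie–Rinehart algebra by a derivation -/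

section LieRinehart

variable {R S : Type*} [CommRing R] [Algebra ℝ R] [AddCommGroup S] [Module R S] [Module ℝ S]
  [IsScalarTower ℝ R S] (δ : Derivation ℝ R R) (ρ : S →ₗ[R] Derivation ℝ R R)
  (D : S →ₗ[ℝ] S) (B : S →ₗ[ℝ] S →ₗ[ℝ] S)

/-- The bracket on `R × S` that extends the bracket `B` of a Lie–Rinehart algebra `S` with anchor `ρ`
by the derivation `D` of `B` with symbol `δ`. -/
def extensionBracket : R × S →ₗ[ℝ] R × S →ₗ[ℝ] R × S :=
  LinearMap.mk₂ ℝ (fun X Y => ((X.1 • δ + ρ X.2) Y.1 - (Y.1 • δ + ρ Y.2) X.1,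
      X.1 • D Y.2 - Y.1 • D X.2 + B X.2 Y.2))
    (fun X X' Y => by
      ext
      · simp; ring
      · simp; module)
    (fun c X Y => by
      have h : ρ (c • X.2) = c • ρ X.2 := by rw [← algebraMap_smul R, map_smul, algebraMap_smul]
      ext
      · simp [h, smul_sub]
      · simp [smul_sub, smul_comm _ c])
    (fun X Y Y' => by
      ext
      · simp; ring
      · simp; module)
    (fun c X Y => by
      have h : ρ (c • Y.2) = c • ρ Y.2 := by rw [← algebraMap_smul R, map_smul, algebraMap_smul]
      ext
      · simp [h, smul_sub]
      · simp [smul_sub, smul_comm _ c])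

variable {δ ρ D B}

theorem extensionBracket_apply (X Y : R × S) : extensionBracket δ ρ D B X Y =
    ((X.1 • δ + ρ X.2) Y.1 - (Y.1 • δ + ρ Y.2) X.1, X.1 • D Y.2 - Y.1 • D X.2 + B X.2 Y.2) :=
  rfl

theorem extensionBracket_skew (hB : ∀ v w, B v w = -B w v) (X Y : R × S) :
    extensionBracket δ ρ D B X Y = -extensionBracket δ ρ D B Y X := by
  rw [extensionBracket_apply, extensionBracket_apply, hB Y.2]
  ext
  · simp
  · simp only [Prod.snd_neg]; abel

theorem extensionBracket_smul (hD : ∀ (f : R) v, D (f • v) = f • D v + δ f • v)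
    (hBs : ∀ v (f : R) w, B v (f • w) = f • B v w + ρ v f • w) (X Y : R × S) (f : R) :
    extensionBracket δ ρ D B X (f • Y) =
      f • extensionBracket δ ρ D B X Y + (X.1 • δ + ρ X.2) f • Y := by
  simp only [extensionBracket_apply]
  ext
  · simp
    ring
  · simp [hD, hBs]
    module

/-- The anchor of the extension is a homomorphism of brackets. -/
theorem extensionBracket_anchor (hρD : ∀ v f, ρ (D v) f = δ (ρ v f) - ρ v (δ f))
    (hρB : ∀ v w f, ρ (B v w) f = ρ v (ρ w f) - ρ w (ρ v f)) (X Y : R × S) (f : R) :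
    ((extensionBracket δ ρ D B X Y).1 • δ + ρ (extensionBracket δ ρ D B X Y).2) f =
      (X.1 • δ + ρ X.2) ((Y.1 • δ + ρ Y.2) f) - (Y.1 • δ + ρ Y.2) ((X.1 • δ + ρ X.2) f) := by
  simp [extensionBracket_apply, hρD, hρB]
  ring

/-- In the function component, compatibility of the anchors turns the cyclic sum into commutators
that cancel in pairs. In the other component, the Leibniz and derivation rules remove everything
except the Jacobi sum of `B`. -/
theorem extensionBracket_jacobi
    (hD : ∀ (f : R) v, D (f • v) = f • D v + δ f • v)
    (hBs : ∀ v (f : R) w, B v (f • w) = f • B v w + ρ v f • w)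
    (hDB : ∀ v w, D (B v w) = B v (D w) - B w (D v))
    (hJ : ∀ u v w, B u (B v w) + B v (B w u) + B w (B u v) = 0)
    (hρD : ∀ v f, ρ (D v) f = δ (ρ v f) - ρ v (δ f))
    (hρB : ∀ v w f, ρ (B v w) f = ρ v (ρ w f) - ρ w (ρ v f)) (X Y Z : R × S) :
    extensionBracket δ ρ D B X (extensionBracket δ ρ D B Y Z) +
      extensionBracket δ ρ D B Y (extensionBracket δ ρ D B Z X) +
      extensionBracket δ ρ D B Z (extensionBracket δ ρ D B X Y) = 0 := by
  ext
  · simp only [Prod.fst_add, Prod.fst_zero]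
    rw [extensionBracket_apply X, extensionBracket_apply Y (extensionBracket δ ρ D B Z X),
      extensionBracket_apply Z (extensionBracket δ ρ D B X Y)]
    simp only [extensionBracket_anchor hρD hρB]
    simp only [extensionBracket_apply, map_sub]
    abel
  · have h := hJ X.2 Y.2 Z.2
    simp [extensionBracket_apply, hD, hBs, hDB]
    linear_combination (norm := module) h

end LieRinehart

/-! ### Linear parts of the affine bracket and the anchor of the hull -/

section LieAffgebroid

set_option linter.unusedSectionVars false

variable {EM : Type*} [NormedAddCommGroup EM] [NormedSpace ℝ EM] [FiniteDimensional ℝ EM]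
  {M : Type*} [TopologicalSpace M] [T2Space M] [SigmaCompactSpace M] [ChartedSpace EM M]
  [IsManifold 𝓘(ℝ, EM) ∞ M]
  {F : Type*} [NormedAddCommGroup F] [NormedSpace ℝ F] [FiniteDimensional ℝ F]
  {V : M → Type*} [∀ x, AddCommGroup (V x)] [∀ x, Module ℝ (V x)]
  [∀ x, TopologicalSpace (V x)] [TopologicalSpace (TotalSpace F V)] [FiberBundle F V]
  [VectorBundle ℝ F V] [ContMDiffVectorBundle ∞ F V 𝓘(ℝ, EM)]
  {A : M → Type*} [∀ x, AddTorsor (V x) (A x)] [TopologicalSpace (TotalSpace F A)]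
  [ChartedSpace (ModelProd EM F) (TotalSpace F A)]
  [SmoothAffineBundle EM F V A]

section AnchorDerivation

variable {E : M → Type*} [∀ x, AddCommGroup (E x)] [∀ x, Module ℝ (E x)]
  [∀ x, TopologicalSpace (E x)] [TopologicalSpace (TotalSpace F E)] [FiberBundle F E]
  [VectorBundle ℝ F E] [ContMDiffVectorBundle ∞ F E 𝓘(ℝ, EM)]

instance instIsScalarTowerSections :
    IsScalarTower ℝ C^∞⟮𝓘(ℝ, EM), M; ℝ⟯ Cₛ^∞⟮𝓘(ℝ, EM); F, E⟯ where
  smul_assoc c f s := ContMDiffSection.ext fun x => smul_assoc c (f x) (s x)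

/-- The derivations of the algebra of smooth functions given by a morphism of vector bundles to the
tangent bundle. -/
def anchorDerivation {ρ : ∀ x, E x →ₗ[ℝ] TangentSpace 𝓘(ℝ, EM) x}
    (hρ : ContMDiff (𝓘(ℝ, EM).prod 𝓘(ℝ, F)) 𝓘(ℝ, EM).tangent ∞
      (fun p : TotalSpace F E => (⟨p.1, ρ p.1 p.2⟩ : TangentBundle 𝓘(ℝ, EM) M))) :
    Cₛ^∞⟮𝓘(ℝ, EM); F, E⟯ →ₗ[C^∞⟮𝓘(ℝ, EM), M; ℝ⟯]
      Derivation ℝ C^∞⟮𝓘(ℝ, EM), M; ℝ⟯ C^∞⟮𝓘(ℝ, EM), M; ℝ⟯ where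
  toFun X := Derivation.mk'
    { toFun := fun f => ⟨fun x => dirDeriv 𝓘(ℝ, EM) f x (ρ x (X x)),
        contMDiff_dirDeriv (hρ.comp X.contMDiff) f.contMDiff⟩
      map_add' := fun f g => ContMDiffMap.ext fun x =>
        dirDeriv_add (f.contMDiff.mdifferentiableAt (by simp))
          (g.contMDiff.mdifferentiableAt (by simp)) _
      map_smul' := fun c f => ContMDiffMap.ext fun x => by
        refine (dirDeriv_mul (f := fun _ => c) mdifferentiableAt_const
          (f.contMDiff.mdifferentiableAt (by simp)) _).trans ?_
        rw [dirDeriv_const, mul_zero, add_zero]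
        rfl }
    fun f g => ContMDiffMap.ext fun x => dirDeriv_mul (f.contMDiff.mdifferentiableAt (by simp))
      (g.contMDiff.mdifferentiableAt (by simp)) _
  map_add' X Y := by
    ext f x
    refine Eq.trans ?_ (dirDeriv_vec_add _ _)
    exact congrArg _ (map_add (ρ x) (X x) (Y x))
  map_smul' c X := by
    ext f x
    refine Eq.trans ?_ (dirDeriv_vec_smul _ _)
    exact congrArg _ (map_smul (ρ x) (c x) (X x))

/-- Settles the rank zero case, where symbols cannot be compared. -/
theorem section_eq_zero [Subsingleton F] (v : Cₛ^∞⟮𝓘(ℝ, EM); F, E⟯) : v = 0 := by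
  refine ContMDiffSection.ext fun x => ?_
  let e := (trivializationAt F E x).linearEquivAt ℝ x (FiberBundle.mem_baseSet_trivializationAt' x)
  exact e.injective (Subsingleton.elim _ _)

end AnchorDerivation

open VectorHull

variable (L : LieAffgebroid EM F V A)

namespace LieAffgebroid

theorem bracket_self (α : AffineSection EM F V A) : L.bracket α α = 0 := by
  refine ContMDiffSection.ext fun x => ?_
  have h : L.bracket α α x = -L.bracket α α x := congrArg (fun s => s x) (L.skew α α)
  have h2 : (2 : ℝ) • L.bracket α α x = 0 := by rw [two_smul]; nth_rewrite 1 [h]; exact neg_add_cancel _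
  exact (smul_eq_zero.1 h2).resolve_left two_ne_zero

theorem bracket_vadd_right (α β : AffineSection EM F V A) (v : Cₛ^∞⟮𝓘(ℝ, EM); F, V⟯) :
    L.bracket α (v +ᵥ β) = L.bracketAV α v + L.bracket α β :=
  (L.bracket α).map_vadd β v

theorem bracketAV_vadd (α : AffineSection EM F V A) (v w : Cₛ^∞⟮𝓘(ℝ, EM); F, V⟯) :
    L.bracketAV (v +ᵥ α) w = L.bracketVV v w + L.bracketAV α w := by
  unfold bracketAV
  rw [L.bracket.map_vadd]
  rfl

theorem bracket_vadd_left (α β : AffineSection EM F V A) (v : Cₛ^∞⟮𝓘(ℝ, EM); F, V⟯) :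
    L.bracket (v +ᵥ α) β = L.bracket α β - L.bracketAV β v := by
  rw [L.skew, L.bracket_vadd_right, L.skew α]
  abel

/-- With a fixed σ, the affine bracket is encoded by D = [σ, ·] and the bilinear part B, so the
affine axioms become identities between D and B. -/
theorem bracket_vadd_vadd (σ : AffineSection EM F V A) (v w : Cₛ^∞⟮𝓘(ℝ, EM); F, V⟯) :
    L.bracket (v +ᵥ σ) (w +ᵥ σ) = L.bracketAV σ w - L.bracketAV σ v + L.bracketVV v w := by
  rw [L.bracket_vadd_right, L.bracketAV_vadd, L.bracket_vadd_left, L.bracket_self]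
  abel

theorem bracketVV_skew (v w : Cₛ^∞⟮𝓘(ℝ, EM); F, V⟯) : L.bracketVV v w = -L.bracketVV w v := by
  obtain ⟨σ⟩ : Nonempty (AffineSection EM F V A) := inferInstance
  have h := L.skew (v +ᵥ σ) (w +ᵥ σ)
  rw [L.bracket_vadd_vadd, L.bracket_vadd_vadd] at h
  linear_combination (norm := module) h

/-- The affine-linear part of the bracket as a linear map. -/
def bracketAVLinear (α : AffineSection EM F V A) :
    Cₛ^∞⟮𝓘(ℝ, EM); F, V⟯ →ₗ[ℝ] Cₛ^∞⟮𝓘(ℝ, EM); F, V⟯ :=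
  (L.bracket α).linear

/-- The bilinear part of the bracket as a bilinear map. -/
def bracketVVLinear :
    Cₛ^∞⟮𝓘(ℝ, EM); F, V⟯ →ₗ[ℝ] Cₛ^∞⟮𝓘(ℝ, EM); F, V⟯ →ₗ[ℝ] Cₛ^∞⟮𝓘(ℝ, EM); F, V⟯ :=
  LinearMap.mk₂ ℝ L.bracketVV
    (fun v v' w => by unfold bracketVV; rw [map_add]; rfl)
    (fun c v w => by unfold bracketVV; rw [map_smul]; rfl)
    (fun v w w' => by unfold bracketVV; rw [map_add])
    (fun c v w => by unfold bracketVV; rw [map_smul])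

theorem bracketAVLinear_apply (α : AffineSection EM F V A) (v : Cₛ^∞⟮𝓘(ℝ, EM); F, V⟯) :
    L.bracketAVLinear α v = L.bracketAV α v := rfl

theorem bracketVVLinear_apply (v w : Cₛ^∞⟮𝓘(ℝ, EM); F, V⟯) :
    L.bracketVVLinear v w = L.bracketVV v w := rfl

/-- The Jacobi identity for σ, v + σ, w + σ: the terms with D applied twice cancel, and what remains
says that D is a derivation of B. -/
theorem bracketAV_bracketVV (σ : AffineSection EM F V A) (v w : Cₛ^∞⟮𝓘(ℝ, EM); F, V⟯) :
    L.bracketAV σ (L.bracketVV v w) =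
      L.bracketVV v (L.bracketAV σ w) - L.bracketVV w (L.bracketAV σ v) := by
  have h : L.bracketAV σ (L.bracket (v +ᵥ σ) (w +ᵥ σ)) +
    L.bracketAV (v +ᵥ σ) (L.bracket (w +ᵥ σ) σ) + L.bracketAV (w +ᵥ σ) (L.bracket σ (v +ᵥ σ)) = 0 :=
    L.jacobi σ (v +ᵥ σ) (w +ᵥ σ)
  simp only [L.bracketAV_vadd, L.bracket_vadd_vadd, L.bracket_vadd_left, L.bracket_vadd_right,
    L.bracket_self, ← bracketAVLinear_apply, ← bracketVVLinear_apply, map_add, map_sub, map_zero] at h ⊢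
  linear_combination (norm := module) h

/-- In the Jacobi identity for u + σ, v + σ, w + σ, the terms that involve D cancel by three
instances of the derivation property. -/
theorem bracketVV_jacobi (u v w : Cₛ^∞⟮𝓘(ℝ, EM); F, V⟯) :
    L.bracketVV u (L.bracketVV v w) + L.bracketVV v (L.bracketVV w u) +
      L.bracketVV w (L.bracketVV u v) = 0 := by
  obtain ⟨σ⟩ : Nonempty (AffineSection EM F V A) := inferInstance
  have h : L.bracketAV (u +ᵥ σ) (L.bracket (v +ᵥ σ) (w +ᵥ σ)) +
      L.bracketAV (v +ᵥ σ) (L.bracket (w +ᵥ σ) (u +ᵥ σ)) +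
      L.bracketAV (w +ᵥ σ) (L.bracket (u +ᵥ σ) (v +ᵥ σ)) = 0 :=
    L.jacobi (u +ᵥ σ) (v +ᵥ σ) (w +ᵥ σ)
  have h1 := L.bracketAV_bracketVV σ u v
  have h2 := L.bracketAV_bracketVV σ v w
  have h3 := L.bracketAV_bracketVV σ w u
  simp only [L.bracketAV_vadd, L.bracket_vadd_vadd,
    ← bracketAVLinear_apply, ← bracketVVLinear_apply, map_add, map_sub] at h h1 h2 h3 ⊢
  linear_combination (norm := module) h - h1 - h2 - h3

/-- The anchor of the vector hull. -/
def hullAnchor (σ : AffineSection EM F V A) (x : M) :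
    VectorHull EM F V A x →ₗ[ℝ] TangentSpace 𝓘(ℝ, EM) x :=
  ((L.anchor x).linear.comp (LinearMap.fst ℝ (V x) ℝ) +
    (LinearMap.snd ℝ (V x) ℝ).smulRight (L.anchor x (σ x))).comp (split (σ x)).toLinearMap

theorem hullAnchor_apply (σ : AffineSection EM F V A) (x : M) (p : VectorHull EM F V A x) :
    L.hullAnchor σ x p = (L.anchor x).linear (split (σ x) p).1 +
      (split (σ x) p).2 • L.anchor x (σ x) :=
  rfl

theorem hullAnchor_point (σ : AffineSection EM F V A) (x : M) (a : A x) :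
    L.hullAnchor σ x (point x a) = L.anchor x a := by
  rw [hullAnchor_apply, split_point, one_smul]
  have h := (L.anchor x).map_vadd (σ x) (a -ᵥ σ x)
  rw [vsub_vadd] at h
  exact h.symm

/-- The linear anchor at p is the affine anchor at the retraction of p plus (h(p) - 1) times the
anchor of σ, so its smoothness follows from that of the affine anchor. -/
theorem contMDiff_hullAnchor (σ : AffineSection EM F V A) :
    ContMDiff (𝓘(ℝ, EM).prod 𝓘(ℝ, F × ℝ)) 𝓘(ℝ, EM).tangent ∞
      (fun p : TotalSpace (F × ℝ) (VectorHull EM F V A) =>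
        (⟨p.1, L.hullAnchor σ p.1 p.2⟩ : TangentBundle 𝓘(ℝ, EM) M)) := by
  intro p
  let e := trivializationAt EM (TangentSpace 𝓘(ℝ, EM) : M → Type _) p.1
  have hp : p.1 ∈ e.baseSet := FiberBundle.mem_baseSet_trivializationAt' p.1
  have hcont := FiberBundle.continuous_proj (F × ℝ) (VectorHull EM F V A)
  have hs : ContMDiff (𝓘(ℝ, EM).prod 𝓘(ℝ, F × ℝ)) 𝓘(ℝ, ℝ) ∞ (height EM F V A).linearFun :=
    (height EM F V A).contMDiff_toFun
  have h1 := ((e.contMDiffAt_iff (by rw [e.mem_source]; exact hp)).1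
    ((L.contMDiff_anchor.comp (contMDiff_retract σ)) p)).2
  have h2 := ((e.contMDiffAt_iff (by rw [e.mem_source]; exact hp)).1
    ((L.contMDiff_anchor.comp (σ.contMDiff_toFun.comp (Bundle.contMDiff_proj _))) p)).2
  refine (e.contMDiffAt_iff (by rw [e.mem_source]; exact hp)).2 ⟨Bundle.contMDiffAt_proj _, ?_⟩
  refine (h1.add ((hs.contMDiffAt.sub (contMDiffAt_const (c := (1 : ℝ)))).smul h2)).congr_of_eventuallyEq ?_
  filter_upwards [hcont.continuousAt.eventually (e.open_baseSet.mem_nhds hp)] with q hq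
  have hq' : q.1 ∈ e.baseSet := hq
  have h3 : L.hullAnchor σ q.1 q.2 = L.anchor q.1 (retract σ q).2 +
      ((height EM F V A).linearFun q - 1) • L.anchor q.1 (σ q.1) := by
    rw [hullAnchor_apply, split_snd]
    change _ = L.anchor q.1 ((split (σ q.1) q.2).1 +ᵥ σ q.1) + _
    rw [(L.anchor q.1).map_vadd]
    change _ + (height EM F V A).linearFun q • _ = _ + _ + _
    module
  rw [h3]
  refine ((e.linear ℝ hq').map_add _ _).trans ?_
  exact congrArg _ ((e.linear ℝ hq').map_smul _ _)

end LieAffgebroid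

end LieAffgebroid

/-! ### Existence and uniqueness of the Lie algebroid on the hull -/

section HullAlgebroid

set_option linter.unusedSectionVars false

variable {EM : Type*} [NormedAddCommGroup EM] [NormedSpace ℝ EM] [FiniteDimensional ℝ EM]
  {M : Type*} [TopologicalSpace M] [T2Space M] [SigmaCompactSpace M] [ChartedSpace EM M]
  [IsManifold 𝓘(ℝ, EM) ∞ M]
  {F : Type*} [NormedAddCommGroup F] [NormedSpace ℝ F] [FiniteDimensional ℝ F]
  {V : M → Type*} [∀ x, AddCommGroup (V x)] [∀ x, Module ℝ (V x)]
  [∀ x, TopologicalSpace (V x)] [TopologicalSpace (TotalSpace F V)] [FiberBundle F V]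
  [VectorBundle ℝ F V] [ContMDiffVectorBundle ∞ F V 𝓘(ℝ, EM)]
  {A : M → Type*} [∀ x, AddTorsor (V x) (A x)] [TopologicalSpace (TotalSpace F A)]
  [ChartedSpace (ModelProd EM F) (TotalSpace F A)]
  [SmoothAffineBundle EM F V A]

open VectorHull

variable (A) in
/-- The inclusion of the sections of `V` into the sections of the vector hull as a linear map over
the smooth functions. -/
def vectorToHullLinear : Cₛ^∞⟮𝓘(ℝ, EM); F, V⟯ →ₗ[C^∞⟮𝓘(ℝ, EM), M; ℝ⟯]
    Cₛ^∞⟮𝓘(ℝ, EM); F × ℝ, VectorHull EM F V A⟯ where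
  toFun := vectorToHull A
  map_add' v w := ContMDiffSection.ext fun x => map_add (vector x) (v x) (w x)
  map_smul' f v := ContMDiffSection.ext fun x => map_smul (vector x) (f x) (v x)

theorem vectorToHullLinear_apply (v : Cₛ^∞⟮𝓘(ℝ, EM); F, V⟯) :
    vectorToHullLinear A v = vectorToHull A v := rfl

theorem AffineSection.toHull_vadd (σ : AffineSection EM F V A) (v : Cₛ^∞⟮𝓘(ℝ, EM); F, V⟯) :
    (v +ᵥ σ).toHull = vectorToHull A v + σ.toHull :=
  ContMDiffSection.ext fun x => (point (EM := EM) (F := F) x).map_vadd (σ x) (v x)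

/-- A section `σ` of `A` splits the sections of the vector hull: they are uniquely of the form
`f • σ + v`. -/
def AffineSection.hullEquiv (σ : AffineSection EM F V A) :
    (C^∞⟮𝓘(ℝ, EM), M; ℝ⟯ × Cₛ^∞⟮𝓘(ℝ, EM); F, V⟯) ≃ₗ[C^∞⟮𝓘(ℝ, EM), M; ℝ⟯]
      Cₛ^∞⟮𝓘(ℝ, EM); F × ℝ, VectorHull EM F V A⟯ where
  toFun p := p.1 • σ.toHull + vectorToHullLinear A p.2
  invFun X := ((height EM F V A).smoothPairing X,
    ⟨fun x => (split (σ x) (X x)).1, (contMDiff_vectorPart σ).comp X.contMDiff⟩)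
  map_add' p q := by
    simp only [Prod.fst_add, Prod.snd_add, map_add]
    module
  map_smul' f p := by
    simp only [Prod.smul_fst, Prod.smul_snd, map_smul, RingHom.id_apply, smul_eq_mul]
    module
  left_inv p := by
    have h : ∀ x, split (σ x) (p.1 x • point (EM := EM) (F := F) x (σ x) + vector x (p.2 x)) =
        (p.2 x, p.1 x) := fun x => by
      rw [map_add, map_smul, split_point, split_vector]
      simp
    refine Prod.ext (ContMDiffMap.ext fun x => ?_) (ContMDiffSection.ext fun x => ?_)
    · exact congrArg Prod.snd (h x)
    · exact congrArg Prod.fst (h x)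
  right_inv X := ContMDiffSection.ext fun x => by
    refine Eq.trans ?_ (eq_vector_add_smul_point (σ x) (X x)).symm
    exact add_comm _ _

theorem AffineSection.hullEquiv_apply (σ : AffineSection EM F V A)
    (p : C^∞⟮𝓘(ℝ, EM), M; ℝ⟯ × Cₛ^∞⟮𝓘(ℝ, EM); F, V⟯) :
    σ.hullEquiv p = p.1 • σ.toHull + vectorToHullLinear A p.2 := rfl

theorem AffineSection.hullEquiv_symm_toHull (σ τ : AffineSection EM F V A) :
    σ.hullEquiv.symm τ.toHull = (1, τ -ᵥ σ) := by
  rw [LinearEquiv.symm_apply_eq, hullEquiv_apply, one_smul, add_comm, vectorToHullLinear_apply,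
    ← toHull_vadd, vsub_vadd]

namespace LieAffgebroid

variable (L : LieAffgebroid EM F V A) (σ : AffineSection EM F V A)

/-- The derivation of the smooth functions given by the anchor of a section of `A`. -/
def anchorA : Derivation ℝ C^∞⟮𝓘(ℝ, EM), M; ℝ⟯ C^∞⟮𝓘(ℝ, EM), M; ℝ⟯ :=
  anchorDerivation (L.contMDiff_hullAnchor σ) σ.toHull

/-- The derivations of the smooth functions given by the linear part of the anchor. -/
def anchorV : Cₛ^∞⟮𝓘(ℝ, EM); F, V⟯ →ₗ[C^∞⟮𝓘(ℝ, EM), M; ℝ⟯]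
    Derivation ℝ C^∞⟮𝓘(ℝ, EM), M; ℝ⟯ C^∞⟮𝓘(ℝ, EM), M; ℝ⟯ :=
  (anchorDerivation (L.contMDiff_hullAnchor σ)).comp (vectorToHullLinear A)

theorem anchorDerivation_hullEquiv (p : C^∞⟮𝓘(ℝ, EM), M; ℝ⟯ × Cₛ^∞⟮𝓘(ℝ, EM); F, V⟯) :
    anchorDerivation (L.contMDiff_hullAnchor σ) (σ.hullEquiv p) =
      p.1 • L.anchorA σ + L.anchorV σ p.2 := by
  rw [AffineSection.hullEquiv_apply, map_add, map_smul]
  rfl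

theorem bracketAVLinear_smul (f : C^∞⟮𝓘(ℝ, EM), M; ℝ⟯) (v : Cₛ^∞⟮𝓘(ℝ, EM); F, V⟯) :
    L.bracketAVLinear σ (f • v) = f • L.bracketAVLinear σ v + L.anchorA σ f • v := by
  refine ContMDiffSection.ext fun x => (L.leibniz σ f v x).trans ?_
  rw [← L.hullAnchor_point σ]
  rfl

/-- B(v, ·) is the difference of [v + σ, ·] and [σ, ·], both covered by the Leibniz axiom, and their
symbols subtract to the linear part of the anchor at v. -/
theorem bracketVVLinear_smul (v : Cₛ^∞⟮𝓘(ℝ, EM); F, V⟯) (f : C^∞⟮𝓘(ℝ, EM), M; ℝ⟯)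
    (w : Cₛ^∞⟮𝓘(ℝ, EM); F, V⟯) :
    L.bracketVVLinear v (f • w) = f • L.bracketVVLinear v w + L.anchorV σ v f • w := by
  have h1 : ∀ u, L.bracketVVLinear v u = L.bracketAVLinear (v +ᵥ σ) u - L.bracketAVLinear σ u :=
    fun u => eq_sub_of_add_eq (L.bracketAV_vadd σ v u).symm
  have h2 : L.bracketAVLinear (v +ᵥ σ) (f • w) = f • L.bracketAVLinear (v +ᵥ σ) w +
      (L.anchorV σ v f + L.anchorA σ f) • w := by
    refine ContMDiffSection.ext fun x => (L.leibniz (v +ᵥ σ) f w x).trans ?_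
    rw [← L.hullAnchor_point σ]
    have h3 : L.anchorV σ v + L.anchorA σ =
        anchorDerivation (L.contMDiff_hullAnchor σ) (v +ᵥ σ).toHull := by
      rw [AffineSection.toHull_vadd, map_add]
      rfl
    change _ = f x • L.bracketAVLinear (v +ᵥ σ) w x + (L.anchorV σ v + L.anchorA σ) f x • w x
    rw [h3]
    rfl
  rw [h1, h1, h2, bracketAVLinear_smul]
  module

/-- The derivation property says that the commutator of D and B(v, ·) is B(Dv, ·); comparing symbols
gives the claim when V has positive rank. In rank zero v is zero. -/
theorem anchorV_bracketAV (v : Cₛ^∞⟮𝓘(ℝ, EM); F, V⟯) (f : C^∞⟮𝓘(ℝ, EM), M; ℝ⟯) :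
    L.anchorV σ (L.bracketAVLinear σ v) f =
      L.anchorA σ (L.anchorV σ v f) - L.anchorV σ v (L.anchorA σ f) := by
  rcases subsingleton_or_nontrivial F with hF | hF
  · rw [section_eq_zero v]
    simp
  · refine (eq_of_forall_smul_section (F := F) (E := V) fun Z => ?_).symm
    refine symbol_commutator (map_add (L.bracketAVLinear σ)) (map_add (L.bracketVVLinear v))
      (L.bracketAVLinear_smul σ) (L.bracketVVLinear_smul σ v)
      (L.bracketVVLinear_smul σ (L.bracketAVLinear σ v)) (fun z => ?_) f Z
    have h1 := L.bracketAV_bracketVV σ v z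
    have h2 := L.bracketVV_skew (L.bracketAVLinear σ v) z
    simp only [← bracketAVLinear_apply, ← bracketVVLinear_apply] at h1 h2
    rw [h1, h2]
    abel

/-- The same comparison of symbols, now starting from the Jacobi identity of B. -/
theorem anchorV_bracketVV (v w : Cₛ^∞⟮𝓘(ℝ, EM); F, V⟯) (f : C^∞⟮𝓘(ℝ, EM), M; ℝ⟯) :
    L.anchorV σ (L.bracketVVLinear v w) f =
      L.anchorV σ v (L.anchorV σ w f) - L.anchorV σ w (L.anchorV σ v f) := by
  rcases subsingleton_or_nontrivial F with hF | hF
  · rw [section_eq_zero v]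
    simp
  · refine (eq_of_forall_smul_section (F := F) (E := V) fun Z => ?_).symm
    refine symbol_commutator (map_add (L.bracketVVLinear v)) (map_add (L.bracketVVLinear w))
      (L.bracketVVLinear_smul σ v) (L.bracketVVLinear_smul σ w)
      (L.bracketVVLinear_smul σ (L.bracketVVLinear v w)) (fun z => ?_) f Z
    have h1 := L.bracketVV_jacobi v w z
    have h2 := L.bracketVV_skew (L.bracketVVLinear v w) z
    have h3 := L.bracketVV_skew z v
    simp only [← bracketVVLinear_apply] at h1 h2 h3
    rw [h3, map_neg] at h1
    rw [h2]
    linear_combination (norm := module) h1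

/-- The Lie algebroid structure on the vector hull. -/
def hullAlgebroid : LieAlgebroid EM (F × ℝ) (VectorHull EM F V A) where
  anchor := L.hullAnchor σ
  contMDiff_anchor := L.contMDiff_hullAnchor σ
  bracket := ((extensionBracket (L.anchorA σ) (L.anchorV σ) (L.bracketAVLinear σ)
    L.bracketVVLinear).compl₁₂ (σ.hullEquiv.symm.toLinearMap.restrictScalars ℝ)
      (σ.hullEquiv.symm.toLinearMap.restrictScalars ℝ)).compr₂
        (σ.hullEquiv.toLinearMap.restrictScalars ℝ)
  skew X Y := by
    simp only [LinearMap.compr₂_apply, LinearMap.compl₁₂_apply, LinearMap.coe_restrictScalars,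
      LinearEquiv.coe_coe]
    rw [extensionBracket_skew L.bracketVV_skew, map_neg]
  jacobi X Y Z := by
    simp only [LinearMap.compr₂_apply, LinearMap.compl₁₂_apply, LinearMap.coe_restrictScalars,
      LinearEquiv.coe_coe, LinearEquiv.symm_apply_apply, ← map_add]
    rw [extensionBracket_jacobi (L.bracketAVLinear_smul σ) (L.bracketVVLinear_smul σ)
      (L.bracketAV_bracketVV σ) L.bracketVV_jacobi (L.anchorV_bracketAV σ) (L.anchorV_bracketVV σ),
      map_zero]
  leibniz X f Y x := by
    have h := extensionBracket_smul (L.bracketAVLinear_smul σ) (L.bracketVVLinear_smul σ)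
      (σ.hullEquiv.symm X) (σ.hullEquiv.symm Y) f
    rw [← anchorDerivation_hullEquiv, LinearEquiv.apply_symm_apply] at h
    have h' := congrArg σ.hullEquiv h
    rw [← map_smul, map_add, map_smul σ.hullEquiv, map_smul σ.hullEquiv,
      LinearEquiv.apply_symm_apply] at h'
    exact congrArg (fun s => s x) h'

theorem hullAlgebroid_bracket (X Y : Cₛ^∞⟮𝓘(ℝ, EM); F × ℝ, VectorHull EM F V A⟯) :
    (L.hullAlgebroid σ).bracket X Y = σ.hullEquiv (extensionBracket (L.anchorA σ) (L.anchorV σ)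
      (L.bracketAVLinear σ) L.bracketVVLinear (σ.hullEquiv.symm X) (σ.hullEquiv.symm Y)) := rfl

theorem isHull_hullAlgebroid : L.IsHull (L.hullAlgebroid σ) where
  anchor x a := L.hullAnchor_point σ x a
  bracket α β := by
    rw [hullAlgebroid_bracket, AffineSection.hullEquiv_symm_toHull,
      AffineSection.hullEquiv_symm_toHull, extensionBracket_apply]
    have h := L.bracket_vadd_vadd σ (α -ᵥ σ) (β -ᵥ σ)
    rw [vsub_vadd, vsub_vadd] at h
    rw [h, AffineSection.hullEquiv_apply]
    simp [← bracketAVLinear_apply, ← bracketVVLinear_apply, vectorToHullLinear_apply]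

end LieAffgebroid

namespace LieAffgebroid.IsHull

variable {L : LieAffgebroid EM F V A} {H : LieAlgebroid EM (F × ℝ) (VectorHull EM F V A)}

theorem anchor_eq (hH : L.IsHull H) (σ : AffineSection EM F V A) : H.anchor = L.hullAnchor σ := by
  funext x
  refine LinearMap.ext fun p => ?_
  have h : ∀ v : V x, H.anchor x (vector x v) = L.hullAnchor σ x (vector x v) := by
    intro v
    have h1 : vector (EM := EM) (F := F) x v = point x (v +ᵥ σ x : A x) - point x (σ x) :=
      eq_sub_of_add_eq ((point (EM := EM) (F := F) x).map_vadd (σ x) v).symm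
    rw [h1, map_sub, map_sub, hH.anchor, hH.anchor, hullAnchor_point, hullAnchor_point]
  rw [eq_vector_add_smul_point (σ x) p, map_add, map_add, map_smul, map_smul, h, hH.anchor,
    hullAnchor_point]

theorem bracket_toHull_vectorToHull (hH : L.IsHull H) (σ : AffineSection EM F V A)
    (v : Cₛ^∞⟮𝓘(ℝ, EM); F, V⟯) :
    H.bracket σ.toHull (vectorToHull A v) = vectorToHull A (L.bracketAV σ v) := by
  have h := hH.bracket σ (v +ᵥ σ)
  rw [AffineSection.toHull_vadd, map_add, hH.bracket, L.bracket_vadd_right] at h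
  simp only [← vectorToHullLinear_apply, map_add] at h ⊢
  exact add_right_cancel h

theorem bracket_vectorToHull_vectorToHull (hH : L.IsHull H) (v w : Cₛ^∞⟮𝓘(ℝ, EM); F, V⟯) :
    H.bracket (vectorToHull A v) (vectorToHull A w) = vectorToHull A (L.bracketVV v w) := by
  obtain ⟨σ⟩ : Nonempty (AffineSection EM F V A) := inferInstance
  have h := hH.bracket_toHull_vectorToHull (v +ᵥ σ) w
  rw [AffineSection.toHull_vadd, map_add, LinearMap.add_apply, hH.bracket_toHull_vectorToHull,
    L.bracketAV_vadd] at h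
  simp only [← vectorToHullLinear_apply, map_add] at h ⊢
  exact add_right_cancel h

theorem anchorDeriv_eq (hH : L.IsHull H) (σ : AffineSection EM F V A)
    (X : Cₛ^∞⟮𝓘(ℝ, EM); F × ℝ, VectorHull EM F V A⟯) (f : C^∞⟮𝓘(ℝ, EM), M; ℝ⟯) :
    H.anchorDeriv X f = anchorDerivation (L.contMDiff_hullAnchor σ) X f := by
  ext x
  change dirDeriv 𝓘(ℝ, EM) f x (H.anchor x (X x)) = _
  rw [hH.anchor_eq σ]
  rfl

/-- On σ and on sections of V the bracket is prescribed by the affgebroid, and the Leibniz rule with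
skew-symmetry extends it to all fσ + v. Hence the structure on the hull is unique and given by the
extension formula. -/
theorem bracket_hullEquiv (hH : L.IsHull H) (σ : AffineSection EM F V A)
    (X Y : C^∞⟮𝓘(ℝ, EM), M; ℝ⟯ × Cₛ^∞⟮𝓘(ℝ, EM); F, V⟯) :
    H.bracket (σ.hullEquiv X) (σ.hullEquiv Y) = σ.hullEquiv (extensionBracket (L.anchorA σ)
      (L.anchorV σ) (L.bracketAVLinear σ) L.bracketVVLinear X Y) := by
  have h1 : ∀ Z, H.bracket (σ.hullEquiv Z) σ.toHull =
      -((L.anchorA σ Z.1) • σ.toHull + vectorToHullLinear A (L.bracketAVLinear σ Z.2)) := by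
    intro Z
    rw [H.skew, AffineSection.hullEquiv_apply, map_add, H.bracket_smul, hH.bracket,
      L.bracket_self, hH.anchorDeriv_eq σ, vectorToHullLinear_apply,
      hH.bracket_toHull_vectorToHull, ← vectorToHullLinear_apply, map_zero, smul_zero, zero_add]
    rfl
  have h2 : H.bracket (σ.hullEquiv X) (vectorToHull A Y.2) =
      X.1 • vectorToHullLinear A (L.bracketAVLinear σ Y.2) - L.anchorV σ Y.2 X.1 • σ.toHull +
        vectorToHullLinear A (L.bracketVVLinear X.2 Y.2) := by
    rw [H.skew, AffineSection.hullEquiv_apply, map_add, H.bracket_smul, H.skew _ σ.toHull,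
      hH.bracket_toHull_vectorToHull, hH.anchorDeriv_eq σ, vectorToHullLinear_apply,
      H.skew (vectorToHull A Y.2), hH.bracket_vectorToHull_vectorToHull]
    change -(X.1 • -(vectorToHullLinear A (L.bracketAVLinear σ Y.2)) +
      L.anchorV σ Y.2 X.1 • σ.toHull + -(vectorToHullLinear A (L.bracketVVLinear X.2 Y.2))) = _
    module
  rw [AffineSection.hullEquiv_apply σ Y, map_add, H.bracket_smul, h1, vectorToHullLinear_apply Y.2, h2,
    hH.anchorDeriv_eq σ, anchorDerivation_hullEquiv, AffineSection.hullEquiv_apply,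
    extensionBracket_apply]
  simp only [map_add, map_sub, map_smul, Derivation.add_apply, Derivation.smul_apply, smul_eq_mul]
  module

theorem unique {H' : LieAlgebroid EM (F × ℝ) (VectorHull EM F V A)} (hH : L.IsHull H)
    (hH' : L.IsHull H') : H = H' := by
  obtain ⟨σ⟩ : Nonempty (AffineSection EM F V A) := inferInstance
  refine LieAlgebroid.ext ((hH.anchor_eq σ).trans (hH'.anchor_eq σ).symm)
    (LinearMap.ext fun X => LinearMap.ext fun Y => ?_)
  rw [← σ.hullEquiv.apply_symm_apply X, ← σ.hullEquiv.apply_symm_apply Y,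
    hH.bracket_hullEquiv, hH'.bracket_hullEquiv]

/-- The height function defines a closed one-form of the vector hull. -/
theorem height_bracket (hH : L.IsHull H) (X Y : Cₛ^∞⟮𝓘(ℝ, EM); F × ℝ, VectorHull EM F V A⟯) :
    (height EM F V A).smoothPairing (H.bracket X Y) =
      H.anchorDeriv X ((height EM F V A).smoothPairing Y) -
        H.anchorDeriv Y ((height EM F V A).smoothPairing X) := by
  obtain ⟨σ⟩ : Nonempty (AffineSection EM F V A) := inferInstance
  have h := hH.bracket_hullEquiv σ (σ.hullEquiv.symm X) (σ.hullEquiv.symm Y)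
  rw [LinearEquiv.apply_symm_apply, LinearEquiv.apply_symm_apply, ← LinearEquiv.symm_apply_eq] at h
  -- The function component of fσ + v is its height, and the function component of the extension
  -- bracket has the required form.
  have h' := congrArg Prod.fst h
  rw [extensionBracket_apply, ← anchorDerivation_hullEquiv, ← anchorDerivation_hullEquiv,
    LinearEquiv.apply_symm_apply, LinearEquiv.apply_symm_apply, ← hH.anchorDeriv_eq,
    ← hH.anchorDeriv_eq] at h'
  exact h'

end LieAffgebroid.IsHull

end HullAlgebroid

/-! ### Complete and vertical lifts as operations on test functions -/

section LieOnFunctions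

set_option linter.unusedSectionVars false

variable {EM : Type*} [NormedAddCommGroup EM] [NormedSpace ℝ EM] [FiniteDimensional ℝ EM]
  {M : Type*} [TopologicalSpace M] [T2Space M] [ChartedSpace EM M] [IsManifold 𝓘(ℝ, EM) ∞ M]
  {F : Type*} [NormedAddCommGroup F] [NormedSpace ℝ F] [FiniteDimensional ℝ F]
  {E : M → Type*} [∀ x, AddCommGroup (E x)] [∀ x, Module ℝ (E x)]
  [∀ x, TopologicalSpace (E x)] [TopologicalSpace (TotalSpace F E)] [FiberBundle F E]
  [VectorBundle ℝ F E] [ContMDiffVectorBundle ∞ F E 𝓘(ℝ, EM)]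

theorem DualSection.smoothPairing_sub (μ : DualSection EM F E) (Z Z' : Cₛ^∞⟮𝓘(ℝ, EM); F, E⟯) :
    μ.smoothPairing (Z - Z') = μ.smoothPairing Z - μ.smoothPairing Z' :=
  ContMDiffMap.ext fun x => map_sub (μ.toFun x) (Z x) (Z' x)

/-- The index of the derivative along the vertical lift of a section of a function that is constant
or linear on the fibres. -/
def verticalAction (Y : Cₛ^∞⟮𝓘(ℝ, EM); F, E⟯) :
    C^∞⟮𝓘(ℝ, EM), M; ℝ⟯ ⊕ DualSection EM F E → C^∞⟮𝓘(ℝ, EM), M; ℝ⟯ ⊕ DualSection EM F E :=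
  Sum.elim (fun _ => .inl 0) (fun μ => .inl (μ.smoothPairing Y))

theorem dirDeriv_basicOrLinear_verticalLift (Y : Cₛ^∞⟮𝓘(ℝ, EM); F, E⟯) (p : TotalSpace F E)
    (i : C^∞⟮𝓘(ℝ, EM), M; ℝ⟯ ⊕ DualSection EM F E) :
    dirDeriv (𝓘(ℝ, EM).prod 𝓘(ℝ, F)) (basicOrLinear i) p (verticalLift Y p) =
      basicOrLinear (verticalAction Y i) p := by
  cases i with
  | inl f => exact dirDeriv_basic_verticalLift Y p f
  | inr μ => exact dirDeriv_linear_verticalLift Y p μ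

namespace LieAlgebroid

variable (L : LieAlgebroid EM F E)

theorem anchorDeriv_sub (X : Cₛ^∞⟮𝓘(ℝ, EM); F, E⟯) (f g : C^∞⟮𝓘(ℝ, EM), M; ℝ⟯) :
    L.anchorDeriv X (f - g) = L.anchorDeriv X f - L.anchorDeriv X g :=
  ContMDiffMap.ext fun _ => dirDeriv_sub (f.contMDiff.mdifferentiableAt (by simp))
    (g.contMDiff.mdifferentiableAt (by simp)) _

theorem anchorDeriv_const (X : Cₛ^∞⟮𝓘(ℝ, EM); F, E⟯) (c : ℝ) :
    L.anchorDeriv X (ContMDiffMap.const c) = 0 :=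
  ContMDiffMap.ext fun _ => dirDeriv_const c _

/-- The Lie derivative of a section of the dual bundle. -/
def lieDeriv (X : Cₛ^∞⟮𝓘(ℝ, EM); F, E⟯) (μ : DualSection EM F E) : DualSection EM F E :=
  (L.exists_lieDeriv X μ).choose

theorem smoothPairing_lieDeriv (X : Cₛ^∞⟮𝓘(ℝ, EM); F, E⟯) (μ : DualSection EM F E)
    (Z : Cₛ^∞⟮𝓘(ℝ, EM); F, E⟯) : (L.lieDeriv X μ).smoothPairing Z =
      L.anchorDeriv X (μ.smoothPairing Z) - μ.smoothPairing (L.bracket X Z) :=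
  ContMDiffMap.ext fun x => (L.exists_lieDeriv X μ).choose_spec Z x

/-- The index of the derivative along the complete lift of a section of a function that is constant
or linear on the fibres. -/
def completeAction (X : Cₛ^∞⟮𝓘(ℝ, EM); F, E⟯) :
    C^∞⟮𝓘(ℝ, EM), M; ℝ⟯ ⊕ DualSection EM F E → C^∞⟮𝓘(ℝ, EM), M; ℝ⟯ ⊕ DualSection EM F E :=
  Sum.map (L.anchorDeriv X) (L.lieDeriv X)

variable {L}

theorem IsCompleteLift.dirDeriv_basicOrLinear {X : Cₛ^∞⟮𝓘(ℝ, EM); F, E⟯}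
    {W : SmoothVectorField (𝓘(ℝ, EM).prod 𝓘(ℝ, F)) (TotalSpace F E)} (h : L.IsCompleteLift X W)
    (p : TotalSpace F E) (i : C^∞⟮𝓘(ℝ, EM), M; ℝ⟯ ⊕ DualSection EM F E) :
    dirDeriv (𝓘(ℝ, EM).prod 𝓘(ℝ, F)) (basicOrLinear i) p (W p) =
      basicOrLinear (L.completeAction X i) p := by
  cases i with
  | inl f => exact h.basic f p
  | inr μ =>
    obtain ⟨x, v⟩ := p
    obtain ⟨Z, rfl⟩ := exists_section_apply_eq EM F v
    exact (h.linear μ Z x).trans (congrArg (fun f => f x) (L.smoothPairing_lieDeriv X μ Z)).symm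

variable (L)

/-- On functions of the base this is the homomorphism property of the anchor. On dual sections,
pairing with a section Z through the point cancels the mixed terms and leaves the homomorphism
property and the Jacobi identity. -/
theorem completeAction_commutator [Nontrivial F] (X Y : Cₛ^∞⟮𝓘(ℝ, EM); F, E⟯)
    (i : C^∞⟮𝓘(ℝ, EM), M; ℝ⟯ ⊕ DualSection EM F E) (p : TotalSpace F E) :
    basicOrLinear (L.completeAction X (L.completeAction Y i)) p -
      basicOrLinear (L.completeAction Y (L.completeAction X i)) p =
      basicOrLinear (L.completeAction (L.bracket X Y) i) p := by
  cases i with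
  | inl f => exact (congrArg (fun g => g p.1) (L.anchorDeriv_bracket X Y f)).symm
  | inr μ =>
    obtain ⟨x, v⟩ := p
    obtain ⟨Z, rfl⟩ := exists_section_apply_eq EM F v
    have h : (L.lieDeriv X (L.lieDeriv Y μ)).smoothPairing Z -
        (L.lieDeriv Y (L.lieDeriv X μ)).smoothPairing Z =
        (L.lieDeriv (L.bracket X Y) μ).smoothPairing Z := by
      simp only [smoothPairing_lieDeriv, anchorDeriv_sub, L.anchorDeriv_bracket,
        ← L.bracket_bracket, DualSection.smoothPairing_sub]
      abel
    exact congrArg (fun g => g x) h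

/-- On linear functions this is the defining formula of ℒ_X μ evaluated at Y; the Jacobi identity
plays no part. -/
theorem completeAction_verticalAction (X Y : Cₛ^∞⟮𝓘(ℝ, EM); F, E⟯)
    (i : C^∞⟮𝓘(ℝ, EM), M; ℝ⟯ ⊕ DualSection EM F E) (p : TotalSpace F E) :
    basicOrLinear (L.completeAction X (verticalAction Y i)) p -
      basicOrLinear (verticalAction Y (L.completeAction X i)) p =
      basicOrLinear (verticalAction (L.bracket X Y) i) p := by
  cases i with
  | inl f =>
    have h : L.anchorDeriv X 0 - 0 = 0 := (sub_zero _).trans (L.anchorDeriv_const X 0)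
    exact congrArg (fun g => g p.1) h
  | inr μ =>
    have h : L.anchorDeriv X (μ.smoothPairing Y) - (L.lieDeriv X μ).smoothPairing Y =
        μ.smoothPairing (L.bracket X Y) := by
      rw [smoothPairing_lieDeriv, sub_sub_cancel]
    exact congrArg (fun g => g p.1) h

end LieAlgebroid

end LieOnFunctions

/-! ### Lifts restricted to the affine bundle and their brackets -/

section LiftsToAffineBundle

set_option linter.unusedSectionVars false

variable {EM : Type*} [NormedAddCommGroup EM] [NormedSpace ℝ EM] [FiniteDimensional ℝ EM]
  {M : Type*} [TopologicalSpace M] [T2Space M] [SigmaCompactSpace M] [ChartedSpace EM M]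
  [IsManifold 𝓘(ℝ, EM) ∞ M]
  {F : Type*} [NormedAddCommGroup F] [NormedSpace ℝ F] [FiniteDimensional ℝ F]
  {V : M → Type*} [∀ x, AddCommGroup (V x)] [∀ x, Module ℝ (V x)]
  [∀ x, TopologicalSpace (V x)] [TopologicalSpace (TotalSpace F V)] [FiberBundle F V]
  [VectorBundle ℝ F V] [ContMDiffVectorBundle ∞ F V 𝓘(ℝ, EM)]
  {A : M → Type*} [∀ x, AddTorsor (V x) (A x)] [TopologicalSpace (TotalSpace F A)]
  [ChartedSpace (ModelProd EM F) (TotalSpace F A)]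
  [SmoothAffineBundle EM F V A]

open VectorHull

theorem VectorHull.smoothPairing_height_toHull (X : AffineSection EM F V A) :
    (height EM F V A).smoothPairing X.toHull = ContMDiffMap.const 1 := rfl

theorem VectorHull.smoothPairing_height_vectorToHull (Y : Cₛ^∞⟮𝓘(ℝ, EM); F, V⟯) :
    (height EM F V A).smoothPairing (vectorToHull A Y) = ContMDiffMap.const 0 := rfl

/-- Since the height h is closed, ℒ_X h is the differential of ⟨h, X⟩, which vanishes for a constant
pairing. The cases in view are c = 1 for sections of A and c = 0 for sections of V. -/
theorem LieAffgebroid.IsHull.lieDeriv_height {L : LieAffgebroid EM F V A}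
    {H : LieAlgebroid EM (F × ℝ) (VectorHull EM F V A)} (hH : L.IsHull H)
    {X : Cₛ^∞⟮𝓘(ℝ, EM); F × ℝ, VectorHull EM F V A⟯} {c : ℝ}
    (hX : (height EM F V A).smoothPairing X = ContMDiffMap.const c)
    (p : TotalSpace (F × ℝ) (VectorHull EM F V A)) :
    (H.lieDeriv X (height EM F V A)).linearFun p = 0 := by
  obtain ⟨x, v⟩ := p
  obtain ⟨Z, rfl⟩ := exists_section_apply_eq EM (F × ℝ) v
  have h := H.smoothPairing_lieDeriv X (height EM F V A) Z
  rw [hH.height_bracket, sub_sub_cancel, hX, H.anchorDeriv_const] at h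
  exact congrArg (fun g => g x) h

variable [IsManifold (𝓘(ℝ, EM).prod 𝓘(ℝ, F)) ∞ (TotalSpace F A)]

theorem LieAffgebroid.IsHull.exists_restriction_completeLift {L : LieAffgebroid EM F V A}
    {H : LieAlgebroid EM (F × ℝ) (VectorHull EM F V A)} (hH : L.IsHull H)
    {X : Cₛ^∞⟮𝓘(ℝ, EM); F × ℝ, VectorHull EM F V A⟯} {c : ℝ}
    (hX : (height EM F V A).smoothPairing X = ContMDiffMap.const c)
    {W' : SmoothVectorField (𝓘(ℝ, EM).prod 𝓘(ℝ, F × ℝ)) (TotalSpace (F × ℝ) (VectorHull EM F V A))}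
    (hW' : H.IsCompleteLift X W') :
    ∃ W₀ : SmoothVectorField (𝓘(ℝ, EM).prod 𝓘(ℝ, F)) (TotalSpace F A),
      ∀ W, IsRestriction W' W ↔ W = W₀ := by
  refine exists_restriction (fun a => ?_) fun i => ?_
  · exact (hW'.dirDeriv_basicOrLinear _ (.inr (height EM F V A))).trans (hH.lieDeriv_height hX _)
  · simp only [hW'.dirDeriv_basicOrLinear]
    exact contMDiff_basicOrLinear _

theorem exists_restriction_verticalLift (Y : Cₛ^∞⟮𝓘(ℝ, EM); F, V⟯) :
    ∃ W₀ : SmoothVectorField (𝓘(ℝ, EM).prod 𝓘(ℝ, F)) (TotalSpace F A),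
      ∀ W, IsRestriction (verticalLift (vectorToHull A Y)) W ↔ W = W₀ := by
  refine exists_restriction (fun a => ?_) fun i => ?_
  · exact dirDeriv_linear_verticalLift _ _ _
  · simp only [dirDeriv_basicOrLinear_verticalLift]
    exact contMDiff_basicOrLinear _

/-- The bracket of restrictions of vector fields to `A` can be computed on the functions that are
constant or linear on the fibres of the vector hull. -/
theorem IsRestriction.mlieBracket_eq {W₁' W₂' W₃' : ∀ p : TotalSpace (F × ℝ) (VectorHull EM F V A),
      TangentSpace (𝓘(ℝ, EM).prod 𝓘(ℝ, F × ℝ)) p}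
    {W₁ W₂ W₃ : SmoothVectorField (𝓘(ℝ, EM).prod 𝓘(ℝ, F)) (TotalSpace F A)}
    (h₁ : IsRestriction W₁' W₁) (h₂ : IsRestriction W₂' W₂) (h₃ : IsRestriction W₃' W₃)
    {T₁ T₂ T₃ : C^∞⟮𝓘(ℝ, EM), M; ℝ⟯ ⊕ DualSection EM (F × ℝ) (VectorHull EM F V A) →
      C^∞⟮𝓘(ℝ, EM), M; ℝ⟯ ⊕ DualSection EM (F × ℝ) (VectorHull EM F V A)}
    (hT₁ : ∀ p i, dirDeriv (𝓘(ℝ, EM).prod 𝓘(ℝ, F × ℝ)) (basicOrLinear i) p (W₁' p) =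
      basicOrLinear (T₁ i) p)
    (hT₂ : ∀ p i, dirDeriv (𝓘(ℝ, EM).prod 𝓘(ℝ, F × ℝ)) (basicOrLinear i) p (W₂' p) =
      basicOrLinear (T₂ i) p)
    (hT₃ : ∀ p i, dirDeriv (𝓘(ℝ, EM).prod 𝓘(ℝ, F × ℝ)) (basicOrLinear i) p (W₃' p) =
      basicOrLinear (T₃ i) p)
    (hT : ∀ i p, basicOrLinear (T₁ (T₂ i)) p - basicOrLinear (T₂ (T₁ i)) p =
      basicOrLinear (T₃ i) p) :
    VectorField.mlieBracket (𝓘(ℝ, EM).prod 𝓘(ℝ, F)) W₁ W₂ = W₃ := by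
  funext a
  refine sub_eq_zero.1 (eq_zero_of_basicOrLinear_comp_embed a _ fun i => ?_)
  -- A restricted field acts on restricted test functions through the same operation on indices as
  -- on the hull, so iterated derivatives stay within the test functions.
  have key : ∀ {W' : ∀ p : TotalSpace (F × ℝ) (VectorHull EM F V A),
        TangentSpace (𝓘(ℝ, EM).prod 𝓘(ℝ, F × ℝ)) p}
      {W : SmoothVectorField (𝓘(ℝ, EM).prod 𝓘(ℝ, F)) (TotalSpace F A)}
      {T : C^∞⟮𝓘(ℝ, EM), M; ℝ⟯ ⊕ DualSection EM (F × ℝ) (VectorHull EM F V A) →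
        C^∞⟮𝓘(ℝ, EM), M; ℝ⟯ ⊕ DualSection EM (F × ℝ) (VectorHull EM F V A)},
      IsRestriction W' W → (∀ p i, dirDeriv (𝓘(ℝ, EM).prod 𝓘(ℝ, F × ℝ)) (basicOrLinear i) p (W' p) =
        basicOrLinear (T i) p) → ∀ i, (fun b => dirDeriv (𝓘(ℝ, EM).prod 𝓘(ℝ, F))
          (fun b => basicOrLinear (EM := EM) i (embed EM F V A b)) b (W b)) =
        fun b => basicOrLinear (EM := EM) (T i) (embed EM F V A b) := fun h hT i =>
    funext fun b => (h.dirDeriv_eq i b).trans (hT _ i)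
  have hd : ∀ (i) (b : TotalSpace F A), MDifferentiableAt (𝓘(ℝ, EM).prod 𝓘(ℝ, F)) 𝓘(ℝ, ℝ)
      (fun b => basicOrLinear (EM := EM) i (embed EM F V A b)) b := fun i b =>
    (contMDiff_basicOrLinear_comp_embed i).mdifferentiableAt (by simp)
  rw [dirDeriv_vec_sub, dirDeriv_mlieBracket (W₁.contMDiff.mdifferentiableAt (by simp))
    (W₂.contMDiff.mdifferentiableAt (by simp)) (contMDiff_basicOrLinear_comp_embed i)
    (by rw [key h₁ hT₁]; exact hd _ _) (by rw [key h₂ hT₂]; exact hd _ _), key h₁ hT₁,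
    key h₂ hT₂, sub_eq_zero]
  refine (congrArg₂ (· - ·) (congrFun (key h₁ hT₁ (T₂ i)) a) (congrFun (key h₂ hT₂ (T₁ i)) a)).trans ?_
  exact (hT i _).trans (congrFun (key h₃ hT₃ i) a).symm

end LiftsToAffineBundle

end

theorem theorem12 {EM : Type*} [NormedAddCommGroup EM] [NormedSpace ℝ EM] [FiniteDimensional ℝ EM]
    {M : Type*} [TopologicalSpace M] [T2Space M] [SigmaCompactSpace M] [ChartedSpace EM M]
    [IsManifold 𝓘(ℝ, EM) ∞ M]
    {F : Type*} [NormedAddCommGroup F] [NormedSpace ℝ F] [FiniteDimensional ℝ F]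
    {V : M → Type*} [∀ x, AddCommGroup (V x)] [∀ x, Module ℝ (V x)]
    [∀ x, TopologicalSpace (V x)] [TopologicalSpace (TotalSpace F V)] [FiberBundle F V]
    [VectorBundle ℝ F V] [ContMDiffVectorBundle ∞ F V 𝓘(ℝ, EM)]
    {A : M → Type*} [∀ x, AddTorsor (V x) (A x)] [TopologicalSpace (TotalSpace F A)]
    [ChartedSpace (ModelProd EM F) (TotalSpace F A)]
    [IsManifold (𝓘(ℝ, EM).prod 𝓘(ℝ, F)) ∞ (TotalSpace F A)]
    [SmoothAffineBundle EM F V A]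
    (L : LieAffgebroid EM F V A) :
    ∃ H : LieAlgebroid EM (F × ℝ) (VectorHull EM F V A),
      (∀ H' : LieAlgebroid EM (F × ℝ) (VectorHull EM F V A), L.IsHull H' ↔ H' = H) ∧
    ∃ complete : Cₛ^∞⟮𝓘(ℝ, EM); F × ℝ, VectorHull EM F V A⟯ →
        SmoothVectorField (𝓘(ℝ, EM).prod 𝓘(ℝ, F × ℝ)) (TotalSpace (F × ℝ) (VectorHull EM F V A)),
      (∀ X W, H.IsCompleteLift X W ↔ W = complete X) ∧
    ∃ (completeA : AffineSection EM F V A →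
        SmoothVectorField (𝓘(ℝ, EM).prod 𝓘(ℝ, F)) (TotalSpace F A))
      (completeV verticalV : Cₛ^∞⟮𝓘(ℝ, EM); F, V⟯ →
        SmoothVectorField (𝓘(ℝ, EM).prod 𝓘(ℝ, F)) (TotalSpace F A)),
      (∀ X W, IsRestriction (complete X.toHull) W ↔ W = completeA X) ∧
      (∀ Y W, IsRestriction (complete (vectorToHull A Y)) W ↔ W = completeV Y) ∧
      (∀ Y W, IsRestriction (verticalLift (vectorToHull A Y)) W ↔ W = verticalV Y) ∧
      (∀ X₁ X₂, VectorField.mlieBracket (𝓘(ℝ, EM).prod 𝓘(ℝ, F)) (completeA X₁) (completeA X₂) =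
        completeV (L.bracket X₁ X₂)) ∧
      (∀ Y₁ Y₂, VectorField.mlieBracket (𝓘(ℝ, EM).prod 𝓘(ℝ, F)) (completeV Y₁) (completeV Y₂) =
        completeV (L.bracketVV Y₁ Y₂)) ∧
      (∀ X Y, VectorField.mlieBracket (𝓘(ℝ, EM).prod 𝓘(ℝ, F)) (completeA X) (verticalV Y) =
        verticalV (L.bracketAV X Y)) ∧
      (∀ Y₁ Y₂, VectorField.mlieBracket (𝓘(ℝ, EM).prod 𝓘(ℝ, F)) (verticalV Y₁) (verticalV Y₂) =
        0) := by 
  obtain ⟨σ⟩ : Nonempty (AffineSection EM F V A) := inferInstance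
  have hH := L.isHull_hullAlgebroid σ
  -- From here on only the extension property of `H` is used, so the choice of σ no longer matters.
  generalize L.hullAlgebroid σ = H at hH
  refine ⟨H, fun H' => ⟨fun h => h.unique hH, fun h => h ▸ hH⟩, ?_⟩
  choose complete hcomplete using H.exists_completeLift
  refine ⟨complete, fun X W => ⟨fun h => h.unique (hcomplete X), fun h => h ▸ hcomplete X⟩, ?_⟩
  choose completeA hA using fun X : AffineSection EM F V A =>
    hH.exists_restriction_completeLift (VectorHull.smoothPairing_height_toHull X)
      (hcomplete X.toHull)
  choose completeV hV using fun Y : Cₛ^∞⟮𝓘(ℝ, EM); F, V⟯ =>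
    hH.exists_restriction_completeLift (VectorHull.smoothPairing_height_vectorToHull (A := A) Y)
      (hcomplete (vectorToHull A Y))
  choose verticalV hv using exists_restriction_verticalLift (EM := EM) (F := F) (V := V) (A := A)
  have rA := fun X => (hA X _).2 rfl
  have rV := fun Y => (hV Y _).2 rfl
  have rv := fun Y => (hv Y _).2 rfl
  refine ⟨completeA, completeV, verticalV, hA, hV, hv, fun X₁ X₂ => ?_, fun Y₁ Y₂ => ?_,
    fun X Y => ?_, fun Y₁ Y₂ => ?_⟩
  -- The model fibre `F × ℝ` of the hull is nontrivial even if V has rank zero, so the homomorphism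
  -- property of the anchor is available in all ranks.
  · exact (rA X₁).mlieBracket_eq (rA X₂) (rV _) (hcomplete _).dirDeriv_basicOrLinear
      (hcomplete _).dirDeriv_basicOrLinear (hcomplete _).dirDeriv_basicOrLinear
      (hH.bracket X₁ X₂ ▸ H.completeAction_commutator X₁.toHull X₂.toHull)
  · exact (rV Y₁).mlieBracket_eq (rV Y₂) (rV _) (hcomplete _).dirDeriv_basicOrLinear
      (hcomplete _).dirDeriv_basicOrLinear (hcomplete _).dirDeriv_basicOrLinear
      (hH.bracket_vectorToHull_vectorToHull Y₁ Y₂ ▸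
        H.completeAction_commutator (vectorToHull A Y₁) (vectorToHull A Y₂))
  · exact (rA X).mlieBracket_eq (rv Y) (rv _) (hcomplete _).dirDeriv_basicOrLinear
      (fun p i => dirDeriv_basicOrLinear_verticalLift _ p i)
      (fun p i => dirDeriv_basicOrLinear_verticalLift _ p i)
      (hH.bracket_toHull_vectorToHull X Y ▸
        H.completeAction_verticalAction X.toHull (vectorToHull A Y))
  -- A vertical lift makes a linear function basic and kills basic ones, so both iterated
  -- derivatives are zero and the zero field is the bracket.
  · exact (rv Y₁).mlieBracket_eq (rv Y₂) (W₃ := 0) (W₃' := 0) (fun a => map_zero _)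
      (fun p i => dirDeriv_basicOrLinear_verticalLift _ p i)
      (fun p i => dirDeriv_basicOrLinear_verticalLift _ p i)
      (T₃ := fun _ => .inl 0) (fun p i => dirDeriv_vec_zero)
      (fun i p => by cases i <;> exact sub_zero _)
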